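/- Let $G$ be a locally compact étale groupoid, not necessarily Hausdorff, with Hausdorff unit space $G^0$; étale means that the topology of $G$ has a basis of open bisections, i.e. open sets $u\subseteq G$ on which the range and source maps $r,s$ restrict to homeomorphisms onto open subsets of $G^0$. The set $\mathrm{Bis}(G)$ of open bisections is an inverse monoid with product $uv=\{gh : g\in u,\ h\in v,\ s(g)=r(h)\}$, involution $u^*=u^{-1}$ and unit $1=G^0$. Let $S\subseteq \mathrm{Bis}(G)$ be an inverse subsemigroup containing $G^0$ that is wide: $\bigcup_{u\in S}u=G$, and whenever $g\in u\cap v$ with $u,v\in S$ there is $w\in S$ with $g\in w\subseteq u\cap v$. Let $\mathcal A=(A_g)_{g\in G}$ be a Fell bundle over $G$, i.e. an upper semicontinuous Banach bundle with continuous multiplications $A_g\times A_h\to A_{gh}$ and continuous involutions $A_g\to A_{g^{-1}}$ satisfying the usual algebraic axioms, $\|ab\|\le\|a\|\|b\|$, $\|a^*a\|=\|a\|^2$ and $a^*a\ge 0$ in the $C^*$-algebra $A_{s(g)}$ for $a\in A_g$; $\mathcal A$ need not be saturated or separable. Let $C_c(\mathcal A)$ be the linear span of the sections $f$ of $\mathcal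 A$ for which there are an open bisection $u$ and a compact $K\subseteq u$ such that $f$ is continuous on $u$ and vanishes outside $K$, and let $C_c(G,r^*(\mathcal A^0))$ be defined in the same way from the functions $\xi$ on $G$ with $\xi(g)\in A_{r(g)}$. Write $G^x=r^{-1}(x)$. The bundle $\mathcal A$ has the *approximation property* if there is a net $(\xi_i)_{i\in I}$ in $C_c(G,r^*(\mathcal A^0))$ such that 1. $\sup_{i\in I}\sup_{x\in G^0}\bigl\|\sum_{g\in G^x}\xi_i(g)^*\xi_i(g)\bigr\|<\infty$, and 2. for every $f\in C_c(\mathcal A)$, the sections $g\mapsto\sum_{h\in G^{s(g)}}\xi_i(gh)^*f(g)\,\xi_i(h)$ converge to $f$ uniformly on compact subsets of $G$. Let $\mathcal B=(B_u)_{u\in S}$ be the Fell bundle over $S$ associated to $\mathcal A$: $B_u$ is the Banach space of continuous sections $u\to\mathcal A$ vanishing at infinity, with the multiplications $B_u\times B_v\to B_{uv}$, $(f\cdot f')(gh)=f(g)f'(h)$, the involutions $B_u\to B_{u^*}$, $f^*(g)=f(g^{-1})^*$, and the inclusions $B_u\subseteq B_v$ for $u\subseteq v$ by extension by zero. For $u\in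 S$ let $I_{u,1}$ be the closed ideal of the $C^*$-algebra $B_1=B_{G^0}$ generated by the $B_{v^*v}$ with $v\in S$, $v\le u$ and $v\le 1$ in the natural partial order of $S$, and let $1_u$ be the unit of $I_{u,1}''\subseteq B_1''$, where $''$ denotes biduals. The bundle $\mathcal B$ has the *approximation property* if there is a net $(\xi_i)_{i\in I}$ of finitely supported functions $\xi_i\colon S\to B_1$ with $\xi_i(t)\in B_{tt^*}$ for all $t\in S$, such that 1. $\sup_{i\in I}\bigl\|\sum_{p,t\in S}\xi_i(p)^*\xi_i(t)\,1_{pt^*}\bigr\|<\infty$ in $B_1''$, and 2. for all $u\in S$ and $a\in B_u$, $\sum_{p,t\in S}1_{p(ut)^*}\,\xi_i(p)^*a\,\xi_i(t)\to a$ in the norm of $B_u''$. Then $\mathcal A$ has the approximation property if and only if $\mathcal B$ has the approximation property. -/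

import Mathlib

universe u v

section

open Topology Filter
open scoped ENNReal

/-! ### Topological groupoids and their open bisections -/

/-- A topological groupoid: a small category with inverses, presented by its set of arrows `G`
(objects are identified with the identity arrows), such that multiplication, defined on
composable pairs, and inversion are continuous.  No separation axiom is imposed. -/
class TopGroupoid (G : Type u) [TopologicalSpace G] where
  src : G → G
  rng : G → G
  gmul : ∀ g h : G, src g = rng h → G
  ginv : G → G
  src_src : ∀ g, src (src g) = src g
  rng_src : ∀ g, rng (src g) = src g
  src_rng : ∀ g, src (rng g) = rng g
  rng_rng : ∀ g, rng (rng g) = rng g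
  src_gmul : ∀ g h hc, src (gmul g h hc) = src h
  rng_gmul : ∀ g h hc, rng (gmul g h hc) = rng g
  gmul_assoc : ∀ g h k (hgh : src g = rng h) (hhk : src h = rng k),
    gmul (gmul g h hgh) k ((src_gmul g h hgh).trans hhk) =
      gmul g (gmul h k hhk) (hgh.trans (rng_gmul h k hhk).symm)
  gmul_src : ∀ g, gmul g (src g) (rng_src g).symm = g
  rng_gmul_self : ∀ g, gmul (rng g) g (src_rng g) = g
  src_ginv : ∀ g, src (ginv g) = rng g
  rng_ginv : ∀ g, rng (ginv g) = src g
  gmul_ginv : ∀ g, gmul g (ginv g) (rng_ginv g).symm = rng g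
  ginv_gmul : ∀ g, gmul (ginv g) g (src_ginv g) = src g
  continuous_gmul : Continuous fun p : {p : G × G // src p.1 = rng p.2} => gmul p.1.1 p.1.2 p.2
  continuous_ginv : Continuous ginv

namespace TopGroupoid

variable {G : Type u} [TopologicalSpace G] [TopGroupoid G]

/-- `IsMul g h k`: the pair `(g, h)` is composable and `gh = k`. -/
def IsMul (g h k : G) : Prop := ∃ hc : src g = rng h, gmul g h hc = k

variable (G) in
/-- The unit space `G⁰`. -/
def units : Set G := {x | src x = x}

theorem rng_of_unit {x : G} (hx : x ∈ units G) : rng x = x := by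
  have h : src x = x := hx
  rw [← h, rng_src]

theorem rng_mem_units (g : G) : rng g ∈ units G := src_rng g

theorem src_mem_units (g : G) : src g ∈ units G := src_src g

theorem IsMul.src_eq {g h k : G} (H : IsMul g h k) : src k = src h := by
  obtain ⟨hc, rfl⟩ := H; exact src_gmul _ _ _

theorem IsMul.rng_eq {g h k : G} (H : IsMul g h k) : rng k = rng g := by
  obtain ⟨hc, rfl⟩ := H; exact rng_gmul _ _ _

theorem IsMul.comp {g h k : G} (H : IsMul g h k) : src g = rng h := H.1

theorem IsMul.unique {g h k k' : G} (H : IsMul g h k) (H' : IsMul g h k') : k = k' := by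
  obtain ⟨hc, rfl⟩ := H; obtain ⟨hc', rfl⟩ := H'; rfl

theorem isMul_gmul {g h : G} (hc : src g = rng h) : IsMul g h (gmul g h hc) := ⟨hc, rfl⟩

theorem isMul_ginv (g : G) : IsMul g (ginv g) (rng g) := ⟨_, gmul_ginv g⟩

theorem isMul_ginv_left (g : G) : IsMul (ginv g) g (src g) := ⟨_, ginv_gmul g⟩

theorem isMul_src (g : G) : IsMul g (src g) g := ⟨_, gmul_src g⟩

theorem isMul_rng (g : G) : IsMul (rng g) g g := ⟨_, rng_gmul_self g⟩

theorem IsMul.assoc_right {g h k gh hk ghk : G} (h1 : IsMul g h gh) (h2 : IsMul gh k ghk)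
    (h3 : IsMul h k hk) : IsMul g hk ghk := by
  obtain ⟨c1, rfl⟩ := h1; obtain ⟨c2, rfl⟩ := h2; obtain ⟨c3, rfl⟩ := h3
  exact ⟨_, (gmul_assoc g h k c1 c3).symm⟩

theorem IsMul.assoc_left {g h k gh hk ghk : G} (h1 : IsMul g h gh) (h3 : IsMul h k hk)
    (h4 : IsMul g hk ghk) : IsMul gh k ghk := by
  obtain ⟨c1, rfl⟩ := h1; obtain ⟨c3, rfl⟩ := h3; obtain ⟨c4, rfl⟩ := h4
  exact ⟨_, gmul_assoc g h k c1 c3⟩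

/-- `gh = k` implies `g⁻¹k = h`. -/
theorem IsMul.inv_left {g h k : G} (H : IsMul g h k) : IsMul (ginv g) k h := by
  have h1 := isMul_ginv_left g
  have h2 : IsMul (src g) h h := by rw [H.comp]; exact isMul_rng h
  exact h1.assoc_right h2 H

/-- `gh = k` implies `kh⁻¹ = g`. -/
theorem IsMul.inv_right {g h k : G} (H : IsMul g h k) : IsMul k (ginv h) g := by
  have h1 := isMul_ginv h
  have h2 : IsMul g (rng h) g := by rw [← H.comp]; exact isMul_src g
  exact H.assoc_left h1 h2

theorem IsMul.left_cancel {g h h' k : G} (H : IsMul g h k) (H' : IsMul g h' k) : h = h' :=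
  H.inv_left.unique H'.inv_left

theorem IsMul.right_cancel {g g' h k : G} (H : IsMul g h k) (H' : IsMul g' h k) : g = g' :=
  H.inv_right.unique H'.inv_right

theorem ginv_ginv (g : G) : ginv (ginv g) = g := by
  have h1 := (isMul_ginv_left g).inv_left
  have h2 : IsMul (ginv (ginv g)) (src g) (ginv (ginv g)) := by
    have := isMul_src (ginv (ginv g))
    rwa [src_ginv, rng_ginv] at this
  exact h2.unique h1

theorem IsMul.inv {g h k : G} (H : IsMul g h k) :
    IsMul (ginv h) (ginv g) (ginv k) := by
  have h1 := H.inv_right.inv_left.inv_right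
  exact h1

theorem ginv_of_unit {x : G} (hx : x ∈ units G) : ginv x = x := by
  have h1 : IsMul (ginv x) x x := by
    have := isMul_ginv_left x
    rwa [show src x = x from hx] at this
  have h2 : IsMul x x x := by
    have := isMul_src x
    rwa [show src x = x from hx] at this
  exact h1.right_cancel h2

theorem isMul_unit {x : G} (hx : x ∈ units G) : IsMul x x x := by
  have := isMul_src x
  rwa [show src x = x from hx] at this

theorem continuous_rng : Continuous (rng : G → G) := by
  have h : (rng : G → G) = fun g => gmul g (ginv g) (rng_ginv g).symm :=
    funext fun g => (gmul_ginv g).symm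
  rw [h]
  exact continuous_gmul.comp (f := fun g : G =>
    (⟨(g, ginv g), (rng_ginv g).symm⟩ : {p : G × G // src p.1 = rng p.2}))
    (Continuous.subtype_mk (continuous_id.prodMk continuous_ginv) _)

theorem continuous_src : Continuous (src : G → G) := by
  have h : (src : G → G) = fun g => rng (ginv g) := funext fun g => (rng_ginv g).symm
  rw [h]
  exact continuous_rng.comp continuous_ginv

/-- An open bisection: an open set on which range and source are homeomorphisms onto open
subsets of the unit space. -/
structure IsOpenBisection (u : Set G) : Prop where
  isOpen : IsOpen u
  rng_emb : IsOpenEmbedding fun g : u => (⟨rng g.1, rng_mem_units g.1⟩ : units G)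
  src_emb : IsOpenEmbedding fun g : u => (⟨src g.1, src_mem_units g.1⟩ : units G)

theorem IsOpenBisection.rng_inj {u : Set G} (hu : IsOpenBisection u) {g h : G} (hg : g ∈ u)
    (hh : h ∈ u) (e : rng g = rng h) : g = h := by
  have := @hu.rng_emb.injective ⟨g, hg⟩ ⟨h, hh⟩ (Subtype.ext e)
  exact congrArg Subtype.val this

theorem IsOpenBisection.src_inj {u : Set G} (hu : IsOpenBisection u) {g h : G} (hg : g ∈ u)
    (hh : h ∈ u) (e : src g = src h) : g = h := by
  have := @hu.src_emb.injective ⟨g, hg⟩ ⟨h, hh⟩ (Subtype.ext e)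
  exact congrArg Subtype.val this

end TopGroupoid

open TopGroupoid

/-- A topological groupoid is étale if its topology has a basis of open bisections. -/
class EtaleGroupoid (G : Type u) [TopologicalSpace G] [TopGroupoid G] : Prop where
  isTopologicalBasis : TopologicalSpace.IsTopologicalBasis {u : Set G | IsOpenBisection u}

namespace EtaleGroupoid

variable {G : Type u} [TopologicalSpace G] [TopGroupoid G] [EtaleGroupoid G]

theorem exists_bisection {g : G} {U : Set G} (hU : IsOpen U) (hg : g ∈ U) :
    ∃ u, IsOpenBisection u ∧ g ∈ u ∧ u ⊆ U :=
  isTopologicalBasis.exists_subset_of_mem_open hg hU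

theorem isOpen_units : IsOpen (units G) := by
  rw [isOpen_iff_forall_mem_open]
  intro x hx
  obtain ⟨u, hu, hxu, -⟩ := exists_bisection (isOpen_univ : IsOpen (Set.univ : Set G)) (Set.mem_univ x)
  refine ⟨u ∩ rng ⁻¹' u, ?_, hu.isOpen.inter (hu.isOpen.preimage continuous_rng), hxu, ?_⟩
  · rintro g ⟨hg, hrg⟩
    have : rng g = g := hu.rng_inj hrg hg (rng_rng g)
    rw [← this]; exact rng_mem_units g
  · simpa [rng_of_unit hx] using hxu

theorem isOpenMap_rng : IsOpenMap fun g : G => (⟨rng g, rng_mem_units g⟩ : units G) := by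
  rw [isTopologicalBasis.isOpenMap_iff]
  intro u hu
  have : (fun g : G => (⟨rng g, rng_mem_units g⟩ : units G)) '' u =
      Set.range fun g : u => (⟨rng g.1, rng_mem_units g.1⟩ : units G) := by
    exact Set.image_eq_range _ _
  rw [this]
  exact hu.rng_emb.isOpen_range

theorem isOpenMap_src : IsOpenMap fun g : G => (⟨src g, src_mem_units g⟩ : units G) := by
  rw [isTopologicalBasis.isOpenMap_iff]
  intro u hu
  have : (fun g : G => (⟨src g, src_mem_units g⟩ : units G)) '' u =
      Set.range fun g : u => (⟨src g.1, src_mem_units g.1⟩ : units G) := by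
    exact Set.image_eq_range _ _
  rw [this]
  exact hu.src_emb.isOpen_range

theorem isOpenBisection_of_injOn {u : Set G} (ho : IsOpen u) (hr : Set.InjOn rng u)
    (hs : Set.InjOn src u) : IsOpenBisection u := by
  refine ⟨ho, ?_, ?_⟩
  · refine IsOpenEmbedding.of_continuous_injective_isOpenMap ?_ ?_ ?_
    · exact (continuous_rng.comp continuous_subtype_val).subtype_mk _
    · intro g h e
      exact Subtype.ext (hr g.2 h.2 (congrArg Subtype.val e))
    · exact isOpenMap_rng.comp ho.isOpenMap_subtype_val
  · refine IsOpenEmbedding.of_continuous_injective_isOpenMap ?_ ?_ ?_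
    · exact (continuous_src.comp continuous_subtype_val).subtype_mk _
    · intro g h e
      exact Subtype.ext (hs g.2 h.2 (congrArg Subtype.val e))
    · exact isOpenMap_src.comp ho.isOpenMap_subtype_val

end EtaleGroupoid

/-- An inverse semigroup with unit; `s⁻¹` is the generalised inverse, usually written `s^*`. -/
class InverseMonoid (S : Type u) extends Monoid S, Inv S where
  mul_inv_mul : ∀ s : S, s * s⁻¹ * s = s
  inv_mul_inv : ∀ s : S, s⁻¹ * s * s⁻¹ = s⁻¹
  eq_inv : ∀ s t : S, s * t * s = s → t * s * t = t → t = s⁻¹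

namespace InverseMonoid

variable {S : Type u} [InverseMonoid S]

/-- The natural partial order: `s ≤ t` iff `s = te` for some idempotent `e`. -/
def NatLE (s t : S) : Prop := ∃ e : S, e * e = e ∧ t * e = s

theorem natLE_of_eq {s t : S} (h : s = t) : NatLE s t := ⟨1, one_mul 1, by rw [h, mul_one]⟩

theorem mul_inv_natLE_one (s : S) : NatLE (s * s⁻¹) 1 :=
  ⟨s * s⁻¹, by rw [← mul_assoc, mul_inv_mul], one_mul _⟩

theorem inv_mul_natLE_one (s : S) : NatLE (s⁻¹ * s) 1 :=
  ⟨s⁻¹ * s, by rw [← mul_assoc, inv_mul_inv], one_mul _⟩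

theorem one_inv : (1 : S)⁻¹ = 1 := (eq_inv 1 1 (by simp) (by simp)).symm

end InverseMonoid

open InverseMonoid

/-- The set `Bis(G)` of open bisections of `G`. -/
structure Bis (G : Type u) [TopologicalSpace G] [TopGroupoid G] where
  carrier : Set G
  isOpenBisection : IsOpenBisection carrier

namespace Bis

open EtaleGroupoid

variable {G : Type u} [TopologicalSpace G] [TopGroupoid G]

instance : Membership G (Bis G) := ⟨fun u g => g ∈ u.1⟩

theorem mem_val {u : Bis G} {g : G} : g ∈ u.1 ↔ g ∈ u := Iff.rfl

theorem ext {u v : Bis G} (h : ∀ g, g ∈ u ↔ g ∈ v) : u = v := by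
  cases u; cases v
  congr 1
  exact Set.ext h

theorem rng_inj (u : Bis G) {g h : G} (hg : g ∈ u) (hh : h ∈ u) (e : rng g = rng h) : g = h :=
  u.2.rng_inj hg hh e

theorem src_inj (u : Bis G) {g h : G} (hg : g ∈ u) (hh : h ∈ u) (e : src g = src h) : g = h :=
  u.2.src_inj hg hh e

/-- The arrow of the bisection `u` with the same range as `k` (and `k` itself if there is none). -/
noncomputable def lift (u : Bis G) (k : G) : G :=
  open Classical in if h : ∃ g, g ∈ u ∧ rng g = rng k then h.choose else k

theorem lift_eq (u : Bis G) {k g : G} (hg : g ∈ u) (e : rng g = rng k) : u.lift k = g := by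
  have h : ∃ g, g ∈ u ∧ rng g = rng k := ⟨g, hg, e⟩
  have : u.lift k = h.choose := by simp only [lift]; rw [dif_pos h]
  rw [this]
  exact u.rng_inj h.choose_spec.1 hg (h.choose_spec.2.trans e.symm)

/-- The open set of arrows whose range lies in `r(u)`. -/
def liftDom (u : Bis G) : Set G := {k | ∃ g, g ∈ u ∧ rng g = rng k}

theorem isOpen_liftDom (u : Bis G) : IsOpen u.liftDom := by
  have h : u.liftDom = (fun g : G => (⟨rng g, rng_mem_units g⟩ : units G)) ⁻¹'
      Set.range fun g : u.1 => (⟨rng g.1, rng_mem_units g.1⟩ : units G) := by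
    ext k
    simp only [liftDom, Set.mem_ofPred_eq, Set.mem_preimage, Set.mem_range, Subtype.mk.injEq,
      Subtype.exists, exists_prop]
    rfl
  rw [h]
  exact u.2.rng_emb.isOpen_range.preimage (continuous_rng.subtype_mk _)

theorem continuousOn_lift (u : Bis G) : ContinuousOn u.lift u.liftDom := by
  rw [continuousOn_iff_continuous_domRestrict]
  have hm : ∀ k : u.liftDom, u.lift k.1 ∈ u.1 := by
    rintro ⟨k, g, hg, e⟩
    rw [u.lift_eq hg e]; exact hg
  have : Continuous fun k : u.liftDom => (⟨u.lift k.1, hm k⟩ : u.1) := by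
    rw [u.2.rng_emb.isInducing.continuous_iff]
    have he : ((fun g : u.1 => (⟨rng g.1, rng_mem_units g.1⟩ : units G)) ∘
        fun k : u.liftDom => (⟨u.lift k.1, hm k⟩ : u.1)) =
        fun k : u.liftDom => ⟨rng k.1, rng_mem_units k.1⟩ := by
      funext k
      obtain ⟨k, g, hg, e⟩ := k
      exact Subtype.ext ((congrArg rng (u.lift_eq hg e)).trans e)
    rw [he]
    exact (continuous_rng.comp continuous_subtype_val).subtype_mk _
  exact continuous_subtype_val.comp this

/-- The set of products of composable pairs from `u` and `v`. -/
def mulSet (u v : Set G) : Set G := {k | ∃ g h, g ∈ u ∧ h ∈ v ∧ IsMul g h k}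

theorem mem_mulSet_iff (u v : Bis G) (k : G) : k ∈ mulSet u.1 v.1 ↔
    k ∈ u.liftDom ∧ ∃ h, h ∈ v ∧ IsMul (ginv (u.lift k)) k h := by
  constructor
  · rintro ⟨g, h, hg, hh, H⟩
    refine ⟨⟨g, hg, H.rng_eq.symm⟩, h, hh, ?_⟩
    rw [u.lift_eq hg H.rng_eq.symm]
    exact H.inv_left
  · rintro ⟨⟨g, hg, e⟩, h, hh, H⟩
    rw [u.lift_eq hg e] at H
    refine ⟨g, h, hg, hh, ?_⟩
    have := H.inv_left
    rwa [ginv_ginv] at this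

theorem lift_comp (u : Bis G) (k : u.liftDom) : src (ginv (u.lift k.1)) = rng k.1 := by
  obtain ⟨g, hg, e⟩ := k.2
  rw [src_ginv, u.lift_eq hg e, e]

/-- The arrow `g⁻¹k`, where `g` is the arrow of `u` with the same range as `k`. -/
noncomputable def colift (u : Bis G) (k : u.liftDom) : G :=
  gmul (ginv (u.lift k.1)) k.1 (u.lift_comp k)

theorem colift_eq (u : Bis G) (k : u.liftDom) {g h : G} (hg : g ∈ u) (H : IsMul g h k.1) :
    u.colift k = h := by
  have h1 : IsMul (ginv (u.lift k.1)) k.1 (u.colift k) := isMul_gmul _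
  rw [u.lift_eq hg H.rng_eq.symm] at h1
  exact h1.unique H.inv_left

theorem continuous_colift (u : Bis G) : Continuous u.colift := by
  have h1 : Continuous fun k : u.liftDom => u.lift k.1 :=
    continuousOn_iff_continuous_domRestrict.1 u.continuousOn_lift
  exact continuous_gmul.comp (f := fun k : u.liftDom =>
    (⟨(ginv (u.lift k.1), k.1), u.lift_comp k⟩ : {p : G × G // src p.1 = rng p.2}))
    (Continuous.subtype_mk ((continuous_ginv.comp h1).prodMk continuous_subtype_val) u.lift_comp)

theorem isOpen_mulSet (u v : Bis G) : IsOpen (mulSet u.1 v.1) := by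
  have h : mulSet u.1 v.1 = Subtype.val '' (u.colift ⁻¹' v.1) := by
    ext k
    rw [mem_mulSet_iff]
    constructor
    · rintro ⟨hk, h, hh, H⟩
      refine ⟨⟨k, hk⟩, ?_, rfl⟩
      have : u.colift ⟨k, hk⟩ = h := (isMul_gmul _ : IsMul _ _ _).unique H
      rw [Set.mem_preimage, this]; exact hh
    · rintro ⟨⟨k, hk⟩, hv, rfl⟩
      exact ⟨hk, _, hv, isMul_gmul _⟩
  rw [h]
  exact u.isOpen_liftDom.isOpenMap_subtype_val _ (v.2.isOpen.preimage u.continuous_colift)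

variable [EtaleGroupoid G]

instance : Mul (Bis G) := ⟨fun u v => ⟨mulSet u.1 v.1, by
  refine isOpenBisection_of_injOn (isOpen_mulSet u v) ?_ ?_
  · rintro k ⟨g, h, hg, hh, H⟩ k' ⟨g', h', hg', hh', H'⟩ e
    obtain rfl : g = g' := u.rng_inj hg hg' (by rw [← H.rng_eq, e, H'.rng_eq])
    obtain rfl : h = h' := v.rng_inj hh hh' (by rw [← H.comp, H'.comp])
    exact H.unique H'
  · rintro k ⟨g, h, hg, hh, H⟩ k' ⟨g', h', hg', hh', H'⟩ e
    obtain rfl : h = h' := v.src_inj hh hh' (by rw [← H.src_eq, e, H'.src_eq])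
    obtain rfl : g = g' := u.src_inj hg hg' (by rw [H.comp, H'.comp])
    exact H.unique H'⟩⟩

instance : One (Bis G) := ⟨⟨units G, by
  refine isOpenBisection_of_injOn isOpen_units ?_ ?_
  · intro x hx y hy e
    rwa [rng_of_unit hx, rng_of_unit hy] at e
  · intro x hx y hy e
    rwa [show src x = x from hx, show src y = y from hy] at e⟩⟩

instance : Inv (Bis G) := ⟨fun u => ⟨ginv ⁻¹' u.1, by
  refine isOpenBisection_of_injOn (u.2.isOpen.preimage continuous_ginv) ?_ ?_
  · intro g hg h hh e
    have := u.src_inj hg hh (by rw [src_ginv, src_ginv, e])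
    rw [← ginv_ginv g, this, ginv_ginv]
  · intro g hg h hh e
    have := u.rng_inj hg hh (by rw [rng_ginv, rng_ginv, e])
    rw [← ginv_ginv g, this, ginv_ginv]⟩⟩

theorem mem_mul {u v : Bis G} {k : G} : k ∈ u * v ↔ ∃ g h, g ∈ u ∧ h ∈ v ∧ IsMul g h k := Iff.rfl

theorem mem_one {x : G} : x ∈ (1 : Bis G) ↔ x ∈ units G := Iff.rfl

theorem mem_inv {u : Bis G} {g : G} : g ∈ u⁻¹ ↔ ginv g ∈ u := Iff.rfl

theorem mem_mul_inv_mul {u v : Bis G} {g : G} (hg : g ∈ u * v * u) (h1 : g ∈ u) :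
    ginv g ∈ v := by
  obtain ⟨k, c, ⟨a, b, ha, hb, H1⟩, hc, H2⟩ := hg
  obtain rfl : g = c := u.src_inj h1 hc H2.src_eq
  obtain rfl : g = a := u.rng_inj h1 ha (by rw [H2.rng_eq, H1.rng_eq])
  have e : k = rng g := H2.right_cancel (isMul_rng g)
  rw [e] at H1
  rwa [← H1.left_cancel (isMul_ginv g)]

instance : InverseMonoid (Bis G) where
  mul_assoc u v w := ext fun k => by
    constructor
    · rintro ⟨a, b, ⟨c, d, hc, hd, H1⟩, hb, H2⟩
      have hcd : src d = rng b := by rw [← H1.src_eq, H2.comp]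
      exact ⟨c, _, hc, ⟨d, b, hd, hb, isMul_gmul hcd⟩, H1.assoc_right H2 (isMul_gmul hcd)⟩
    · rintro ⟨a, b, ha, ⟨c, d, hc, hd, H1⟩, H2⟩
      have hac : src a = rng c := by rw [← H1.rng_eq, H2.comp]
      exact ⟨_, d, ⟨a, c, ha, hc, isMul_gmul hac⟩, hd, (isMul_gmul hac).assoc_left H1 H2⟩
  one_mul u := ext fun k => by
    constructor
    · rintro ⟨a, b, ha, hb, H⟩
      have e : a = rng b := by rw [← H.comp, show src a = a from ha]
      rw [e] at H
      rwa [H.unique (isMul_rng b)]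
    · intro hk
      exact ⟨rng k, k, rng_mem_units k, hk, isMul_rng k⟩
  mul_one u := ext fun k => by
    constructor
    · rintro ⟨a, b, ha, hb, H⟩
      have e : b = src a := by rw [H.comp, rng_of_unit hb]
      rw [e] at H
      rwa [H.unique (isMul_src a)]
    · intro hk
      exact ⟨k, src k, hk, src_mem_units k, isMul_src k⟩
  mul_inv_mul u := ext fun k => by
    constructor
    · rintro ⟨a, b, ⟨c, d, hc, hd, H1⟩, hb, H2⟩
      have e : c = ginv d := u.src_inj hc hd (by rw [H1.comp, src_ginv])
      subst e
      have e2 := H1.unique (by simpa using isMul_ginv_left d)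
      rw [e2] at H2
      have : src d = rng b := by have := H2.comp; rwa [src_src] at this
      rw [this] at H2
      rwa [H2.unique (isMul_rng b)]
    · intro hk
      exact ⟨rng k, k, ⟨k, ginv k, hk, mem_inv.2 (by rwa [ginv_ginv]), isMul_ginv k⟩, hk,
        isMul_rng k⟩
  inv_mul_inv u := ext fun k => by
    constructor
    · rintro ⟨a, b, ⟨c, d, hc, hd, H1⟩, hb, H2⟩
      have e : ginv c = d := u.rng_inj hc hd (by rw [rng_ginv, H1.comp])
      subst e
      have e2 := H1.unique (isMul_ginv c)
      rw [e2] at H2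
      have : rng c = rng b := by have := H2.comp; rwa [src_rng] at this
      rw [this] at H2
      rwa [H2.unique (isMul_rng b)]
    · intro hk
      exact ⟨rng k, k, ⟨k, ginv k, hk, hk, isMul_ginv k⟩, hk, isMul_rng k⟩
  eq_inv u v h1 h2 := ext fun k => by
    constructor
    · intro hk
      exact mem_mul_inv_mul (by rwa [h2]) hk
    · intro hk
      have h3 : ginv k ∈ u * v * u := by rwa [h1]
      have := mem_mul_inv_mul h3 hk
      rwa [ginv_ginv] at this

theorem subset_of_natLE {u v : Bis G} (h : NatLE u v) : u.1 ⊆ v.1 := by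
  obtain ⟨e, he, rfl⟩ := h
  rintro k ⟨a, b, ha, hb, H⟩
  have hb' : b ∈ e * e * e := by rw [he, he]; exact hb
  have h1 : ginv b ∈ e := mem_mul_inv_mul hb' hb
  obtain ⟨c, d, hc, hd, H1⟩ : b ∈ e * e := by rwa [he]
  obtain rfl : b = c := e.rng_inj hb hc H1.rng_eq
  obtain rfl : b = d := e.src_inj hb hd H1.src_eq
  have e1 : b = src b := H1.left_cancel (isMul_src b)
  have e2 : b = src a := by rw [H.comp, e1, rng_src]
  rw [e2] at H
  rwa [H.unique (isMul_src a)]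

end Bis

/-- A subset of an inverse monoid containing the unit and closed under products and inverses. -/
structure InverseSubmonoid (M : Type u) [InverseMonoid M] extends Submonoid M where
  inv_mem' : ∀ {s : M}, s ∈ carrier → s⁻¹ ∈ carrier

namespace InverseSubmonoid

variable {M : Type u} [InverseMonoid M]

instance (S : InverseSubmonoid M) : InverseMonoid S.toSubmonoid where
  inv s := ⟨s.1⁻¹, S.inv_mem' s.2⟩
  mul_inv_mul s := Subtype.ext (InverseMonoid.mul_inv_mul s.1)
  inv_mul_inv s := Subtype.ext (InverseMonoid.inv_mul_inv s.1)
  eq_inv s t h1 h2 := Subtype.ext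
    (InverseMonoid.eq_inv s.1 t.1 (congrArg Subtype.val h1) (congrArg Subtype.val h2))

theorem natLE_val {S : InverseSubmonoid M} {s t : S.toSubmonoid} (h : NatLE s t) :
    NatLE s.1 t.1 := by
  obtain ⟨e, he, hte⟩ := h
  exact ⟨e.1, congrArg Subtype.val he, congrArg Subtype.val hte⟩

/-- `S ⊆ Bis(G)` is wide: it covers `G`, and any `g ∈ u ∩ v` with `u, v ∈ S` lies in some `w ∈ S`
with `w ⊆ u ∩ v`. -/
def IsWide {G : Type u} [TopologicalSpace G] [TopGroupoid G] [EtaleGroupoid G]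
    (S : InverseSubmonoid (Bis G)) : Prop :=
  (∀ g : G, ∃ u ∈ S.toSubmonoid, g ∈ u) ∧
    ∀ u ∈ S.toSubmonoid, ∀ v ∈ S.toSubmonoid, ∀ g : G, g ∈ u → g ∈ v →
      ∃ w ∈ S.toSubmonoid, g ∈ w ∧ w.1 ⊆ u.1 ∩ v.1

end InverseSubmonoid

/-! ### Biduals -/

/-- The bidual of a Banach space. -/
abbrev Bidual (X : Type v) [NormedAddCommGroup X] [NormedSpace ℂ X] : Type v :=
  StrongDual ℂ (StrongDual ℂ X)

namespace Bidual

/-- The extension of a bounded bilinear map `μ : X × Y → Z` to the biduals: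
`(m · n)(ψ) = m (x ↦ n (y ↦ ψ (μ x y)))` (the first Arens extension).  For the multiplications of
C⋆-algebras and Hilbert bimodules it is the unique separately weak⋆-continuous extension. -/
noncomputable def arens {X Y Z : Type*} [NormedAddCommGroup X] [NormedSpace ℂ X]
    [NormedAddCommGroup Y] [NormedSpace ℂ Y] [NormedAddCommGroup Z] [NormedSpace ℂ Z]
    (μ : X →L[ℂ] Y →L[ℂ] Z) (m : Bidual X) (n : Bidual Y) : Bidual Z :=
  m.comp ((ContinuousLinearMap.compL ℂ X (StrongDual ℂ Y) ℂ n).comp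
    (((ContinuousLinearMap.compL ℂ X (Y →L[ℂ] Z) (StrongDual ℂ Y)).flip μ).comp
      (ContinuousLinearMap.compL ℂ Y Z ℂ)))

theorem arens_apply {X Y Z : Type*} [NormedAddCommGroup X] [NormedSpace ℂ X]
    [NormedAddCommGroup Y] [NormedSpace ℂ Y] [NormedAddCommGroup Z] [NormedSpace ℂ Z]
    (μ : X →L[ℂ] Y →L[ℂ] Z) (m : Bidual X) (n : Bidual Y) (ψ : StrongDual ℂ Z) :
    arens μ m n ψ = m (n.comp ((ContinuousLinearMap.compL ℂ Y Z ℂ ψ).comp μ)) := rfl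

/-- The bidual `I''` of a closed subspace `I ⊆ X`, viewed inside `X''`: the weak⋆-closure of `I`,
that is, the annihilator in `X''` of the annihilator of `I` in `X'`. -/
def ofSubspace {X : Type v} [NormedAddCommGroup X] [NormedSpace ℂ X] (I : Submodule ℂ X) :
    Set (Bidual X) :=
  {m | ∀ φ : StrongDual ℂ X, (∀ x ∈ I, φ x = 0) → m φ = 0}

/-- `e` is a (two-sided) unit of `I''` for the Arens product extending `μ`. -/
def IsUnitOf {X : Type v} [NormedAddCommGroup X] [NormedSpace ℂ X] (μ : X →L[ℂ] X →L[ℂ] X)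
    (I : Submodule ℂ X) (e : Bidual X) : Prop :=
  e ∈ ofSubspace I ∧ ∀ m ∈ ofSubspace I, arens μ e m = m ∧ arens μ m e = m

theorem IsUnitOf.unique {X : Type v} [NormedAddCommGroup X] [NormedSpace ℂ X]
    {μ : X →L[ℂ] X →L[ℂ] X} {I : Submodule ℂ X} {e e' : Bidual X} (h : IsUnitOf μ I e)
    (h' : IsUnitOf μ I e') : e = e' :=
  (h'.2 e h.1).2.symm.trans (h.2 e' h'.1).1

end Bidual

/-! ### Fell bundles over inverse semigroups -/

/-- A (not necessarily saturated) Fell bundle over an inverse semigroup with unit: Banach spaces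
`A_s` with bounded bilinear multiplications `A_s × A_t → A_{st}`, conjugate-linear involutions
`A_s → A_{s^*}` and isometric inclusions `A_s → A_t` for `s ≤ t`.  Fibres over equal elements are
identified by the inclusion maps.  Positivity of `a^* a` in the C⋆-algebra `A_{s^* s}` is expressed
by `a^* a = c^* c` with `c ∈ A_{s^* s}`. -/
structure FellBundle (S : Type u) [InverseMonoid S] where
  Fib : S → Type v
  [normedAddCommGroup : ∀ s, NormedAddCommGroup (Fib s)]
  [normedSpace : ∀ s, NormedSpace ℂ (Fib s)]
  [completeSpace : ∀ s, CompleteSpace (Fib s)]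
  mul : ∀ s t, Fib s →L[ℂ] Fib t →L[ℂ] Fib (s * t)
  star : ∀ s, Fib s →ₗ⋆[ℂ] Fib s⁻¹
  incl : ∀ {s t}, NatLE s t → Fib s →ₗᵢ[ℂ] Fib t
  incl_refl : ∀ {s} (h : NatLE s s) (a : Fib s), incl h a = a
  incl_incl : ∀ {r s t} (h : NatLE r s) (h' : NatLE s t) (h'' : NatLE r t) (a : Fib r),
    incl h' (incl h a) = incl h'' a
  incl_mul : ∀ {s s' t t'} (hs : NatLE s s') (ht : NatLE t t') (h : NatLE (s * t) (s' * t'))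
    (a : Fib s) (b : Fib t), mul s' t' (incl hs a) (incl ht b) = incl h (mul s t a b)
  incl_star : ∀ {s t} (h : NatLE s t) (h' : NatLE s⁻¹ t⁻¹) (a : Fib s),
    star t (incl h a) = incl h' (star s a)
  mul_assoc : ∀ {r s t} (h : NatLE (r * s * t) (r * (s * t))) (a : Fib r) (b : Fib s) (c : Fib t),
    incl h (mul (r * s) t (mul r s a b) c) = mul r (s * t) a (mul s t b c)
  star_star : ∀ {s} (h : NatLE s⁻¹⁻¹ s) (a : Fib s), incl h (star s⁻¹ (star s a)) = a
  star_mul : ∀ {s t} (h : NatLE (s * t)⁻¹ (t⁻¹ * s⁻¹)) (a : Fib s) (b : Fib t),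
    incl h (star (s * t) (mul s t a b)) = mul t⁻¹ s⁻¹ (star t b) (star s a)
  norm_star : ∀ {s} (a : Fib s), ‖star s a‖ = ‖a‖
  norm_mul_le : ∀ {s t} (a : Fib s) (b : Fib t), ‖mul s t a b‖ ≤ ‖a‖ * ‖b‖
  norm_star_mul_self : ∀ {s} (a : Fib s), ‖mul s⁻¹ s (star s a) a‖ = ‖a‖ ^ 2
  star_mul_self_nonneg : ∀ {s} (h : NatLE ((s⁻¹ * s)⁻¹ * (s⁻¹ * s)) (s⁻¹ * s)) (a : Fib s),
    ∃ c : Fib (s⁻¹ * s),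
      mul s⁻¹ s (star s a) a = incl h (mul (s⁻¹ * s)⁻¹ (s⁻¹ * s) (star (s⁻¹ * s) c) c)

attribute [instance] FellBundle.normedAddCommGroup FellBundle.normedSpace FellBundle.completeSpace

namespace FellBundle

variable {S : Type u} [InverseMonoid S] (A : FellBundle.{u, v} S)

/-- The left multiplication `A_1 × A_s → A_s`. -/
noncomputable def lmul (s : S) : A.Fib 1 →L[ℂ] A.Fib s →L[ℂ] A.Fib s :=
  (ContinuousLinearMap.compL ℂ (A.Fib s) (A.Fib (1 * s)) (A.Fib s)
    (A.incl (natLE_of_eq (one_mul s))).toContinuousLinearMap).comp (A.mul 1 s)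

/-- The right multiplication `A_s × A_1 → A_s`. -/
noncomputable def rmul (s : S) : A.Fib s →L[ℂ] A.Fib 1 →L[ℂ] A.Fib s :=
  (ContinuousLinearMap.compL ℂ (A.Fib 1) (A.Fib (s * 1)) (A.Fib s)
    (A.incl (natLE_of_eq (mul_one s))).toContinuousLinearMap).comp (A.mul s 1)

/-- The involution of the unit fibre `A_1`. -/
noncomputable def starOne (a : A.Fib 1) : A.Fib 1 := A.incl (natLE_of_eq one_inv) (A.star 1 a)

/-- The closed two-sided ideal `I_{s,t}` of `A_1` generated by the `A_{v^* v}` with `v ≤ s, t`. -/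
noncomputable def ideal (s t : S) : Submodule ℂ (A.Fib 1) :=
  sInf {J | IsClosed (J : Set (A.Fib 1)) ∧
    (∀ a, ∀ b ∈ J, A.lmul 1 a b ∈ J ∧ A.lmul 1 b a ∈ J) ∧
    ∀ v, NatLE v s → NatLE v t → ∀ a : A.Fib (v⁻¹ * v), A.incl (inv_mul_natLE_one v) a ∈ J}

/-- The projection `1_s ∈ A_1''`: the unit of the von Neumann algebra `I_{s,1}'' ⊆ A_1''`, which
exists as `I_{s,1}` is a C⋆-algebra and is unique by `Bidual.IsUnitOf.unique`. -/
noncomputable def unitProj (s : S) : Bidual (A.Fib 1) :=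
  Classical.epsilon (Bidual.IsUnitOf (A.lmul 1) (A.ideal s 1))

/-- `Γ_c(S, A)`: finitely supported sections of the bundle `(A_{s s^*})_{s ∈ S}`. -/
structure FinSection where
  toFun : ∀ s, A.Fib (s * s⁻¹)
  finite_support : {s | toFun s ≠ 0}.Finite

variable {A}

/-- The value `ξ(s) ∈ A_{s s^*} ⊆ A_1`. -/
noncomputable def FinSection.val (ξ : A.FinSection) (s : S) : A.Fib 1 :=
  A.incl (mul_inv_natLE_one s) (ξ.toFun s)

/-- `∑_{p,t} ξ(p)^* ξ(t) 1_{p t^*} ∈ A_1''`. -/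
noncomputable def FinSection.sqSum (ξ : A.FinSection) : Bidual (A.Fib 1) :=
  ∑ p ∈ ξ.finite_support.toFinset, ∑ t ∈ ξ.finite_support.toFinset,
    Bidual.arens (A.lmul 1)
      (NormedSpace.inclusionInDoubleDual ℂ (A.Fib 1) (A.lmul 1 (A.starOne (ξ.val p)) (ξ.val t)))
      (A.unitProj (p * t⁻¹))

/-- `∑_{p,t} 1_{p (st)^*} ξ(p)^* a ξ(t) ∈ A_s''` for `a ∈ A_s`. -/
noncomputable def FinSection.average (ξ : A.FinSection) (s : S) (a : A.Fib s) : Bidual (A.Fib s) :=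
  ∑ p ∈ ξ.finite_support.toFinset, ∑ t ∈ ξ.finite_support.toFinset,
    Bidual.arens (A.lmul s) (A.unitProj (p * (s * t)⁻¹))
      (NormedSpace.inclusionInDoubleDual ℂ (A.Fib s)
        (A.rmul s (A.lmul s (A.starOne (ξ.val p)) a) (ξ.val t)))

variable (A) in
/-- The approximation property of a Fell bundle over an inverse semigroup. -/
def HasApproximationProperty : Prop :=
  ∃ (ι : Type (max u v)) (_ : Preorder ι) (_ : IsDirectedOrder ι) (_ : Nonempty ι)
    (ξ : ι → A.FinSection),
    (∃ C : ℝ, ∀ i, ‖(ξ i).sqSum‖ ≤ C) ∧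
    ∀ (s : S) (a : A.Fib s), Tendsto (fun i => (ξ i).average s a) atTop
      (𝓝 (NormedSpace.inclusionInDoubleDual ℂ (A.Fib s) a))

end FellBundle

/-! ### Fell bundles over groupoids -/

/-- A (not necessarily saturated) Fell bundle over a topological groupoid `G`: an upper
semicontinuous bundle of complex Banach spaces `A_g`, with continuous multiplication
`A_g × A_h → A_{gh}` for composable `g, h` and continuous involution `A_g → A_{g⁻¹}`.
The target fibres are indexed by `k` together with a proof of `gh = k`, resp. `g⁻¹ = k`.
Positivity of `a^* a` in the C⋆-algebra `A_{s(g)}` is expressed by `a^* a = c^* c`. -/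
structure GroupoidFellBundle (G : Type u) [TopologicalSpace G] [TopGroupoid G] where
  Fib : G → Type v
  [normedAddCommGroup : ∀ g, NormedAddCommGroup (Fib g)]
  [normedSpace : ∀ g, NormedSpace ℂ (Fib g)]
  [completeSpace : ∀ g, CompleteSpace (Fib g)]
  [topologicalSpace : TopologicalSpace (Bundle.TotalSpace Unit Fib)]
  continuous_proj : Continuous (Bundle.TotalSpace.proj : Bundle.TotalSpace Unit Fib → G)
  isOpenMap_proj : IsOpenMap (Bundle.TotalSpace.proj : Bundle.TotalSpace Unit Fib → G)
  upperSemicontinuous_norm :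
    UpperSemicontinuous fun a : Bundle.TotalSpace Unit Fib => ‖a.snd‖
  /-- Addition is continuous on the fibre product of the total space with itself. -/
  continuous_add : ∀ (g : G) (a b : Fib g), ∀ U ∈ 𝓝 (⟨g, a + b⟩ : Bundle.TotalSpace Unit Fib),
    ∃ V ∈ 𝓝 (⟨g, a⟩ : Bundle.TotalSpace Unit Fib), ∃ W ∈ 𝓝 (⟨g, b⟩ : Bundle.TotalSpace Unit Fib),
      ∀ (h : G) (a' b' : Fib h), (⟨h, a'⟩ : Bundle.TotalSpace Unit Fib) ∈ V →
        (⟨h, b'⟩ : Bundle.TotalSpace Unit Fib) ∈ W →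
        (⟨h, a' + b'⟩ : Bundle.TotalSpace Unit Fib) ∈ U
  continuous_smul : Continuous fun p : ℂ × Bundle.TotalSpace Unit Fib =>
    (⟨p.2.proj, p.1 • p.2.snd⟩ : Bundle.TotalSpace Unit Fib)
  /-- If `p(a_i) → g` and `‖a_i‖ → 0`, then `a_i → 0_g`. -/
  nhds_zero : ∀ (g : G), ∀ U ∈ 𝓝 (⟨g, 0⟩ : Bundle.TotalSpace Unit Fib), ∃ V ∈ 𝓝 g, ∃ ε > (0 : ℝ),
    ∀ h ∈ V, ∀ a : Fib h, ‖a‖ < ε → (⟨h, a⟩ : Bundle.TotalSpace Unit Fib) ∈ U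
  mul : ∀ {g h k : G}, IsMul g h k → Fib g →ₗ[ℂ] Fib h →ₗ[ℂ] Fib k
  star : ∀ {g k : G}, ginv g = k → Fib g →ₗ⋆[ℂ] Fib k
  continuous_mul : Continuous fun p : {p : Bundle.TotalSpace Unit Fib × Bundle.TotalSpace Unit Fib //
      src p.1.proj = rng p.2.proj} =>
    (⟨gmul p.1.1.proj p.1.2.proj p.2, mul (isMul_gmul p.2) p.1.1.snd p.1.2.snd⟩ :
      Bundle.TotalSpace Unit Fib)
  continuous_star : Continuous fun a : Bundle.TotalSpace Unit Fib =>
    (⟨ginv a.proj, star rfl a.snd⟩ : Bundle.TotalSpace Unit Fib)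
  mul_assoc : ∀ {g h k gh hk ghk : G} (h₁ : IsMul g h gh) (h₂ : IsMul gh k ghk)
    (h₃ : IsMul h k hk) (h₄ : IsMul g hk ghk) (a : Fib g) (b : Fib h) (c : Fib k),
    mul h₂ (mul h₁ a b) c = mul h₄ a (mul h₃ b c)
  star_star : ∀ {g k : G} (h₁ : ginv g = k) (h₂ : ginv k = g) (a : Fib g),
    star h₂ (star h₁ a) = a
  star_mul : ∀ {g h k g' h' k' : G} (hm : IsMul g h k) (hg : ginv g = g') (hh : ginv h = h')
    (hk : ginv k = k') (hm' : IsMul h' g' k') (a : Fib g) (b : Fib h),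
    star hk (mul hm a b) = mul hm' (star hh b) (star hg a)
  norm_mul_le : ∀ {g h k : G} (hm : IsMul g h k) (a : Fib g) (b : Fib h),
    ‖mul hm a b‖ ≤ ‖a‖ * ‖b‖
  norm_star_mul_self : ∀ {g g' x : G} (hg : ginv g = g') (hm : IsMul g' g x) (a : Fib g),
    ‖mul hm (star hg a) a‖ = ‖a‖ ^ 2
  star_mul_self_nonneg : ∀ {g g' x : G} (hg : ginv g = g') (hm : IsMul g' g x) (hx : ginv x = x)
    (hxx : IsMul x x x) (a : Fib g),
    ∃ c : Fib x, mul hm (star hg a) a = mul hxx (star hx c) c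

attribute [instance] GroupoidFellBundle.normedAddCommGroup GroupoidFellBundle.normedSpace
  GroupoidFellBundle.completeSpace GroupoidFellBundle.topologicalSpace

namespace GroupoidFellBundle

variable {G : Type u} [TopologicalSpace G] [TopGroupoid G] (A : GroupoidFellBundle.{u, v} G)

/-- The total space of the bundle. -/
abbrev Total : Type (max u v) := Bundle.TotalSpace Unit A.Fib

/-- `C_c(A)`: the span of the sections of `A` that are continuous and compactly supported in an
open bisection and vanish outside of it. -/
def Cc : Submodule ℂ (∀ g : G, A.Fib g) :=
  Submodule.span ℂ {f | ∃ u : Set G, IsOpenBisection u ∧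
    ContinuousOn (fun g => (⟨g, f g⟩ : A.Total)) u ∧
    ∃ K ⊆ u, IsCompact K ∧ ∀ g ∉ K, f g = 0}

/-- `C_c(G, r^*(A⁰))`: the span of the sections `ξ(g) ∈ A_{r(g)}` that are continuous and compactly
supported in an open bisection and vanish outside of it. -/
def CcRange : Submodule ℂ (∀ g : G, A.Fib (rng g)) :=
  Submodule.span ℂ {ξ | ∃ u : Set G, IsOpenBisection u ∧
    ContinuousOn (fun g => (⟨rng g, ξ g⟩ : A.Total)) u ∧
    ∃ K ⊆ u, IsCompact K ∧ ∀ g ∉ K, ξ g = 0}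

variable {A}

/-- `∑_{g ∈ G^x} ξ(g)^* ξ(g) ∈ A_x`; the sum is finite for `ξ ∈ C_c(G, r^*(A⁰))`. -/
noncomputable def sqSum (ξ : ∀ g : G, A.Fib (rng g)) (x : units G) : A.Fib x.1 :=
  ∑ᶠ g : {g : G // rng g = x.1},
    A.mul (g := x.1) (h := rng g.1) (by rw [g.2]; exact isMul_unit x.2)
      (A.star (by rw [g.2]; exact ginv_of_unit x.2) (ξ g.1)) (ξ g.1)

/-- `∑_{h ∈ G^{s(g)}} ξ(gh)^* f(g) ξ(h) ∈ A_g`; the sum is finite for `ξ ∈ C_c(G, r^*(A⁰))`. -/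
noncomputable def average (ξ : ∀ g : G, A.Fib (rng g)) (f : ∀ g : G, A.Fib g) (g : G) : A.Fib g :=
  ∑ᶠ h : {h : G // rng h = src g},
    A.mul (g := g) (h := rng h.1) (by rw [h.2]; exact isMul_src g)
      (A.mul (isMul_rng g)
        (A.star (by rw [rng_gmul]; exact ginv_of_unit (rng_mem_units g)) (ξ (gmul g h.1 h.2.symm)))
        (f g))
      (ξ h.1)

variable (A) in
/-- The approximation property of a Fell bundle over a groupoid. -/
def HasApproximationProperty : Prop :=
  ∃ (ι : Type (max u v)) (_ : Preorder ι) (_ : IsDirectedOrder ι) (_ : Nonempty ι)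
    (ξ : ι → ∀ g : G, A.Fib (rng g)),
    (∀ i, ξ i ∈ A.CcRange) ∧
    (∃ C : ℝ, ∀ i, ∀ x : units G, ‖sqSum (ξ i) x‖ ≤ C) ∧
    ∀ f ∈ A.Cc, ∀ K : Set G, IsCompact K → ∀ ε > (0 : ℝ),
      ∀ᶠ i in atTop, ∀ g ∈ K, ‖average (ξ i) f g - f g‖ < ε

end GroupoidFellBundle

/-! ### The Fell bundle of `C₀`-sections over a semigroup of bisections -/

namespace GroupoidFellBundle

section Topology

variable {G : Type u} [TopologicalSpace G] [TopGroupoid G] {A : GroupoidFellBundle.{u, v} G}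

theorem norm_star {g k : G} (h : ginv g = k) (a : A.Fib g) : ‖A.star h a‖ = ‖a‖ := by
  have key : ∀ {g k : G} (h : ginv g = k) (a : A.Fib g), ‖a‖ ≤ ‖A.star h a‖ := by
    intro g k h a
    subst h
    have h1 := A.norm_star_mul_self rfl (isMul_ginv_left g) a
    have h2 := A.norm_mul_le (isMul_ginv_left g) (A.star rfl a) a
    rw [h1, sq] at h2
    rcases (norm_nonneg a).eq_or_lt with h0 | h0
    · rw [← h0]; exact norm_nonneg _
    · exact le_of_mul_le_mul_right h2 h0
  refine le_antisymm ?_ (key h a)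
  have h2 : ginv k = g := by rw [← h, ginv_ginv]
  calc ‖A.star h a‖ ≤ ‖A.star h2 (A.star h a)‖ := key h2 _
    _ = ‖a‖ := by rw [A.star_star]

theorem tendsto_add {X : Type*} {l : Filter X} {b : X → G} {f f' : ∀ x, A.Fib (b x)} {g : G}
    {a a' : A.Fib g} (hf : Tendsto (fun x => (⟨b x, f x⟩ : A.Total)) l (𝓝 ⟨g, a⟩))
    (hf' : Tendsto (fun x => (⟨b x, f' x⟩ : A.Total)) l (𝓝 ⟨g, a'⟩)) :
    Tendsto (fun x => (⟨b x, f x + f' x⟩ : A.Total)) l (𝓝 ⟨g, a + a'⟩) := by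
  intro U hU
  obtain ⟨V, hV, W, hW, H⟩ := A.continuous_add g a a' U hU
  rw [mem_map]
  filter_upwards [hf hV, hf' hW] with x h1 h2
  exact H _ _ _ h1 h2

theorem tendsto_smul {X : Type*} {l : Filter X} {b : X → G} {f : ∀ x, A.Fib (b x)} {g : G}
    {a : A.Fib g} (c : ℂ) (hf : Tendsto (fun x => (⟨b x, f x⟩ : A.Total)) l (𝓝 ⟨g, a⟩)) :
    Tendsto (fun x => (⟨b x, c • f x⟩ : A.Total)) l (𝓝 ⟨g, c • a⟩) :=
  (A.continuous_smul.tendsto (c, ⟨g, a⟩)).comp (tendsto_const_nhds.prodMk_nhds hf)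

theorem tendsto_zero {X : Type*} {l : Filter X} {b : X → G} {f : ∀ x, A.Fib (b x)} {g : G}
    (hb : Tendsto b l (𝓝 g)) (hf : ∀ ε > 0, ∀ᶠ x in l, ‖f x‖ < ε) :
    Tendsto (fun x => (⟨b x, f x⟩ : A.Total)) l (𝓝 ⟨g, 0⟩) := by
  intro U hU
  obtain ⟨V, hV, ε, hε, H⟩ := A.nhds_zero g U hU
  rw [mem_map]
  filter_upwards [hb hV, hf ε hε] with x h1 h2
  exact H _ h1 _ h2

/-- Uniform limits of continuous sections are continuous. -/
theorem continuousAt_of_uniform {f : ∀ g : G, A.Fib g} {g : G}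
    (h : ∀ ε > 0, ∃ f' : ∀ g : G, A.Fib g, ContinuousAt (fun g => (⟨g, f' g⟩ : A.Total)) g ∧
      ∀ k, ‖f k - f' k‖ ≤ ε) :
    ContinuousAt (fun g => (⟨g, f g⟩ : A.Total)) g := by
  intro U hU
  have hU' : U ∈ 𝓝 (⟨g, f g + 0⟩ : A.Total) := by rwa [add_zero]
  obtain ⟨V, hV, W, hW, H⟩ := A.continuous_add g (f g) 0 U hU'
  obtain ⟨N, hN, ε, hε, H2⟩ := A.nhds_zero g W hW
  obtain ⟨f', hf', hff'⟩ := h (ε / 4) (by positivity)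
  have hp : Tendsto (fun b : A.Total => b.proj) (𝓝 ⟨g, f g⟩) (𝓝 g) :=
    A.continuous_proj.tendsto (⟨g, f g⟩ : A.Total)
  have h1 : Tendsto (fun b : A.Total => (⟨b.proj, b.snd + (-1 : ℂ) • f' b.proj⟩ : A.Total))
      (𝓝 ⟨g, f g⟩) (𝓝 ⟨g, f g + (-1 : ℂ) • f' g⟩) :=
    tendsto_add (b := fun b : A.Total => b.proj) tendsto_id
      (tendsto_smul (b := fun b : A.Total => b.proj) (-1) (hf'.tendsto.comp hp))
  have h2 : ∀ᶠ b : A.Total in 𝓝 ⟨g, f g⟩, ‖b.snd + (-1 : ℂ) • f' b.proj‖ < ε / 2 := by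
    have h3 := A.upperSemicontinuous_norm (⟨g, f g + (-1 : ℂ) • f' g⟩ : A.Total) (ε / 2) (by
      have := hff' g
      simp only [neg_smul, one_smul, ← sub_eq_add_neg]
      linarith)
    exact h1.eventually h3
  have h4 := A.isOpenMap_proj.image_mem_nhds (inter_mem hV h2)
  rw [mem_map]
  filter_upwards [h4, hN] with k hk hkN
  obtain ⟨⟨k', b⟩, ⟨hbV, hb⟩, rfl⟩ := hk
  have := H k' b (f k' - b) hbV (H2 k' hkN _ (by
    have e1 : f k' - b = (f k' - f' k') - (b + (-1 : ℂ) • f' k') := by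
      simp only [neg_smul, one_smul]; abel
    have e2 := hff' k'
    have e3 : ‖b + (-1 : ℂ) • f' k'‖ < ε / 2 := hb
    rw [e1]
    have := norm_sub_le (f k' - f' k') (b + (-1 : ℂ) • f' k')
    linarith))
  simpa using this

variable (A) in
/-- The Banach space `B_u` of continuous sections `u → A` vanishing at infinity.  A section over `u`
is represented by its extension by zero to `G`, an element of the Banach space of all bounded
sections with the supremum norm. -/
def C0 (u : Bis G) : Submodule ℂ (lp A.Fib ∞) where
  carrier := {f | (∀ g ∉ u, f g = 0) ∧ ContinuousOn (fun g => (⟨g, f g⟩ : A.Total)) u.carrier ∧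
    ∀ ε > (0 : ℝ), ∃ K ⊆ u.carrier, IsCompact K ∧ ∀ g ∉ K, ‖f g‖ < ε}
  add_mem' := by
    rintro f f' ⟨h1, h2, h3⟩ ⟨h1', h2', h3'⟩
    refine ⟨fun g hg => ?_, fun g hg => ?_, fun ε hε => ?_⟩
    · rw [lp.coeFn_add, Pi.add_apply, h1 g hg, h1' g hg, add_zero]
    · exact tendsto_add (b := fun g => g) (h2 g hg) (h2' g hg)
    · obtain ⟨K, hK, hKc, H⟩ := h3 (ε / 2) (by positivity)
      obtain ⟨K', hK', hKc', H'⟩ := h3' (ε / 2) (by positivity)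
      refine ⟨K ∪ K', Set.union_subset hK hK', hKc.union hKc', fun g hg => ?_⟩
      have e1 := H g fun h => hg (Or.inl h)
      have e2 := H' g fun h => hg (Or.inr h)
      have := norm_add_le (f g) (f' g)
      rw [lp.coeFn_add, Pi.add_apply]
      linarith
  zero_mem' := by
    refine ⟨fun g _ => rfl, fun g _ => ?_, fun ε hε => ⟨∅, Set.empty_subset _, isCompact_empty, ?_⟩⟩
    · exact tendsto_zero (b := fun g => g) (f := fun g => (0 : A.Fib g)) inf_le_left
        (fun ε hε => by simpa using Eventually.of_forall fun _ => hε)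
    · intro g _
      simpa using hε
  smul_mem' := by
    rintro c f ⟨h1, h2, h3⟩
    refine ⟨fun g hg => ?_, fun g hg => ?_, fun ε hε => ?_⟩
    · rw [lp.coeFn_smul, Pi.smul_apply, h1 g hg, smul_zero]
    · exact tendsto_smul (b := fun g => g) c (h2 g hg)
    · obtain ⟨K, hK, hKc, H⟩ := h3 (ε / (‖c‖ + 1)) (by positivity)
      refine ⟨K, hK, hKc, fun g hg => ?_⟩
      have e1 := H g hg
      rw [lt_div_iff₀ (by positivity)] at e1
      rw [lp.coeFn_smul, Pi.smul_apply, norm_smul]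
      nlinarith [norm_nonneg (f g)]

theorem C0.isClosed (u : Bis G) : IsClosed (A.C0 u : Set (lp A.Fib ∞)) := by
  rw [← isSeqClosed_iff_isClosed]
  intro F f hF hf
  have hd : ∀ ε > 0, ∃ f' ∈ A.C0 u, ∀ g, ‖f g - f' g‖ ≤ ε := by
    intro ε hε
    obtain ⟨N, hN⟩ := (Metric.tendsto_atTop.1 hf) ε hε
    refine ⟨F N, hF N, fun g => ?_⟩
    have h1 := hN N le_rfl
    rw [dist_eq_norm, norm_sub_rev] at h1
    have h2 := lp.norm_apply_le_norm ENNReal.top_ne_zero (f - F N) g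
    rw [lp.coeFn_sub, Pi.sub_apply] at h2
    linarith
  refine ⟨fun g hg => ?_, fun g hg => ?_, fun ε hε => ?_⟩
  · rw [← norm_eq_zero]
    refine le_antisymm (le_of_forall_pos_le_add fun ε hε => ?_) (norm_nonneg _)
    obtain ⟨f', hf', h⟩ := hd ε hε
    have := h g
    rw [hf'.1 g hg, sub_zero] at this
    linarith
  · refine (continuousAt_of_uniform fun ε hε => ?_).continuousWithinAt
    obtain ⟨f', hf', h⟩ := hd ε hε
    exact ⟨f', hf'.2.1.continuousAt (u.2.isOpen.mem_nhds hg), h⟩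
  · obtain ⟨f', hf', h⟩ := hd (ε / 2) (by positivity)
    obtain ⟨K, hK, hKc, H⟩ := hf'.2.2 (ε / 2) (by positivity)
    refine ⟨K, hK, hKc, fun g hg => ?_⟩
    have h1 := H g hg
    have h2 := h g
    have h3 := norm_add_le (f g - f' g) (f' g)
    rw [sub_add_cancel] at h3
    linarith

instance (u : Bis G) : CompleteSpace (A.C0 u) := (C0.isClosed u).completeSpace_coe

theorem C0.ext {u : Bis G} {f f' : A.C0 u} (h : ∀ g, f.1 g = f'.1 g) : f = f' :=
  Subtype.ext (lp.ext (funext h))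

theorem C0.norm_apply_le {u : Bis G} (f : A.C0 u) (g : G) : ‖f.1 g‖ ≤ ‖f‖ :=
  lp.norm_apply_le_norm ENNReal.top_ne_zero f.1 g

theorem C0.norm_le {u : Bis G} (f : A.C0 u) {C : ℝ} (hC : 0 ≤ C) (h : ∀ g, ‖f.1 g‖ ≤ C) :
    ‖f‖ ≤ C :=
  lp.norm_le_of_forall_le hC h

/-- A bisection is a Hausdorff subspace of `G`. -/
theorem isClosed_of_compact [T2Space (units G)] {v : Bis G} {K : Set G} (hK : K ⊆ v.carrier)
    (hKc : IsCompact K) : ∃ W, IsOpen W ∧ K = v.carrier \ W := by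
  have : T2Space v.carrier := v.2.rng_emb.isEmbedding.t2Space
  have h1 : IsClosed (Subtype.val ⁻¹' K : Set v.carrier) := by
    refine IsCompact.isClosed ?_
    rw [Subtype.isCompact_iff, Subtype.image_preimage_coe, Set.inter_eq_right.2 hK]
    exact hKc
  obtain ⟨W, hW, hWe⟩ := isOpen_induced_iff.1 h1.isOpen_compl
  refine ⟨W, hW, ?_⟩
  ext g
  constructor
  · intro hg
    refine ⟨hK hg, fun hgW => ?_⟩
    have : (⟨g, hK hg⟩ : v.carrier) ∈ (Subtype.val ⁻¹' K : Set v.carrier)ᶜ := by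
      rw [← hWe]; exact hgW
    exact this hg
  · rintro ⟨hgv, hgW⟩
    by_contra hg
    have : (⟨g, hgv⟩ : v.carrier) ∈ (Subtype.val ⁻¹' K : Set v.carrier)ᶜ := hg
    rw [← hWe] at this
    exact hgW this

theorem C0.mono [T2Space (units G)] {u v : Bis G} (h : u.carrier ⊆ v.carrier) :
    A.C0 u ≤ A.C0 v := by
  rintro f ⟨h1, h2, h3⟩
  refine ⟨fun g hg => h1 g fun hgu => hg (h hgu), fun g hg => ?_, fun ε hε => ?_⟩
  · by_cases hgu : g ∈ u
    · exact (h2.continuousAt (u.2.isOpen.mem_nhds hgu)).continuousWithinAt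
    · have e : (⟨g, f g⟩ : A.Total) = ⟨g, 0⟩ := by rw [h1 g hgu]
      change Tendsto _ _ (𝓝 (⟨g, f g⟩ : A.Total))
      rw [e]
      refine tendsto_zero (b := fun g => g) inf_le_left fun ε hε => ?_
      obtain ⟨K, hK, hKc, H⟩ := h3 ε hε
      obtain ⟨W, hW, rfl⟩ := isClosed_of_compact (hK.trans h) hKc
      have hgW : g ∈ W := by
        by_contra hgW
        exact hgu (hK ⟨hg, hgW⟩)
      filter_upwards [mem_nhdsWithin_of_mem_nhds (hW.mem_nhds hgW)] with k hk
      exact H k fun h => h.2 hk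
  · obtain ⟨K, hK, hKc, H⟩ := h3 ε hε
    exact ⟨K, hK.trans h, hKc, H⟩

/-- The product of sections over bisections `u` and `v`: its value at `k = ab`, with `a ∈ u` and
`b ∈ v`, is `f(a) f'(b)`, and it vanishes outside of `uv`. -/
noncomputable def secMul (u v : Bis G) (f f' : ∀ g, A.Fib g) (k : G) : A.Fib k :=
  open Classical in
  if h : ∃ p : G × G, p.1 ∈ u ∧ p.2 ∈ v ∧ IsMul p.1 p.2 k then
    A.mul h.choose_spec.2.2 (f h.choose.1) (f' h.choose.2)
  else 0

theorem secMul_eq {u v : Bis G} {f f' : ∀ g, A.Fib g} {a b k : G} (ha : a ∈ u) (hb : b ∈ v)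
    (H : IsMul a b k) : secMul u v f f' k = A.mul H (f a) (f' b) := by
  have h : ∃ p : G × G, p.1 ∈ u ∧ p.2 ∈ v ∧ IsMul p.1 p.2 k := ⟨(a, b), ha, hb, H⟩
  rw [secMul, dif_pos h]
  have key : ∀ (a' b' : G) (H' : IsMul a' b' k), a' ∈ u → b' ∈ v →
      A.mul H' (f a') (f' b') = A.mul H (f a) (f' b) := by
    intro a' b' H' ha' hb'
    obtain rfl := u.rng_inj ha' ha (by rw [← H'.rng_eq, ← H.rng_eq])
    obtain rfl := v.src_inj hb' hb (by rw [← H'.src_eq, ← H.src_eq])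
    rfl
  exact key _ _ _ h.choose_spec.1 h.choose_spec.2.1

theorem total_mul_eq {a b k : G} (hc : src a = rng b) (H : IsMul a b k) (x : A.Fib a)
    (y : A.Fib b) :
    (⟨gmul a b hc, A.mul (isMul_gmul hc) x y⟩ : A.Total) = ⟨k, A.mul H x y⟩ := by
  obtain ⟨_, rfl⟩ := H
  rfl

theorem isCompact_mulSet [T2Space (units G)] {K K' : Set G} (hK : IsCompact K)
    (hK' : IsCompact K') : IsCompact (Bis.mulSet K K') := by
  have hcl : IsClosed {p : G × G | src p.1 = rng p.2} := by
    have h1 : Continuous fun p : G × G => (⟨src p.1, src_mem_units p.1⟩ : units G) :=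
      (continuous_src.comp continuous_fst).subtype_mk _
    have h2 : Continuous fun p : G × G => (⟨rng p.2, rng_mem_units p.2⟩ : units G) :=
      (continuous_rng.comp continuous_snd).subtype_mk _
    have := isClosed_eq h1 h2
    simpa using this
  have hc : IsCompact {p : {p : G × G // src p.1 = rng p.2} | p.1 ∈ K ×ˢ K'} :=
    hcl.isClosedEmbedding_subtypeVal.isCompact_preimage (hK.prod hK')
  have := hc.image (continuous_gmul (G := G))
  convert this using 1
  ext k
  constructor
  · rintro ⟨a, b, ha, hb, hc, rfl⟩
    exact ⟨⟨(a, b), hc⟩, ⟨ha, hb⟩, rfl⟩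
  · rintro ⟨⟨⟨a, b⟩, hc⟩, ⟨ha, hb⟩, rfl⟩
    exact ⟨a, b, ha, hb, isMul_gmul hc⟩

theorem C0.apply_eq_zero {u : Bis G} (f : A.C0 u) {k : G} (hk : k ∉ u) : f.1 k = 0 := f.2.1 k hk

theorem C0.add_apply {u : Bis G} (f f' : A.C0 u) (g : G) : (f + f').1 g = f.1 g + f'.1 g := rfl

theorem C0.smul_apply {u : Bis G} (c : ℂ) (f : A.C0 u) (g : G) : (c • f).1 g = c • f.1 g := rfl

theorem total_star_eq {g k : G} (h : ginv g = k) (x : A.Fib g) :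
    (⟨ginv g, A.star rfl x⟩ : A.Total) = ⟨k, A.star h x⟩ := by
  subst h; rfl

end Topology

section Operations

variable {G : Type u} [TopologicalSpace G] [TopGroupoid G] [EtaleGroupoid G]
  {A : GroupoidFellBundle.{u, v} G}

theorem secMul_eq_zero {u v : Bis G} {f f' : ∀ g, A.Fib g} {k : G} (hk : k ∉ u * v) :
    secMul u v f f' k = 0 := by
  rw [secMul, dif_neg]
  rintro ⟨p, h1, h2, h3⟩
  exact hk ⟨p.1, p.2, h1, h2, h3⟩

theorem norm_secMul_le {u v : Bis G} {f f' : ∀ g, A.Fib g} {C C' : ℝ} (hf : ∀ g, ‖f g‖ ≤ C)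
    (hf' : ∀ g, ‖f' g‖ ≤ C') (hC : 0 ≤ C) (hC' : 0 ≤ C') (k : G) :
    ‖secMul u v f f' k‖ ≤ C * C' := by
  by_cases hk : k ∈ u * v
  · obtain ⟨a, b, ha, hb, H⟩ := hk
    rw [secMul_eq ha hb H]
    exact (A.norm_mul_le H _ _).trans (mul_le_mul (hf a) (hf' b) (norm_nonneg _) hC)
  · rw [secMul_eq_zero hk, norm_zero]; positivity

theorem continuousOn_secMul {u v : Bis G} {f f' : ∀ g, A.Fib g}
    (hf : ContinuousOn (fun g => (⟨g, f g⟩ : A.Total)) u.carrier)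
    (hf' : ContinuousOn (fun g => (⟨g, f' g⟩ : A.Total)) v.carrier) :
    ContinuousOn (fun g => (⟨g, secMul u v f f' g⟩ : A.Total)) (u * v).carrier := by
  rw [continuousOn_iff_continuous_domRestrict]
  have hdom : ∀ k : (u * v).carrier, k.1 ∈ u.liftDom := fun k => by
    obtain ⟨a, b, ha, hb, H⟩ := k.2
    exact ⟨a, ha, H.rng_eq.symm⟩
  let α : (u * v).carrier → G := fun k => u.lift k.1
  let β : (u * v).carrier → G := fun k => u.colift ⟨k.1, hdom k⟩
  have hα : Continuous α := by
    have h1 : Continuous fun k : u.liftDom => u.lift k.1 :=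
      continuousOn_iff_continuous_domRestrict.1 u.continuousOn_lift
    exact h1.comp (f := fun k : (u * v).carrier => (⟨k.1, hdom k⟩ : u.liftDom))
      (continuous_subtype_val.subtype_mk _)
  have hβ : Continuous β := u.continuous_colift.comp
    (f := fun k : (u * v).carrier => (⟨k.1, hdom k⟩ : u.liftDom))
    (continuous_subtype_val.subtype_mk _)
  have hαβ : ∀ k, α k ∈ u ∧ β k ∈ v ∧ IsMul (α k) (β k) k.1 := fun k => by
    obtain ⟨a, b, ha, hb, H⟩ := k.2
    have e1 : α k = a := u.lift_eq ha H.rng_eq.symm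
    have e2 : β k = b := u.colift_eq ⟨k.1, hdom k⟩ ha H
    rw [e1, e2]
    exact ⟨ha, hb, H⟩
  have h1 : Continuous fun k => (⟨α k, f (α k)⟩ : A.Total) :=
    hf.comp_continuous hα fun k => (hαβ k).1
  have h2 : Continuous fun k => (⟨β k, f' (β k)⟩ : A.Total) :=
    hf'.comp_continuous hβ fun k => (hαβ k).2.1
  have h3 : Continuous fun k : (u * v).carrier =>
      (⟨gmul (α k) (β k) (hαβ k).2.2.comp,
        A.mul (isMul_gmul (hαβ k).2.2.comp) (f (α k)) (f' (β k))⟩ : A.Total) :=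
    A.continuous_mul.comp (f := fun k : (u * v).carrier =>
      (⟨((⟨α k, f (α k)⟩ : A.Total), (⟨β k, f' (β k)⟩ : A.Total)), (hαβ k).2.2.comp⟩ :
        {p : A.Total × A.Total // src p.1.proj = rng p.2.proj}))
      ((h1.prodMk h2).subtype_mk _)
  refine h3.congr fun k => ?_
  obtain ⟨ha, hb, H⟩ := hαβ k
  rw [total_mul_eq _ H, Set.domRestrict_apply, secMul_eq ha hb H]

/-- To compare sections over `uv` it suffices to look at products. -/
theorem C0.ext_mul {u v : Bis G} {f f' : A.C0 (u * v)}
    (h : ∀ a b k, a ∈ u → b ∈ v → IsMul a b k → f.1 k = f'.1 k) : f = f' :=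
  C0.ext fun k => by
    by_cases hk : k ∈ u * v
    · obtain ⟨a, b, ha, hb, H⟩ := hk
      exact h a b k ha hb H
    · rw [C0.apply_eq_zero f hk, C0.apply_eq_zero f' hk]

/-- The involution `B_u → B_{u⁻¹}`, `f^*(g) = f(g⁻¹)^*`. -/
noncomputable def C0.star (u : Bis G) : A.C0 u →ₗ⋆[ℂ] A.C0 u⁻¹ where
  toFun f := ⟨⟨fun g => A.star (ginv_ginv g) (f.1 (ginv g)), memℓp_infty ⟨‖f‖, by
      rintro _ ⟨k, rfl⟩
      change ‖A.star (ginv_ginv k) (f.1 (ginv k))‖ ≤ ‖f‖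
      rw [norm_star]
      exact C0.norm_apply_le f _⟩⟩,
    fun g hg => by
      change A.star (ginv_ginv g) (f.1 (ginv g)) = 0
      rw [C0.apply_eq_zero f (fun h => hg h), map_zero],
    by
      have h1 : ContinuousOn (fun g => (⟨ginv g, f.1 (ginv g)⟩ : A.Total)) (u⁻¹).carrier :=
        ContinuousOn.comp f.2.2.1 continuous_ginv.continuousOn fun g hg => hg
      have h2 := A.continuous_star.comp_continuousOn h1
      refine h2.congr fun g _ => ?_
      exact (total_star_eq (ginv_ginv g) _).symm,
    by
      intro ε hε
      obtain ⟨K, hK, hKc, H⟩ := f.2.2.2 ε hε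
      refine ⟨ginv '' K, ?_, hKc.image continuous_ginv, fun g hg => ?_⟩
      · rintro _ ⟨k, hk, rfl⟩
        have : ginv (ginv k) ∈ u := by rw [ginv_ginv]; exact hK hk
        exact this
      · change ‖A.star (ginv_ginv g) (f.1 (ginv g))‖ < ε
        rw [norm_star]
        exact H _ fun h => hg ⟨_, h, ginv_ginv g⟩⟩
  map_add' f f' := C0.ext fun g => by
    change A.star (ginv_ginv g) (f.1 (ginv g) + f'.1 (ginv g)) = _
    rw [map_add]; rfl
  map_smul' c f := C0.ext fun g => by
    change A.star (ginv_ginv g) (c • f.1 (ginv g)) = _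
    rw [LinearMap.map_smulₛₗ]; rfl

theorem C0.star_apply {u : Bis G} (f : A.C0 u) {g k : G} (h : ginv g = k) :
    (C0.star u f).1 k = A.star h (f.1 g) := by
  have h' : ginv k = g := by rw [← h, ginv_ginv]
  subst h'
  rfl

theorem C0.norm_star {u : Bis G} (f : A.C0 u) : ‖C0.star u f‖ = ‖f‖ := by
  refine le_antisymm (C0.norm_le _ (norm_nonneg _) fun g => ?_) (C0.norm_le _ (norm_nonneg _)
    fun g => ?_)
  · rw [C0.star_apply f (ginv_ginv g), GroupoidFellBundle.norm_star]
    exact C0.norm_apply_le f _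
  · rw [← GroupoidFellBundle.norm_star rfl (f.1 g), ← C0.star_apply f rfl]
    exact C0.norm_apply_le _ _

theorem C0.inv_mul_subset_units (u : Bis G) : (u⁻¹ * u).carrier ⊆ units G := by
  rintro k ⟨a, b, ha, hb, H⟩
  have h1 : ginv a = b := u.rng_inj ha hb (by rw [rng_ginv, H.comp])
  subst h1
  rw [H.unique (isMul_ginv a)]
  exact rng_mem_units a

variable [T2Space (units G)]

/-- The multiplication `B_u × B_v → B_{uv}` on elements. -/
noncomputable def C0.mulFun {u v : Bis G} (f : A.C0 u) (f' : A.C0 v) : A.C0 (u * v) :=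
  ⟨⟨secMul u v f.1 f'.1, memℓp_infty ⟨‖f‖ * ‖f'‖, by
      rintro _ ⟨k, rfl⟩
      exact norm_secMul_le (fun g => C0.norm_apply_le f g) (fun g => C0.norm_apply_le f' g)
        (norm_nonneg _) (norm_nonneg _) k⟩⟩,
    fun _ hk => secMul_eq_zero hk, continuousOn_secMul f.2.2.1 f'.2.2.1, by
      intro ε hε
      obtain ⟨K, hK, hKc, H⟩ := f.2.2.2 (ε / (‖f'‖ + 1)) (by positivity)
      obtain ⟨K', hK', hKc', H'⟩ := f'.2.2.2 (ε / (‖f‖ + 1)) (by positivity)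
      refine ⟨Bis.mulSet K K', ?_, isCompact_mulSet hKc hKc', fun k hk => ?_⟩
      · rintro k ⟨a, b, ha, hb, h⟩
        exact ⟨a, b, hK ha, hK' hb, h⟩
      · change ‖secMul u v f.1 f'.1 k‖ < ε
        by_cases hkuv : k ∈ u * v
        · obtain ⟨a, b, ha, hb, h⟩ := hkuv
          rw [secMul_eq ha hb h]
          refine (A.norm_mul_le h _ _).trans_lt ?_
          have n1 := C0.norm_apply_le f a
          have n2 := C0.norm_apply_le f' b
          have p1 := norm_nonneg (f.1 a)
          have p2 := norm_nonneg (f'.1 b)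
          by_cases haK : a ∈ K
          · have hbK : b ∉ K' := fun hbK => hk ⟨a, b, haK, hbK, h⟩
            have := H' b hbK
            rw [lt_div_iff₀ (by positivity)] at this
            nlinarith
          · have := H a haK
            rw [lt_div_iff₀ (by positivity)] at this
            nlinarith
        · rw [secMul_eq_zero hkuv, norm_zero]; exact hε⟩

theorem C0.mulFun_apply {u v : Bis G} (f : A.C0 u) (f' : A.C0 v) {a b k : G} (ha : a ∈ u)
    (hb : b ∈ v) (H : IsMul a b k) : (C0.mulFun f f').1 k = A.mul H (f.1 a) (f'.1 b) :=
  secMul_eq ha hb H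

/-- The multiplication `B_u × B_v → B_{uv}`. -/
noncomputable def C0.mul (u v : Bis G) : A.C0 u →L[ℂ] A.C0 v →L[ℂ] A.C0 (u * v) :=
  LinearMap.mkContinuous₂
    (LinearMap.mk₂ ℂ (fun f f' => C0.mulFun f f')
      (fun f₁ f₂ f' => C0.ext_mul fun a b k ha hb H => by
        simp only [C0.add_apply, C0.mulFun_apply _ _ ha hb H, map_add, LinearMap.add_apply])
      (fun c f f' => C0.ext_mul fun a b k ha hb H => by
        simp only [C0.smul_apply, C0.mulFun_apply _ _ ha hb H, map_smul, LinearMap.smul_apply])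
      (fun f f₁ f₂ => C0.ext_mul fun a b k ha hb H => by
        simp only [C0.add_apply, C0.mulFun_apply _ _ ha hb H, map_add])
      (fun c f f' => C0.ext_mul fun a b k ha hb H => by
        simp only [C0.smul_apply, C0.mulFun_apply _ _ ha hb H, map_smul]))
    1 (fun f f' => by
      rw [one_mul]
      refine C0.norm_le _ (by positivity) fun k => ?_
      exact norm_secMul_le (fun g => C0.norm_apply_le f g) (fun g => C0.norm_apply_le f' g)
        (norm_nonneg _) (norm_nonneg _) k)

theorem C0.mul_apply {u v : Bis G} (f : A.C0 u) (f' : A.C0 v) {a b k : G} (ha : a ∈ u)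
    (hb : b ∈ v) (H : IsMul a b k) : (C0.mul u v f f').1 k = A.mul H (f.1 a) (f'.1 b) :=
  secMul_eq ha hb H

theorem C0.norm_mul_le {u v : Bis G} (f : A.C0 u) (f' : A.C0 v) :
    ‖C0.mul u v f f'‖ ≤ ‖f‖ * ‖f'‖ :=
  C0.norm_le _ (by positivity) fun k =>
    norm_secMul_le (fun g => C0.norm_apply_le f g) (fun g => C0.norm_apply_le f' g)
      (norm_nonneg _) (norm_nonneg _) k

theorem C0.norm_star_mul_self {u : Bis G} (f : A.C0 u) :
    ‖C0.mul u⁻¹ u (C0.star u f) f‖ = ‖f‖ ^ 2 := by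
  refine le_antisymm ?_ ?_
  · refine (C0.norm_mul_le _ _).trans ?_
    rw [C0.norm_star, sq]
  · have h : ‖f‖ ≤ √‖C0.mul u⁻¹ u (C0.star u f) f‖ := by
      refine C0.norm_le _ (Real.sqrt_nonneg _) fun g => ?_
      by_cases hg : g ∈ u
      · have hg' : ginv g ∈ u⁻¹ := by rw [Bis.mem_inv, ginv_ginv]; exact hg
        have h1 := C0.norm_apply_le (C0.mul u⁻¹ u (C0.star u f) f) (src g)
        rw [C0.mul_apply _ _ hg' hg (isMul_ginv_left g), C0.star_apply f rfl,
          A.norm_star_mul_self] at h1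
        exact Real.le_sqrt_of_sq_le h1
      · rw [C0.apply_eq_zero f hg, norm_zero]; exact Real.sqrt_nonneg _
    calc ‖f‖ ^ 2 ≤ (√‖C0.mul u⁻¹ u (C0.star u f) f‖) ^ 2 := by gcongr
      _ = _ := Real.sq_sqrt (norm_nonneg _)

end Operations

end GroupoidFellBundle

/-! ### Positivity of `f^* f` and the associated Fell bundle -/

theorem exists_star_mul_self_mem {N : Type*} [NonUnitalCStarAlgebra N]
    (B : NonUnitalStarSubalgebra ℂ N) (hB : IsClosed (B : Set N)) (y : N) (hy : star y * y ∈ B) :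
    ∃ c ∈ B, star c * c = star y * y := by
  let _ := CStarAlgebra.spectralOrder N
  let _ := CStarAlgebra.spectralOrderedRing N
  have h0 : 0 ≤ star y * y := star_mul_self_nonneg y
  refine ⟨CFC.sqrt (star y * y), ?_, ?_⟩
  · rw [CFC.sqrt_eq_real_sqrt _ h0]
    have : IsClosed (B : Set N) := hB
    exact cfcₙ_mem (𝕜' := ℂ) _ hy
  · rw [(CFC.sqrt_nonneg (star y * y)).isSelfAdjoint.star_eq, CFC.sqrt_mul_sqrt_self _ h0]

namespace GroupoidFellBundle

section UnitFib

variable {G : Type u} [TopologicalSpace G] [TopGroupoid G]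

/-- The fibre over a unit, with its C⋆-algebra structure. -/
def UnitFib (A : GroupoidFellBundle.{u, v} G) (x : units G) : Type v := A.Fib x.1

variable {A : GroupoidFellBundle.{u, v} G}

noncomputable instance (x : units G) : NormedAddCommGroup (A.UnitFib x) :=
  inferInstanceAs (NormedAddCommGroup (A.Fib x.1))

noncomputable instance (x : units G) : NormedSpace ℂ (A.UnitFib x) :=
  inferInstanceAs (NormedSpace ℂ (A.Fib x.1))

instance (x : units G) : CompleteSpace (A.UnitFib x) :=
  inferInstanceAs (CompleteSpace (A.Fib x.1))

/-- The multiplication of the fibre over a unit, as a bilinear map. -/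
noncomputable def unitMul (x : units G) : A.UnitFib x →ₗ[ℂ] A.UnitFib x →ₗ[ℂ] A.UnitFib x :=
  A.mul (isMul_unit x.2)

/-- The involution of the fibre over a unit. -/
noncomputable def unitStar (x : units G) : A.UnitFib x →ₗ⋆[ℂ] A.UnitFib x :=
  A.star (ginv_of_unit x.2)

noncomputable instance (x : units G) : NonUnitalNormedRing (A.UnitFib x) where
  __ := (inferInstance : NormedAddCommGroup (A.UnitFib x))
  mul a b := unitMul x a b
  left_distrib a b c := (unitMul x a).map_add b c
  right_distrib a b c := (unitMul x).map_add₂ a b c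
  zero_mul a := (unitMul x).map_zero₂ a
  mul_zero a := (unitMul x a).map_zero
  mul_assoc a b c := A.mul_assoc _ _ _ _ a b c
  norm_mul_le a b := A.norm_mul_le (isMul_unit x.2) a b

noncomputable instance (x : units G) : StarRing (A.UnitFib x) where
  star a := unitStar x a
  star_involutive a := A.star_star _ _ a
  star_mul a b := A.star_mul _ _ _ _ _ a b
  star_add a b := (unitStar x).map_add a b

noncomputable instance (x : units G) : NonUnitalCStarAlgebra (A.UnitFib x) where
  norm_mul_self_le a := by
    have := A.norm_star_mul_self (ginv_of_unit x.2) (isMul_unit x.2) a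
    rw [sq] at this
    exact this.ge
  smul_assoc c a b := (unitMul x).map_smul₂ c a b
  smul_comm c a b := ((unitMul x a).map_smul c b).symm
  star_smul c a := (unitStar x).map_smulₛₗ c a

noncomputable instance : NonUnitalCStarAlgebra (lp A.UnitFib ∞) where

end UnitFib

section

variable {G : Type u} [TopologicalSpace G] [TopGroupoid G] [EtaleGroupoid G]
  {A : GroupoidFellBundle.{u, v} G} [T2Space (units G)]

/-- `C₀`-sections over an open set of units, as a closed subalgebra of the bounded sections of the
bundle of C⋆-algebras over the unit space. -/
def C0.unitAlg (e : Bis G) (he : e.carrier ⊆ units G) :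
    NonUnitalStarSubalgebra ℂ (lp A.UnitFib ∞) where
  carrier := {n | ∃ f : A.C0 e, ∀ x : units G, n x = f.1 x.1}
  add_mem' := by
    rintro n n' ⟨f, hf⟩ ⟨f', hf'⟩
    refine ⟨f + f', fun x => ?_⟩
    rw [lp.coeFn_add, Pi.add_apply, hf, hf']
    rfl
  zero_mem' := ⟨0, fun x => rfl⟩
  smul_mem' := by
    rintro c n ⟨f, hf⟩
    refine ⟨c • f, fun x => ?_⟩
    rw [lp.coeFn_smul, Pi.smul_apply, hf]
    rfl
  mul_mem' := by
    rintro n n' ⟨f, hf⟩ ⟨f', hf'⟩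
    have hsub : (e * e).carrier ⊆ e.carrier := by
      rintro k ⟨a, b, ha, hb, H⟩
      have h1 : b = src a := by rw [H.comp, rng_of_unit (he hb)]
      rw [h1] at H
      rwa [H.unique (isMul_src a)]
    refine ⟨⟨(C0.mul e e f f').1, C0.mono hsub (C0.mul e e f f').2⟩, fun x => ?_⟩
    rw [lp.infty_coeFn_mul, Pi.mul_apply, hf, hf']
    change A.mul (isMul_unit x.2) (f.1 x.1) (f'.1 x.1) = (C0.mul e e f f').1 x.1
    by_cases hx : x.1 ∈ e
    · exact (C0.mul_apply f f' hx hx (isMul_unit x.2)).symm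
    · rw [C0.apply_eq_zero f hx]
      have : x.1 ∉ e * e := fun h => hx (hsub h)
      refine Eq.trans ?_ (C0.apply_eq_zero (C0.mul e e f f') this).symm
      exact (A.mul (isMul_unit x.2)).map_zero₂ _
  star_mem' := by
    rintro n ⟨f, hf⟩
    have hsub : (e⁻¹).carrier ⊆ e.carrier := by
      intro k hk
      have h1 : ginv k ∈ e := hk
      have h2 := ginv_of_unit (he h1)
      rw [ginv_ginv] at h2
      rw [h2]; exact h1
    refine ⟨⟨(C0.star e f).1, C0.mono hsub (C0.star e f).2⟩, fun x => ?_⟩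
    rw [lp.star_apply, hf]
    change A.star (ginv_of_unit x.2) (f.1 x.1) = (C0.star e f).1 x.1
    exact (C0.star_apply f (ginv_of_unit x.2)).symm

theorem C0.isClosed_unitAlg (e : Bis G) (he : e.carrier ⊆ units G) :
    IsClosed (C0.unitAlg (A := A) e he : Set (lp A.UnitFib ∞)) := by
  rw [← isSeqClosed_iff_isClosed]
  intro F n hF hn
  choose f hf using hF
  have hdist : ∀ i j, dist (f i) (f j) ≤ dist (F i) (F j) := by
    intro i j
    rw [dist_eq_norm, dist_eq_norm]
    refine C0.norm_le _ (norm_nonneg _) fun g => ?_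
    by_cases hg : g ∈ units G
    · have := lp.norm_apply_le_norm ENNReal.top_ne_zero (F i - F j) ⟨g, hg⟩
      rw [lp.coeFn_sub, Pi.sub_apply, hf, hf] at this
      exact this
    · have hg' : g ∉ e := fun h => hg (he h)
      rw [C0.apply_eq_zero _ hg', norm_zero]
      exact norm_nonneg _
  have hc : CauchySeq f := by
    rw [Metric.cauchySeq_iff]
    intro ε hε
    obtain ⟨N, hN⟩ := Metric.cauchySeq_iff.1 hn.cauchySeq ε hε
    exact ⟨N, fun i hi j hj => (hdist i j).trans_lt (hN i hi j hj)⟩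
  obtain ⟨f₀, hf₀⟩ := cauchySeq_tendsto_of_complete hc
  refine ⟨f₀, fun x => ?_⟩
  have h1 : Tendsto (fun i => (F i) x) atTop (𝓝 (n x)) := by
    rw [tendsto_iff_norm_sub_tendsto_zero] at hn ⊢
    refine squeeze_zero (fun _ => norm_nonneg _) (fun i => ?_) hn
    exact lp.norm_apply_le_norm ENNReal.top_ne_zero (F i - n) x
  have h2 : Tendsto (fun i => ((f i).1 x.1 : A.UnitFib x)) atTop (𝓝 (f₀.1 x.1)) := by
    rw [tendsto_iff_norm_sub_tendsto_zero] at hf₀ ⊢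
    refine squeeze_zero (fun _ => norm_nonneg _) (fun i => ?_) hf₀
    exact C0.norm_apply_le (f i - f₀) x.1
  simp only [hf] at h1
  exact tendsto_nhds_unique h1 h2

theorem C0.star_mul_self_nonneg {u : Bis G} (f : A.C0 u) :
    ∃ c : A.C0 (u⁻¹ * u), ∀ k, (C0.mul u⁻¹ u (C0.star u f) f).1 k =
      (C0.mul (u⁻¹ * u)⁻¹ (u⁻¹ * u) (C0.star (u⁻¹ * u) c) c).1 k := by
  have he := C0.inv_mul_subset_units u
  have hpt : ∀ x : units G, ∃ c : A.UnitFib x,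
      Star.star c * c = ((C0.mul u⁻¹ u (C0.star u f) f).1 x.1 : A.UnitFib x) := by
    intro x
    by_cases hx : x.1 ∈ u⁻¹ * u
    · obtain ⟨a, b, ha, hb, H⟩ := hx
      have h1 : ginv a = b := u.rng_inj ha hb (by rw [rng_ginv, H.comp])
      have h2 : ginv b = a := by rw [← h1, ginv_ginv]
      obtain ⟨c, hc⟩ := A.star_mul_self_nonneg h2 H (ginv_of_unit x.2) (isMul_unit x.2) (f.1 b)
      refine ⟨c, ?_⟩
      rw [C0.mul_apply _ _ ha hb H, C0.star_apply f h2, hc]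
      rfl
    · refine ⟨0, ?_⟩
      rw [mul_zero]
      exact (C0.apply_eq_zero (C0.mul u⁻¹ u (C0.star u f) f) hx).symm
  choose y hy using hpt
  have hmem : Memℓp y ∞ := by
    refine memℓp_infty ⟨‖f‖, ?_⟩
    rintro _ ⟨x, rfl⟩
    have h1 : ‖Star.star (y x) * y x‖ = ‖y x‖ * ‖y x‖ := CStarRing.norm_star_mul_self
    rw [hy] at h1
    have h2 := C0.norm_apply_le (C0.mul u⁻¹ u (C0.star u f) f) x.1
    rw [C0.norm_star_mul_self] at h2
    have h3 : ‖y x‖ * ‖y x‖ ≤ ‖f‖ ^ 2 := h1.symm.le.trans h2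
    change ‖y x‖ ≤ ‖f‖
    nlinarith [norm_nonneg f, norm_nonneg (y x)]
  let Y : lp A.UnitFib ∞ := ⟨y, hmem⟩
  have hY : ∀ x, (Star.star Y * Y) x = (C0.mul u⁻¹ u (C0.star u f) f).1 x.1 := fun x => hy x
  obtain ⟨n, ⟨c, hc⟩, hn⟩ := exists_star_mul_self_mem (C0.unitAlg (A := A) _ he)
    (C0.isClosed_unitAlg _ he) Y ⟨_, hY⟩
  refine ⟨c, fun k => ?_⟩
  by_cases hk : k ∈ u⁻¹ * u
  · have hku : k ∈ units G := he hk
    have hk' : k ∈ (u⁻¹ * u)⁻¹ := by rw [Bis.mem_inv, ginv_of_unit hku]; exact hk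
    have h1 : (Star.star Y * Y) ⟨k, hku⟩ = (Star.star n * n) ⟨k, hku⟩ := by rw [hn]
    rw [hY] at h1
    rw [h1, lp.infty_coeFn_mul, Pi.mul_apply, lp.star_apply, hc,
      C0.mul_apply _ _ hk' hk (isMul_unit hku), C0.star_apply c (ginv_of_unit hku)]
    rfl
  · rw [C0.apply_eq_zero _ hk, C0.apply_eq_zero]
    rintro ⟨a, b, ha, hb, H⟩
    have hbu := he hb
    have h1 : b = src a := by rw [H.comp, rng_of_unit hbu]
    have ha' : a ∈ units G := by
      have h2 := ginv_of_unit (he ha)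
      rw [ginv_ginv] at h2
      rw [h2]; exact he ha
    have h2 : a = b := by rw [h1, show src a = a from ha']
    subst h2
    rw [H.unique (isMul_unit hbu)] at hk
    exact hk hb

/-- The Fell bundle `(B_u)_{u ∈ S}` over an inverse semigroup `S` of open bisections associated to a
Fell bundle `A` over `G`: `B_u` is the space of `C₀`-sections of `A` over `u`. -/
noncomputable def toFellBundle (A : GroupoidFellBundle.{u, v} G) (S : InverseSubmonoid (Bis G)) :
    FellBundle.{u, max u v} S.toSubmonoid where
  Fib s := A.C0 s.1
  mul s t := C0.mul s.1 t.1
  star s := C0.star s.1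
  incl h :=
    { Submodule.inclusion (C0.mono (Bis.subset_of_natLE (InverseSubmonoid.natLE_val h))) with
      norm_map' := fun _ => rfl }
  incl_refl _ _ := rfl
  incl_incl _ _ _ _ := rfl
  incl_mul {s s' t t'} hs ht h a b := C0.ext fun k => by
    change (C0.mul s'.1 t'.1 _ _).1 k = (C0.mul s.1 t.1 a b).1 k
    have hs' := Bis.subset_of_natLE (InverseSubmonoid.natLE_val hs)
    have ht' := Bis.subset_of_natLE (InverseSubmonoid.natLE_val ht)
    by_cases hk : k ∈ s.1 * t.1
    · obtain ⟨g, g', hg, hg', H⟩ := hk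
      rw [C0.mul_apply _ _ hg hg' H, C0.mul_apply _ _ (hs' hg) (ht' hg') H]
      rfl
    · rw [C0.apply_eq_zero _ hk]
      by_cases hk' : k ∈ s'.1 * t'.1
      · obtain ⟨g, g', hg, hg', H⟩ := hk'
        rw [C0.mul_apply _ _ hg hg' H]
        change A.mul H (a.1 g) (b.1 g') = 0
        by_cases hgs : g ∈ s.1
        · have hgt : g' ∉ t.1 := fun hgt => hk ⟨g, g', hgs, hgt, H⟩
          rw [C0.apply_eq_zero b hgt, map_zero]
        · rw [C0.apply_eq_zero a hgs, map_zero, LinearMap.zero_apply]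
      · rw [C0.apply_eq_zero _ hk']
  incl_star _ _ _ := rfl
  mul_assoc {r s t} h a b c := C0.ext fun k => by
    change (C0.mul (r.1 * s.1) t.1 (C0.mul r.1 s.1 a b) c).1 k =
      (C0.mul r.1 (s.1 * t.1) a (C0.mul s.1 t.1 b c)).1 k
    by_cases hk : k ∈ r.1 * s.1 * t.1
    · obtain ⟨d, g'', ⟨g, g', hg, hg', H1⟩, hg'', H2⟩ := hk
      have hc : src g' = rng g'' := by rw [← H1.src_eq, H2.comp]
      have H3 := isMul_gmul hc
      rw [C0.mul_apply _ _ (Bis.mem_mul.2 ⟨g, g', hg, hg', H1⟩) hg'' H2,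
        C0.mul_apply _ _ hg hg' H1,
        C0.mul_apply _ _ hg (Bis.mem_mul.2 ⟨g', g'', hg', hg'', H3⟩) (H1.assoc_right H2 H3),
        C0.mul_apply _ _ hg' hg'' H3]
      exact A.mul_assoc _ _ _ _ _ _ _
    · rw [C0.apply_eq_zero _ hk, C0.apply_eq_zero _ (by rwa [← _root_.mul_assoc])]
  star_star {s} h a := C0.ext fun k => by
    change (C0.star _ (C0.star s.1 a)).1 k = a.1 k
    rw [C0.star_apply _ (ginv_ginv k), C0.star_apply a rfl]
    exact A.star_star _ _ _
  star_mul {s t} h a b := C0.ext fun k => by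
    change (C0.star _ (C0.mul s.1 t.1 a b)).1 k =
      (C0.mul t.1⁻¹ s.1⁻¹ (C0.star t.1 b) (C0.star s.1 a)).1 k
    by_cases hk : ginv k ∈ s.1 * t.1
    · obtain ⟨g, g', hg, hg', H⟩ := hk
      have H' := H.inv
      rw [ginv_ginv] at H'
      have h1 : ginv g ∈ s.1⁻¹ := by rw [Bis.mem_inv, ginv_ginv]; exact hg
      have h2 : ginv g' ∈ t.1⁻¹ := by rw [Bis.mem_inv, ginv_ginv]; exact hg'
      rw [C0.star_apply _ (ginv_ginv k), C0.mul_apply _ _ hg hg' H, C0.mul_apply _ _ h2 h1 H',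
        C0.star_apply _ rfl, C0.star_apply _ rfl]
      exact A.star_mul _ _ _ _ _ _ _
    · rw [C0.star_apply _ (ginv_ginv k), C0.apply_eq_zero _ hk, map_zero, C0.apply_eq_zero]
      rintro ⟨g, g', hg, hg', H⟩
      exact hk ⟨ginv g', ginv g, hg', hg, H.inv⟩
  norm_star := C0.norm_star
  norm_mul_le := C0.norm_mul_le
  norm_star_mul_self := C0.norm_star_mul_self
  star_mul_self_nonneg {s} h a := by
    obtain ⟨c, hc⟩ := C0.star_mul_self_nonneg a
    exact ⟨c, C0.ext hc⟩

end

end GroupoidFellBundle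

end

open Topology Filter
open scoped ENNReal
open TopGroupoid InverseMonoid

/-! A bounded functional on a section space `C0 u` behaves like a vector-valued Radon measure on the
unit space, carried there by the range map. It is concentrated up to ε on compact sets, it can be
restricted to an open set U of units, and the norms of its parts on U and on the complement add up
to at most its own norm. The projection 1_s in the bidual of B_1 acts on functionals exactly as
restriction to the open set s ∩ G⁰ (`isPart_right`, `isPart_left`).

Consequently a finite sum ∑ 1_{s_j} a_j in the bidual of B_u has the same norm as the piecewise
continuous section whose value at g is the sum of those a_j(g) with r(g) ∈ s_j. For the upper bound,
split a functional into its parts on the cells cut out by the sets s_j ∩ G⁰; on each cell the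
section agrees with an honest C₀-section (`norm_add_sum_part_le`). For the lower bound, test against
functionals concentrated at a single arrow (`IsPart.apply_of_eval`).

A finitely supported ξ over S gives a function on G, the sum of ξ(p)(r(g)) over all p containing g
(`toRange`). A unit x lies in p t^* iff p and t share an arrow with range x, and for g ∈ u the unit
r(g) lies in p(ut)^* iff gh ∈ p for some h ∈ t. So the piecewise sections that belong to the two
sums in the approximation property of B are precisely the two sums in the approximation property of
A, formed with `toRange ξ`. Bounds and errors therefore coincide on both sides: `norm_sqSum_le`,
`norm_sqSum_toRange_le`, `norm_average_sub_le`, `norm_average_toRange_sub_le`.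

What remains is to match the nets and the test sections. Partitions of unity along the wide
semigroup S show that every element of `CcRange` is some `toRange ξ`; conversely `toRange ξ` is only
approximately compactly supported, which is repaired by a small perturbation
(`exists_mem_CcRange_approx`). The property of A controls compactly supported f on compact sets,
while that of B asks for C₀-sections and global uniformity. This gap is closed by the Cauchy–Schwarz
estimate `norm_average_le`: averaging is bounded pointwise by C‖f(g)‖, so it creates nothing where f
vanishes and passes to uniform limits in f.

The projections 1_s are defined by a choice, so one must also prove that the bidual of a C⋆-ideal
has a unit for the Arens product (`Bidual.exists_isUnitOf`) and that I_{s,1} consists of the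
sections supported in s ∩ G⁰ (`ideal_toFellBundle`). -/

namespace GroupoidFellBundle

/-! ### Cutting off sections by functions on the unit space -/

section Cut

variable {G : Type u} [TopologicalSpace G] [TopGroupoid G] {A : GroupoidFellBundle.{u, v} G}

/-- The range map with values in the unit space. -/
def rngUnit (g : G) : units G := ⟨rng g, rng_mem_units g⟩

theorem continuous_rngUnit : Continuous (rngUnit : G → units G) := continuous_rng.subtype_mk _

/-- The source map with values in the unit space. -/
def srcUnit (g : G) : units G := ⟨src g, src_mem_units g⟩

/-- Multiplication of a section by a function `units G → [0,1]`, pulled back along the range. -/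
noncomputable def C0.cut {u : Bis G} (χ : C(units G, unitInterval)) : A.C0 u →ₗ[ℂ] A.C0 u where
  toFun a := ⟨⟨fun g => ((χ (rngUnit g) : ℝ) : ℂ) • a.1 g, memℓp_infty ⟨‖a‖, by
      rintro _ ⟨g, rfl⟩
      change ‖((χ (rngUnit g) : ℝ) : ℂ) • a.1 g‖ ≤ ‖a‖
      rw [norm_smul, Complex.norm_real, Real.norm_of_nonneg (χ (rngUnit g)).2.1]
      exact (mul_le_of_le_one_left (norm_nonneg _) (χ (rngUnit g)).2.2).trans
        (C0.norm_apply_le a g)⟩⟩,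
    fun g hg => by
      change ((χ (rngUnit g) : ℝ) : ℂ) • a.1 g = 0
      rw [C0.apply_eq_zero a hg, smul_zero],
    by
      have h1 : ContinuousOn (fun g : G => (((χ (rngUnit g) : ℝ) : ℂ), (⟨g, a.1 g⟩ : A.Total)))
          u.carrier :=
        (Complex.continuous_ofReal.comp (continuous_subtype_val.comp
          (χ.continuous.comp continuous_rngUnit))).continuousOn.prodMk a.2.2.1
      exact A.continuous_smul.comp_continuousOn h1,
    by
      intro ε hε
      obtain ⟨K, hK, hKc, H⟩ := a.2.2.2 ε hε
      refine ⟨K, hK, hKc, fun g hg => ?_⟩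
      change ‖((χ (rngUnit g) : ℝ) : ℂ) • a.1 g‖ < ε
      rw [norm_smul, Complex.norm_real, Real.norm_of_nonneg (χ (rngUnit g)).2.1]
      exact (mul_le_of_le_one_left (norm_nonneg _) (χ (rngUnit g)).2.2).trans_lt (H g hg)⟩
  map_add' a b := C0.ext fun g => smul_add _ _ _
  map_smul' c a := C0.ext fun g => smul_comm _ _ _

theorem C0.cut_apply {u : Bis G} (χ : C(units G, unitInterval)) (a : A.C0 u) (g : G) :
    (C0.cut χ a).1 g = ((χ (rngUnit g) : ℝ) : ℂ) • a.1 g := rfl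

theorem C0.norm_cut_apply_le {u : Bis G} (χ : C(units G, unitInterval)) (a : A.C0 u) (g : G) :
    ‖(C0.cut χ a).1 g‖ ≤ ‖a.1 g‖ := by
  rw [C0.cut_apply, norm_smul, Complex.norm_real, Real.norm_of_nonneg (χ (rngUnit g)).2.1]
  exact mul_le_of_le_one_left (norm_nonneg _) (χ (rngUnit g)).2.2

theorem C0.norm_cut_le {u : Bis G} (χ : C(units G, unitInterval)) (a : A.C0 u) :
    ‖C0.cut χ a‖ ≤ ‖a‖ :=
  C0.norm_le _ (norm_nonneg _) fun g => (C0.norm_cut_apply_le χ a g).trans (C0.norm_apply_le a g)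

theorem C0.cut_apply_of_eq_zero {u : Bis G} {χ : C(units G, unitInterval)} (a : A.C0 u) {g : G}
    (h : χ (rngUnit g) = 0) : (C0.cut χ a).1 g = 0 := by
  rw [C0.cut_apply, h, Set.Icc.coe_zero, Complex.ofReal_zero, zero_smul]

/-- The function `1 - χ`. -/
def symmCut (χ : C(units G, unitInterval)) : C(units G, unitInterval) :=
  ⟨fun x => unitInterval.symm (χ x), unitInterval.continuous_symm.comp χ.continuous⟩

theorem symmCut_eq_zero {χ : C(units G, unitInterval)} {x : units G} (h : χ x = 1) :
    symmCut χ x = 0 := by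
  change unitInterval.symm (χ x) = 0
  rw [h, unitInterval.symm_one]

theorem C0.cut_add_cut_symmCut {u : Bis G} (χ : C(units G, unitInterval)) (a : A.C0 u) :
    C0.cut χ a + C0.cut (symmCut χ) a = a := C0.ext fun g => by
  rw [C0.add_apply, C0.cut_apply, C0.cut_apply, ← add_smul]
  change (((χ (rngUnit g) : ℝ) : ℂ) + ((1 - (χ (rngUnit g) : ℝ) : ℝ) : ℂ)) • a.1 g = a.1 g
  push_cast
  rw [add_sub_cancel, one_smul]

/-- `a` vanishes at all arrows with range in `K`. -/
def C0.VanishesOn {u : Bis G} (a : A.C0 u) (K : Set (units G)) : Prop :=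
  ∀ g, rngUnit g ∈ K → a.1 g = 0

theorem C0.VanishesOn.cut {u : Bis G} {a : A.C0 u} {K : Set (units G)} (h : C0.VanishesOn a K)
    (χ : C(units G, unitInterval)) : C0.VanishesOn (C0.cut χ a) K := fun g hg => by
  rw [C0.cut_apply, h g hg, smul_zero]

theorem C0.VanishesOn.mono {u : Bis G} {a : A.C0 u} {K K' : Set (units G)} (h : C0.VanishesOn a K)
    (hK : K' ⊆ K) : C0.VanishesOn a K' := fun g hg => h g (hK hg)

theorem C0.vanishesOn_cut_of_zero {u : Bis G} {χ : C(units G, unitInterval)} (a : A.C0 u)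
    {K : Set (units G)} (h : ∀ x ∈ K, χ x = 0) : C0.VanishesOn (C0.cut χ a) K :=
  fun _ hg => C0.cut_apply_of_eq_zero a (h _ hg)

theorem C0.vanishesOn_cut_symm {u : Bis G} {χ : C(units G, unitInterval)} (a : A.C0 u)
    {K : Set (units G)} (h : ∀ x ∈ K, χ x = 1) : C0.VanishesOn (C0.cut (symmCut χ) a) K :=
  C0.vanishesOn_cut_of_zero a fun x hx => symmCut_eq_zero (h x hx)

theorem C0.isOpen_norm_lt {u : Bis G} (a : A.C0 u) (ε : ℝ) :
    IsOpen {g | g ∈ u.carrier ∧ ‖a.1 g‖ < ε} := by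
  rw [isOpen_iff_mem_nhds]
  rintro g ⟨hg, hε⟩
  have h1 := a.2.2.1.continuousAt (u.2.isOpen.mem_nhds hg)
  have h2 := h1.tendsto.eventually (A.upperSemicontinuous_norm (⟨g, a.1 g⟩ : A.Total) ε hε)
  filter_upwards [h2, u.2.isOpen.mem_nhds hg] with k hk hku
  exact ⟨hku, hk⟩

/-- In a non-Hausdorff G compact sets need not be closed, but a compact set minus an open set is
compact. Upper semicontinuity of the norm makes the set where ‖a‖ < ε inside u open, so the exact
superlevel set of ‖a‖ is compact. -/
theorem C0.exists_isCompact_norm_lt {u : Bis G} (a : A.C0 u) {ε : ℝ} (hε : 0 < ε) :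
    ∃ M ⊆ u.carrier, IsCompact M ∧ (∀ g ∈ M, ε ≤ ‖a.1 g‖) ∧ ∀ g ∉ M, ‖a.1 g‖ < ε := by
  obtain ⟨K, hK, hKc, H⟩ := a.2.2.2 ε hε
  refine ⟨K \ {g | g ∈ u.carrier ∧ ‖a.1 g‖ < ε}, Set.sdiff_subset.trans hK,
    hKc.diff (C0.isOpen_norm_lt a ε), fun g hg => ?_, fun g hg => ?_⟩
  · by_contra! h
    exact hg.2 ⟨hK hg.1, h⟩
  · by_contra! h
    exact hg ⟨by_contra fun h' => (H g h').not_ge h, fun h' => h'.2.not_ge h⟩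

end Cut

/-! ### Functionals on sections as measures on the unit space -/

section Tight

variable {G : Type u} [TopologicalSpace G] [TopGroupoid G] {A : GroupoidFellBundle.{u, v} G}

/-- A functional is tight on `V` if it is concentrated, up to `ε`, on compact subsets of `V`. -/
def Tight {u : Bis G} (ψ : StrongDual ℂ (A.C0 u)) (V : Set (units G)) : Prop :=
  ∀ ε > (0 : ℝ), ∃ K ⊆ V, IsCompact K ∧ ∀ a : A.C0 u, C0.VanishesOn a K → ‖ψ a‖ ≤ ε * ‖a‖

/-- A functional is null on `W` if it kills the sections supported in `W`. -/
def Null {u : Bis G} (ψ : StrongDual ℂ (A.C0 u)) (W : Set (units G)) : Prop :=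
  ∀ a : A.C0 u, C0.VanishesOn a Wᶜ → ψ a = 0

/-- `φ` is the part of `ψ` that lives on `U`. -/
def IsPart {u : Bis G} (U : Set (units G)) (ψ φ : StrongDual ℂ (A.C0 u)) : Prop :=
  Tight φ U ∧ Null (ψ - φ) U

theorem Null.sub {u : Bis G} {ψ φ : StrongDual ℂ (A.C0 u)} {W : Set (units G)} (h : Null ψ W)
    (h' : Null φ W) : Null (ψ - φ) W := fun a ha => by
  rw [sub_apply, h a ha, h' a ha, sub_zero]

theorem Tight.mono {u : Bis G} {ψ : StrongDual ℂ (A.C0 u)} {V V' : Set (units G)} (h : Tight ψ V)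
    (hV : V ⊆ V') : Tight ψ V' := fun ε hε => by
  obtain ⟨K, hK, H⟩ := h ε hε
  exact ⟨K, hK.trans hV, H⟩

theorem Tight.sub {u : Bis G} {ψ φ : StrongDual ℂ (A.C0 u)} {V : Set (units G)} (h : Tight ψ V)
    (h' : Tight φ V) : Tight (ψ - φ) V := fun ε hε => by
  obtain ⟨K, hK, hKc, H⟩ := h (ε / 2) (by positivity)
  obtain ⟨K', hK', hKc', H'⟩ := h' (ε / 2) (by positivity)
  refine ⟨K ∪ K', Set.union_subset hK hK', hKc.union hKc', fun a ha => ?_⟩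
  have h1 := H a (ha.mono Set.subset_union_left)
  have h2 := H' a (ha.mono Set.subset_union_right)
  have h3 := norm_sub_le (ψ a) (φ a)
  rw [sub_apply]
  linarith

variable [T2Space (units G)] [LocallyCompactSpace (units G)]

theorem exists_cut {K V : Set (units G)} (hK : IsCompact K) (hV : IsOpen V) (hKV : K ⊆ V) :
    ∃ χ : C(units G, unitInterval), (∀ x ∈ K, χ x = 1) ∧
      ∃ L ⊆ V, IsCompact L ∧ ∀ x ∉ L, χ x = 0 := by
  obtain ⟨f, h1, h2, h3, h4⟩ := exists_continuousMap_one_of_isCompact_subset_isOpen hK hV hKV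
  refine ⟨⟨fun x => ⟨f x, h4 x⟩, f.continuous.subtype_mk _⟩, fun x hx => Subtype.ext (h1 hx),
    tsupport f, h3, h2, fun x hx => Subtype.ext ?_⟩
  exact image_eq_zero_of_notMem_tsupport (f := f) hx

/-- The compact set where ‖a‖ ≥ ε has its range in U, because a vanishes over the complement of U. A
bump function equal to 1 there and compactly supported in U loses at most ε. -/
theorem C0.exists_cut_norm_sub_le {u : Bis G} (a : A.C0 u) {U : Set (units G)} (hU : IsOpen U)
    (ha : C0.VanishesOn a Uᶜ) {ε : ℝ} (hε : 0 < ε) :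
    ∃ χ : C(units G, unitInterval), (∃ L ⊆ U, IsCompact L ∧ ∀ x ∉ L, χ x = 0) ∧
      ‖a - C0.cut χ a‖ ≤ ε := by
  obtain ⟨M, hMu, hMc, h1, h2⟩ := C0.exists_isCompact_norm_lt a hε
  obtain ⟨χ, hχ, hL⟩ := exists_cut (hMc.image continuous_rngUnit) hU (by
    rintro _ ⟨g, hg, rfl⟩
    by_contra hgU
    have := h1 g hg
    rw [ha g hgU, norm_zero] at this
    linarith)
  refine ⟨χ, hL, ?_⟩
  have e : a - C0.cut χ a = C0.cut (symmCut χ) a := by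
    rw [sub_eq_iff_eq_add', C0.cut_add_cut_symmCut]
  rw [e]
  refine C0.norm_le _ hε.le fun g => ?_
  by_cases hg : g ∈ M
  · rw [C0.vanishesOn_cut_symm a (K := rngUnit '' M) hχ g ⟨g, hg, rfl⟩, norm_zero]
    exact hε.le
  · exact (C0.norm_cut_apply_le _ a g).trans (h2 g hg).le

/-- Every functional on sections is tight on `U`, as far as sections supported in `U` are
concerned. -/
theorem exists_isCompact_norm_le {u : Bis G} (ψ : StrongDual ℂ (A.C0 u)) {U : Set (units G)}
    (hU : IsOpen U) {ε : ℝ} (hε : 0 < ε) :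
    ∃ K ⊆ U, IsCompact K ∧ ∀ a : A.C0 u, C0.VanishesOn a Uᶜ → C0.VanishesOn a K →
      ‖ψ a‖ ≤ ε * ‖a‖ := by
  by_contra! hcon
  -- Gliding hump: if no compact set works, then beyond each compact K there is a compactly
  -- supported section of norm at most 1 on which ψ has real part at least ε.
  have step : ∀ K ⊆ U, IsCompact K → ∃ c : A.C0 u, ‖c‖ ≤ 1 ∧ C0.VanishesOn c K ∧
      ε ≤ (ψ c).re ∧ ∃ L ⊆ U, IsCompact L ∧ C0.VanishesOn c Lᶜ := by
    intro K hK hKc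
    obtain ⟨a, haU, haK, ha⟩ := hcon K hK hKc
    set δ := ‖ψ a‖ - ε * ‖a‖ with hδ
    have hδ0 : 0 < δ := sub_pos.2 ha
    -- The tolerance makes cutting off change ψ by at most δ/2, less than the slack δ in the strict
    -- inequality for a.
    obtain ⟨χ, ⟨L, hL, hLc, hχ⟩, hle⟩ := C0.exists_cut_norm_sub_le a hU haU
      (ε := δ / (2 * (‖ψ‖ + 1))) (by positivity)
    set b := C0.cut χ a with hb
    have hψb : ε * ‖a‖ < ‖ψ b‖ := by
      have h1 : ‖ψ (a - b)‖ ≤ ‖ψ‖ * (δ / (2 * (‖ψ‖ + 1))) :=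
        (ψ.le_opNorm _).trans (by gcongr)
      have h2 : ‖ψ‖ * (δ / (2 * (‖ψ‖ + 1))) ≤ δ / 2 := by
        rw [mul_div_assoc', div_le_div_iff₀ (by positivity) (by positivity)]
        nlinarith [norm_nonneg ψ]
      have h3 : ‖ψ a‖ ≤ ‖ψ (a - b)‖ + ‖ψ b‖ := by
        rw [map_sub]
        simpa using norm_add_le (ψ a - ψ b) (ψ b)
      linarith
    have ha0 : 0 < ‖a‖ := by
      rcases (norm_nonneg a).eq_or_lt with h0 | h0
      · have : ‖b‖ = 0 := le_antisymm (h0 ▸ C0.norm_cut_le χ a) (norm_nonneg _)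
        rw [norm_eq_zero.1 this, map_zero, norm_zero, ← h0, mul_zero] at hψb
        exact absurd hψb (lt_irrefl _)
      · exact h0
    have hψ0 : 0 < ‖ψ b‖ := lt_of_le_of_lt (by positivity) hψb
    -- This scalar turns ψ b into a positive number and divides by ‖a‖, which bounds ‖b‖.
    let z : ℂ := (starRingEnd ℂ (ψ b)) / ((‖ψ b‖ * ‖a‖ : ℝ) : ℂ)
    have hz : ‖z‖ = ‖a‖⁻¹ := by
      simp only [z, norm_div, RCLike.norm_conj, Complex.norm_real, norm_mul, norm_norm]
      field_simp
    refine ⟨z • b, ?_, ?_, ?_, L, hL, hLc, ?_⟩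
    · rw [norm_smul, hz, inv_mul_le_iff₀ ha0, mul_one]
      exact C0.norm_cut_le χ a
    · intro g hg
      rw [C0.smul_apply, haK.cut χ g hg, smul_zero]
    · have : ψ (z • b) = ((‖ψ b‖ / ‖a‖ : ℝ) : ℂ) := by
        rw [map_smul, smul_eq_mul]
        simp only [z]
        rw [div_mul_eq_mul_div, mul_comm, Complex.mul_conj, Complex.normSq_eq_norm_sq]
        rw [← Complex.ofReal_div]
        congr 1
        field_simp
      rw [this, Complex.ofReal_re, le_div_iff₀ ha0]
      exact hψb.le
    · intro g hg
      rw [C0.smul_apply, C0.cut_apply_of_eq_zero a (hχ _ hg), smul_zero]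
  -- Humps with disjoint supports add without increasing the supremum norm, while their values under
  -- ψ accumulate; for large n this exceeds ‖ψ‖.
  have many : ∀ n : ℕ, ∃ c : A.C0 u, ‖c‖ ≤ 1 ∧ n * ε ≤ (ψ c).re ∧
      ∃ L ⊆ U, IsCompact L ∧ C0.VanishesOn c Lᶜ := by
    intro n
    induction n with
    | zero => exact ⟨0, by simp, by simp, ∅, Set.empty_subset _, isCompact_empty, fun g _ => rfl⟩
    | succ n ih =>
      obtain ⟨c, hc, hcψ, L, hL, hLc, hcL⟩ := ih
      obtain ⟨d, hd, hdL, hdψ, L', hL', hLc', hdL'⟩ := step L hL hLc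
      refine ⟨c + d, C0.norm_le _ zero_le_one fun g => ?_, ?_, L ∪ L', Set.union_subset hL hL',
        hLc.union hLc', fun g hg => ?_⟩
      · by_cases hg : rngUnit g ∈ L
        · rw [C0.add_apply, hdL g hg, add_zero]
          exact (C0.norm_apply_le c g).trans hc
        · rw [C0.add_apply, hcL g hg, zero_add]
          exact (C0.norm_apply_le d g).trans hd
      · rw [map_add, Complex.add_re]
        push_cast
        linarith
      · rw [C0.add_apply, hcL g fun h => hg (Or.inl h), hdL' g fun h => hg (Or.inr h), add_zero]
  obtain ⟨n, hn⟩ := exists_nat_gt (‖ψ‖ / ε)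
  obtain ⟨c, hc, hcψ, -⟩ := many n
  rw [div_lt_iff₀ hε] at hn
  have h1 := (Complex.re_le_norm (ψ c)).trans (ψ.le_opNorm c)
  nlinarith [norm_nonneg ψ]

theorem tight_univ {u : Bis G} (ψ : StrongDual ℂ (A.C0 u)) : Tight ψ Set.univ := fun ε hε => by
  obtain ⟨K, hK, hKc, H⟩ := exists_isCompact_norm_le ψ isOpen_univ hε
  exact ⟨K, hK, hKc, fun a ha => H a (fun g hg => absurd (Set.mem_univ _) hg) ha⟩

/-- Such a ψ lives on V \ W, so only the values of the section over V \ W matter. This is the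
analogue of bounding an integral by the supremum over a set that carries the measure. -/
theorem Tight.norm_le {u : Bis G} {ψ : StrongDual ℂ (A.C0 u)} {V W : Set (units G)}
    (hV : IsOpen V) (hW : IsOpen W) (hψV : Tight ψ V) (hψW : Null ψ W) {C : ℝ} (hC : 0 ≤ C)
    {a : A.C0 u} (ha : ∀ g, rngUnit g ∈ V → rngUnit g ∉ W → ‖a.1 g‖ ≤ C) :
    ‖ψ a‖ ≤ C * ‖ψ‖ := by
  have key : ∀ ε > (0 : ℝ), ‖ψ a‖ ≤ C * ‖ψ‖ + ε * (‖ψ‖ + ‖a‖) := by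
    intro ε hε
    obtain ⟨K, hK, hKc, H⟩ := hψV ε hε
    obtain ⟨χ, hχ, L, hL, hLc, hχL⟩ := exists_cut hKc hV hK
    set b := C0.cut χ a with hb
    have hbW : ∀ g, rngUnit g ∉ W → ‖b.1 g‖ ≤ C := by
      intro g hg
      by_cases hgV : rngUnit g ∈ V
      · exact (C0.norm_cut_apply_le χ a g).trans (ha g hgV hg)
      · rw [hb, C0.cut_apply_of_eq_zero a (hχL _ fun h => hgV (hL h)), norm_zero]
        exact hC
    -- Off W the norm of b is at most C, so the compact set where it reaches C + ε lies over W. The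
    -- piece of b near that set is supported in W and is killed by ψ.
    obtain ⟨M, hMu, hMc, hM1, hM2⟩ := C0.exists_isCompact_norm_lt b (ε := C + ε) (by positivity)
    obtain ⟨σ, hσ, L', hL', hLc', hσL'⟩ := exists_cut (hMc.image continuous_rngUnit) hW (by
      rintro _ ⟨g, hg, rfl⟩
      by_contra hgW
      linarith [hM1 g hg, hbW g hgW])
    have e1 : ψ (C0.cut σ b) = 0 := hψW _ fun g hg =>
      C0.cut_apply_of_eq_zero b (hσL' _ fun h => hg (hL' h))
    have e2 : ‖C0.cut (symmCut σ) b‖ ≤ C + ε := by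
      refine C0.norm_le _ (by positivity) fun g => ?_
      by_cases hg : g ∈ M
      · rw [C0.vanishesOn_cut_symm b (K := rngUnit '' M) hσ g ⟨g, hg, rfl⟩, norm_zero]
        positivity
      · exact (C0.norm_cut_apply_le _ b g).trans (hM2 g hg).le
    have e3 : ‖ψ b‖ ≤ ‖ψ‖ * (C + ε) := by
      rw [← C0.cut_add_cut_symmCut σ b, map_add, e1, zero_add]
      exact (ψ.le_opNorm _).trans (by gcongr)
    have e4 : ‖ψ (C0.cut (symmCut χ) a)‖ ≤ ε * ‖a‖ :=
      (H _ (C0.vanishesOn_cut_symm a hχ)).trans (by gcongr; exact C0.norm_cut_le _ _)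
    have e5 : ψ a = ψ b + ψ (C0.cut (symmCut χ) a) := by
      rw [← map_add, hb, C0.cut_add_cut_symmCut]
    rw [e5]
    refine (norm_add_le _ _).trans ?_
    linarith
  refine le_of_forall_pos_le_add fun ε hε => ?_
  refine (key (ε / (‖ψ‖ + ‖a‖ + 1)) (by positivity)).trans ?_
  gcongr
  rw [div_mul_eq_mul_div, div_le_iff₀ (by positivity)]
  nlinarith

/-- Cutting off outside of a large compact subset of `U` changes the part on `U` little. -/
theorem IsPart.exists_cut {u : Bis G} {U : Set (units G)} (hU : IsOpen U)
    {ψ φ : StrongDual ℂ (A.C0 u)} (h : IsPart U ψ φ) {ε : ℝ} (hε : 0 < ε) :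
    ∃ χ : C(units G, unitInterval), (∃ L ⊆ U, IsCompact L ∧ ∀ x ∉ L, χ x = 0) ∧
      (∃ K ⊆ U, IsCompact K ∧ (∀ x ∈ K, χ x = 1) ∧
        ∀ a : A.C0 u, C0.VanishesOn a K → ‖φ a‖ ≤ ε * ‖a‖) ∧
      ∀ a : A.C0 u, ‖φ a - ψ (C0.cut χ a)‖ ≤ ε * ‖a‖ := by
  obtain ⟨K, hK, hKc, H⟩ := h.1 ε hε
  obtain ⟨χ, hχ, L, hL, hLc, hχL⟩ := GroupoidFellBundle.exists_cut hKc hU hK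
  refine ⟨χ, ⟨L, hL, hLc, hχL⟩, ⟨K, hK, hKc, hχ, H⟩, fun a => ?_⟩
  -- The cut section is supported in U, where ψ and φ agree.
  have e1 : ψ (C0.cut χ a) = φ (C0.cut χ a) := by
    have := h.2 (C0.cut χ a) fun g hg => C0.cut_apply_of_eq_zero a (hχL _ fun h => hg (hL h))
    rwa [sub_apply, sub_eq_zero] at this
  have e2 : φ a - φ (C0.cut χ a) = φ (C0.cut (symmCut χ) a) := by
    rw [sub_eq_iff_eq_add', ← map_add, C0.cut_add_cut_symmCut]
  rw [e1, e2]
  exact (H _ (C0.vanishesOn_cut_symm a hχ)).trans (by gcongr; exact C0.norm_cut_le _ _)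

/-- The part on U is a norm limit of the functionals a ↦ ψ(χa) with χ compactly supported in U, and
these inherit the concentration of ψ on V. The same approximation gives `IsPart.null`. -/
theorem IsPart.tight_inter {u : Bis G} {U V : Set (units G)} (hU : IsOpen U) (hV : IsOpen V)
    {ψ φ : StrongDual ℂ (A.C0 u)} (h : IsPart U ψ φ) (hψ : Tight ψ V) : Tight φ (V ∩ U) := by
  intro ε hε
  obtain ⟨χ, ⟨L, hL, hLc, hχL⟩, -, hφ⟩ := h.exists_cut hU (ε := ε / 2) (by positivity)
  obtain ⟨K, hK, hKc, H⟩ := hψ (ε / 2) (by positivity)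
  obtain ⟨σ, hσ, L', hL', hLc', hσL'⟩ := GroupoidFellBundle.exists_cut hKc hV hK
  refine ⟨L' ∩ L, Set.inter_subset_inter hL' hL, hLc'.inter hLc, fun a ha => ?_⟩
  have e0 : C0.cut σ (C0.cut χ a) = 0 := C0.ext fun g => by
    by_cases h1 : rngUnit g ∈ L
    · by_cases h2 : rngUnit g ∈ L'
      · rw [C0.cut_apply, C0.cut_apply, ha g ⟨h2, h1⟩, smul_zero, smul_zero]; rfl
      · exact C0.cut_apply_of_eq_zero _ (hσL' _ h2)
    · rw [C0.cut_apply, C0.cut_apply_of_eq_zero _ (hχL _ h1), smul_zero]; rfl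
  have e1 : ‖ψ (C0.cut χ a)‖ ≤ ε / 2 * ‖a‖ := by
    rw [← C0.cut_add_cut_symmCut σ (C0.cut χ a), e0, zero_add]
    refine (H _ (C0.vanishesOn_cut_symm _ hσ)).trans ?_
    gcongr
    exact (C0.norm_cut_le _ _).trans (C0.norm_cut_le _ _)
  have e2 := hφ a
  have e3 := norm_add_le (φ a - ψ (C0.cut χ a)) (ψ (C0.cut χ a))
  rw [sub_add_cancel] at e3
  linarith

theorem IsPart.null {u : Bis G} {U W : Set (units G)} (hU : IsOpen U)
    {ψ φ : StrongDual ℂ (A.C0 u)} (h : IsPart U ψ φ) (hψ : Null ψ W) : Null φ W := by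
  intro a ha
  rw [← norm_le_zero_iff]
  refine le_of_forall_pos_le_add fun ε hε => ?_
  obtain ⟨χ, -, -, hφ⟩ := h.exists_cut hU (ε := ε / (‖a‖ + 1)) (by positivity)
  have := hφ a
  rw [hψ _ (ha.cut χ), sub_zero] at this
  refine this.trans ?_
  rw [zero_add, div_mul_eq_mul_div, div_le_iff₀ (by positivity)]
  nlinarith

/-- After approximation the section has compact support L inside W ∪ U. A bump function equal to 1
on the compact set L \ W and supported in U splits it into a piece supported in U and a piece
supported in W. -/
theorem Null.union {u : Bis G} {U W : Set (units G)} (hU : IsOpen U) (hW : IsOpen W)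
    {ψ : StrongDual ℂ (A.C0 u)} (h : Null ψ U) (h' : Null ψ W) : Null ψ (W ∪ U) := by
  intro a ha
  rw [← norm_le_zero_iff]
  refine le_of_forall_pos_le_add fun ε hε => ?_
  obtain ⟨χ, ⟨L, hL, hLc, hχL⟩, hle⟩ := C0.exists_cut_norm_sub_le a (hW.union hU) ha
    (ε := ε / (‖ψ‖ + 1)) (by positivity)
  obtain ⟨σ, hσ, L', hL', -, hσL'⟩ := exists_cut (hLc.diff hW) hU (fun x hx =>
    (hL hx.1).resolve_left hx.2)
  have e0 : ψ (C0.cut χ a) = 0 := by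
    rw [← C0.cut_add_cut_symmCut σ (C0.cut χ a), map_add, h _ fun g hg =>
      C0.cut_apply_of_eq_zero _ (hσL' _ fun h => hg (hL' h)), zero_add]
    refine h' _ fun g hg => ?_
    by_cases hgL : rngUnit g ∈ L
    · exact C0.cut_apply_of_eq_zero _ (symmCut_eq_zero (hσ _ ⟨hgL, hg⟩))
    · rw [C0.cut_apply, C0.cut_apply_of_eq_zero _ (hχL _ hgL), smul_zero]
  have e1 : ψ a = ψ (a - C0.cut χ a) := by rw [map_sub, e0, sub_zero]
  rw [e1, zero_add]
  refine (ψ.le_opNorm _).trans ?_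
  refine (mul_le_mul_of_nonneg_left hle (norm_nonneg ψ)).trans ?_
  rw [mul_div_assoc', div_le_iff₀ (by positivity)]
  nlinarith [norm_nonneg ψ]

/-- Additivity of total variation. Near-optimal test sections for φ and for ψ - φ can be cut to have
disjoint supports without losing much, and then, after rotating phases, their sum is one test
section of norm at most 1 for ψ. -/
theorem IsPart.norm_add_le {u : Bis G} {U : Set (units G)} (hU : IsOpen U)
    {ψ φ : StrongDual ℂ (A.C0 u)} (h : IsPart U ψ φ) : ‖φ‖ + ‖ψ - φ‖ ≤ ‖ψ‖ := by
  have key : ∀ a b : A.C0 u, ‖a‖ ≤ 1 → ‖b‖ ≤ 1 → ‖φ a‖ + ‖(ψ - φ) b‖ ≤ ‖ψ‖ := by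
    intro a b ha hb
    refine le_of_forall_pos_le_add fun ε hε => ?_
    obtain ⟨χ, ⟨L, hL, hLc, hχL⟩, ⟨K, hK, hKc, hχK, hφK⟩, hφ⟩ :=
      h.exists_cut hU (ε := ε / 2) (by positivity)
    -- Since σ = 1 on the set L that contains the support of χ, the sections χa and (1 - σ)b are
    -- disjoint. As σ is supported in U, σb is killed by ψ - φ.
    obtain ⟨σ, hσ, L', hL', -, hσL'⟩ := GroupoidFellBundle.exists_cut hLc hU hL
    obtain ⟨z, hz, hza⟩ : ∃ z : ℂ, ‖z‖ = 1 ∧ z * ψ (C0.cut χ a) = ‖ψ (C0.cut χ a)‖ := by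
      exact RCLike.exists_norm_eq_mul_self (ψ (C0.cut χ a)) |>.imp fun z hz => ⟨hz.1, hz.2.symm⟩
    obtain ⟨w, hw, hwb⟩ : ∃ w : ℂ, ‖w‖ = 1 ∧ w * ψ (C0.cut (symmCut σ) b) =
        ‖ψ (C0.cut (symmCut σ) b)‖ :=
      RCLike.exists_norm_eq_mul_self (ψ (C0.cut (symmCut σ) b)) |>.imp
        fun z hz => ⟨hz.1, hz.2.symm⟩
    set c := z • C0.cut χ a + w • C0.cut (symmCut σ) b with hc
    have hc1 : ‖c‖ ≤ 1 := by
      refine C0.norm_le _ zero_le_one fun g => ?_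
      rw [hc, C0.add_apply, C0.smul_apply, C0.smul_apply]
      by_cases hg : rngUnit g ∈ L
      · rw [C0.vanishesOn_cut_symm b hσ g hg, smul_zero, add_zero, norm_smul, hz, one_mul]
        exact (C0.norm_apply_le _ g).trans ((C0.norm_cut_le _ _).trans ha)
      · rw [C0.cut_apply_of_eq_zero _ (hχL _ hg), smul_zero, zero_add, norm_smul, hw, one_mul]
        exact (C0.norm_apply_le _ g).trans ((C0.norm_cut_le _ _).trans hb)
    have hψc : ‖ψ (C0.cut χ a)‖ + ‖ψ (C0.cut (symmCut σ) b)‖ ≤ ‖ψ‖ := by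
      have e : ψ c = ((‖ψ (C0.cut χ a)‖ + ‖ψ (C0.cut (symmCut σ) b)‖ : ℝ) : ℂ) := by
        rw [hc, map_add, map_smul, map_smul, smul_eq_mul, smul_eq_mul, hza, hwb]
        push_cast; rfl
      have e2 := ψ.le_opNorm c
      rw [e, Complex.norm_real, Real.norm_of_nonneg (by positivity)] at e2
      exact e2.trans (mul_le_of_le_one_right (norm_nonneg ψ) hc1)
    have e1 : ‖φ a‖ ≤ ‖ψ (C0.cut χ a)‖ + ε / 2 := by
      have h1 := hφ a
      have h2 := _root_.norm_add_le (φ a - ψ (C0.cut χ a)) (ψ (C0.cut χ a))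
      rw [sub_add_cancel] at h2
      nlinarith
    have e2 : ‖(ψ - φ) b‖ ≤ ‖ψ (C0.cut (symmCut σ) b)‖ + ε / 2 := by
      have h1 : (ψ - φ) b = ψ (C0.cut (symmCut σ) b) - φ (C0.cut (symmCut σ) b) := by
        rw [← sub_apply]
        conv_lhs => rw [← C0.cut_add_cut_symmCut σ b, map_add]
        rw [h.2 _ fun g hg => C0.cut_apply_of_eq_zero _ (hσL' _ fun h => hg (hL' h)), zero_add]
      have h2 : ‖φ (C0.cut (symmCut σ) b)‖ ≤ ε / 2 * ‖C0.cut (symmCut σ) b‖ := by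
        -- The set K, on which φ is nearly concentrated, lies in L because χ = 1 on K and χ = 0 off
        -- L; so (1 - σ)b vanishes on K.
        refine hφK _ (C0.vanishesOn_cut_symm b fun x hx => hσ x ?_)
        by_contra hxL
        have := hχK x hx
        rw [hχL x hxL] at this
        exact zero_ne_one this
      have h3 := (C0.norm_cut_le (symmCut σ) b).trans hb
      rw [h1]
      refine (norm_sub_le _ _).trans ?_
      nlinarith
    linarith
  have k1 : ∀ b : A.C0 u, ‖b‖ ≤ 1 → ‖φ‖ ≤ ‖ψ‖ - ‖(ψ - φ) b‖ := fun b hb => by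
    refine ContinuousLinearMap.opNorm_le_of_unit_norm ?_ fun a ha => ?_
    · have := key 0 b (by simp) hb
      rw [map_zero, norm_zero, zero_add] at this
      linarith
    · linarith [key a b ha.le hb]
  have k2 : ‖ψ - φ‖ ≤ ‖ψ‖ - ‖φ‖ := by
    refine ContinuousLinearMap.opNorm_le_of_unit_norm ?_ fun b hb => ?_
    · have := k1 0 (by simp)
      rw [map_zero, norm_zero] at this
      linarith
    · linarith [k1 b hb.le]
  linarith

/-- The difference ψ - φ is both concentrated on U and null on U, so `Tight.norm_le` bounds it over
the empty set. The companion `IsPart.eq_zero` holds for the same reason. -/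
theorem IsPart.eq_self {u : Bis G} {U : Set (units G)} (hU : IsOpen U)
    {ψ φ : StrongDual ℂ (A.C0 u)} (h : IsPart U ψ φ) (hψ : Tight ψ U) : φ = ψ := by
  have h1 : Tight (ψ - φ) U := hψ.sub h.1
  refine (sub_eq_zero.1 (ContinuousLinearMap.ext fun a => ?_)).symm
  have := h1.norm_le hU hU h.2 le_rfl (a := a) fun g hg hg' => absurd hg hg'
  rwa [zero_mul, norm_le_zero_iff] at this

theorem IsPart.eq_zero {u : Bis G} {U : Set (units G)} (hU : IsOpen U)
    {ψ φ : StrongDual ℂ (A.C0 u)} (h : IsPart U ψ φ) (hψ : Null ψ U) : φ = 0 := by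
  refine ContinuousLinearMap.ext fun a => ?_
  have := h.1.norm_le hU hU (h.null hU hψ) le_rfl (a := a) fun g hg hg' => absurd hg hg'
  rwa [zero_mul, norm_le_zero_iff] at this

/-- Induction over the sets U j, splitting ψ each time into its part on U j and the rest. The pair
V, W records the cell V \ W on which the current functional lives, so that the bound on the
piecewise section is needed on that cell only. -/
theorem norm_add_sum_part_le_of_tight {u : Bis G} {ι : Type*} {U : ι → Set (units G)}
    (hU : ∀ j, IsOpen (U j)) (Q : ι → StrongDual ℂ (A.C0 u) →ₗ[ℂ] StrongDual ℂ (A.C0 u))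
    (hQ : ∀ j ψ, IsPart (U j) ψ (Q j ψ)) (a : ι → A.C0 u) {C : ℝ} (hC : 0 ≤ C) (F : Finset ι) :
    ∀ (V W : Set (units G)) (_ : IsOpen V) (_ : IsOpen W) (ψ : StrongDual ℂ (A.C0 u))
      (_ : Tight ψ V) (_ : Null ψ W) (a₀ : A.C0 u)
      (_ : ∀ g, rngUnit g ∈ V → rngUnit g ∉ W → ‖a₀.1 g +
        ∑ j ∈ F, open Classical in if rngUnit g ∈ U j then (a j).1 g else 0‖ ≤ C),
      ‖ψ a₀ + ∑ j ∈ F, Q j ψ (a j)‖ ≤ C * ‖ψ‖ := by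
  classical
  induction F using Finset.induction_on with
  | empty =>
    intro V W hV hW ψ hψV hψW a₀ h
    rw [Finset.sum_empty, add_zero]
    refine hψV.norm_le hV hW hψW hC fun g hg hg' => ?_
    simpa using h g hg hg'
  | insert j F hj ih =>
    intro V W hV hW ψ hψV hψW a₀ h
    have hP := hQ j ψ
    set φ := Q j ψ with hφ
    have e1 : Q j φ = φ := (hQ j φ).eq_self (hU j) hP.1
    have e2 : Q j (ψ - φ) = 0 := (hQ j (ψ - φ)).eq_zero (hU j) hP.2
    -- On the cell inside U j the j-th summand is switched on everywhere and is absorbed into a₀; on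
    -- the cell outside U j, treated next, it is switched off.
    have h1 := ih (V ∩ U j) W (hV.inter (hU j)) hW φ (hP.tight_inter (hU j) hV hψV)
      (hP.null (hU j) hψW) (a₀ + a j) fun g hg hg' => by
        have := h g hg.1 hg'
        rw [Finset.sum_insert hj, if_pos hg.2, ← add_assoc] at this
        exact this
    have h2 := ih V (W ∪ U j) hV (hW.union (hU j)) (ψ - φ)
      (hψV.sub ((hP.tight_inter (hU j) hV hψV).mono Set.inter_subset_left))
      (Null.union (hU j) hW hP.2 (hψW.sub (hP.null (hU j) hψW))) a₀ fun g hg hg' => by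
        have := h g hg fun h => hg' (Or.inl h)
        rw [Finset.sum_insert hj, if_neg fun h => hg' (Or.inr h), zero_add] at this
        exact this
    have e3 : ψ a₀ + ∑ i ∈ insert j F, Q i ψ (a i) =
        (φ (a₀ + a j) + ∑ i ∈ F, Q i φ (a i)) +
          ((ψ - φ) a₀ + ∑ i ∈ F, Q i (ψ - φ) (a i)) := by
      rw [Finset.sum_insert hj, ← hφ, map_add]
      simp only [map_sub, sub_apply, Finset.sum_sub_distrib]
      ring
    rw [e3]
    refine (_root_.norm_add_le _ _).trans ((add_le_add h1 h2).trans ?_)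
    rw [← mul_add]
    -- The constant does not grow with the number of pieces because the norms of the two parts add
    -- up to at most ‖ψ‖.
    exact mul_le_mul_of_nonneg_left (hP.norm_add_le (hU j)) hC

/-- A combination of parts of a functional is bounded by the supremum norm of the corresponding
piecewise continuous section. -/
theorem norm_add_sum_part_le {u : Bis G} {ι : Type*} {U : ι → Set (units G)}
    (hU : ∀ j, IsOpen (U j)) (Q : ι → StrongDual ℂ (A.C0 u) →ₗ[ℂ] StrongDual ℂ (A.C0 u))
    (hQ : ∀ j ψ, IsPart (U j) ψ (Q j ψ)) (a₀ : A.C0 u) (a : ι → A.C0 u) {C : ℝ} (hC : 0 ≤ C)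
    (F : Finset ι) (h : ∀ g, ‖a₀.1 g +
        ∑ j ∈ F, open Classical in if rngUnit g ∈ U j then (a j).1 g else 0‖ ≤ C)
    (ψ : StrongDual ℂ (A.C0 u)) : ‖ψ a₀ + ∑ j ∈ F, Q j ψ (a j)‖ ≤ C * ‖ψ‖ :=
  norm_add_sum_part_le_of_tight hU Q hQ a hC F Set.univ ∅ isOpen_univ isOpen_empty ψ (tight_univ ψ)
    (fun a ha => by
      rw [show a = 0 from C0.ext fun g => ha g (Set.notMem_empty _), map_zero]) a₀
    fun g _ _ => h g

end Tight

end GroupoidFellBundle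

/-! ### Units in the biduals of C⋆-algebras -/

section BidualUnit

/-- If `ψ` is a functional on a C⋆-algebra and `e` runs through an approximate unit, then
`y ↦ ψ (y - e y)` converges to `0` in norm. -/
theorem eventually_norm_sub_mul_le {N : Type*} [NonUnitalCStarAlgebra N] {l : Filter N}
    (h1 : ∀ m : N, Tendsto (· * m) l (𝓝 m)) (h2 : ∀ᶠ e in l, ‖e‖ ≤ 1)
    (h3 : ∀ᶠ e in l, star e = e) (ψ : StrongDual ℂ N) {δ : ℝ} (hδ : 0 < δ) :
    ∀ᶠ e in l, ∀ y : N, ‖ψ (y - e * y)‖ ≤ δ * ‖y‖ := by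
  by_contra hcon
  -- If the convergence fails, almost orthogonal increments can be added up: the norm of the sum
  -- grows at most like √n, but its image under ψ grows at least like n.
  have many : ∀ n : ℕ, ∃ z : N, ‖z‖ ^ 2 ≤ 5 * n ∧ n * δ ≤ (ψ z).re := by
    intro n
    induction n with
    | zero => exact ⟨0, by simp, by simp⟩
    | succ n ih =>
      obtain ⟨z, hz, hψz⟩ := ih
      have h4 : ∀ᶠ e in l, ‖e * z - z‖ < 1 / 2 := by
        have := (h1 z).eventually (Metric.ball_mem_nhds z (by norm_num : (0 : ℝ) < 1 / 2))
        filter_upwards [this] with e he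
        rwa [← dist_eq_norm]
      obtain ⟨e, he, he1, hes, hez⟩ :=
        ((not_eventually.1 hcon).and_eventually (h2.and (h3.and h4))).exists
      push Not at he
      obtain ⟨y, hy⟩ := he
      obtain ⟨c, hc, hcy⟩ := Complex.exists_norm_eq_mul_self (ψ (y - e * y))
      have hy0 : 0 < ‖y‖ := by
        rw [norm_pos_iff]
        rintro rfl
        simp at hy
      set y' : N := (c * ((‖y‖⁻¹ : ℝ) : ℂ)) • y with hy'
      have hny : ‖y'‖ = 1 := by
        rw [hy', norm_smul, norm_mul, hc, one_mul, Complex.norm_real, norm_inv, norm_norm,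
          inv_mul_cancel₀ hy0.ne']
      have hψy : ψ (y' - e * y') = ((‖ψ (y - e * y)‖ * ‖y‖⁻¹ : ℝ) : ℂ) := by
        rw [hy', mul_smul_comm, ← smul_sub, map_smul, smul_eq_mul, Complex.ofReal_mul, hcy]
        ring
      have hw : ‖y' - e * y'‖ ≤ 2 := by
        refine (norm_sub_le _ _).trans ?_
        have := norm_mul_le e y'
        rw [hny, mul_one] at this
        linarith
      set w := y' - e * y' with hwdef
      have hzw : ‖star z * w‖ ≤ 1 / 2 := by
        -- Because e is self-adjoint, e can be moved onto z, which it almost fixes; hence z and w =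
        -- y' - e y' are almost orthogonal.
        have e1 : star z * w = - (star (e * z - z) * y') := by
          rw [hwdef, star_sub, star_mul, hes, mul_sub, sub_mul, mul_assoc]
          abel
        rw [e1, norm_neg]
        refine (norm_mul_le _ _).trans ?_
        rw [norm_star, hny, mul_one]
        exact hez.le
      refine ⟨z + w, ?_, ?_⟩
      -- The increment of the squared norm is at most 5: 4 from w^* w, and 1/2 from each of the two
      -- cross terms.
      · have e2 : ‖z + w‖ ^ 2 = ‖star (z + w) * (z + w)‖ := by
          rw [CStarRing.norm_star_mul_self, sq]
        have e3 : star (z + w) * (z + w) = star z * z + star w * w + (star z * w +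
            star (star z * w)) := by
          rw [star_add, star_mul, star_star]
          noncomm_ring
        have e4 : ‖star z * z‖ = ‖z‖ ^ 2 := by rw [CStarRing.norm_star_mul_self, sq]
        have e5 : ‖star w * w‖ ≤ 4 := by
          rw [CStarRing.norm_star_mul_self]
          nlinarith [norm_nonneg w]
        rw [e2, e3]
        refine (norm_add_le _ _).trans ?_
        have e6 := norm_add_le (star z * z) (star w * w)
        have e7 := norm_add_le (star z * w) (star (star z * w))
        rw [norm_star] at e7
        push_cast
        linarith
      · rw [map_add, Complex.add_re, hψy, Complex.ofReal_re]
        have : δ ≤ ‖ψ (y - e * y)‖ * ‖y‖⁻¹ := by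
          rw [← div_eq_mul_inv, le_div_iff₀ hy0]
          exact hy.le
        push_cast
        linarith
  obtain ⟨n, hn⟩ := exists_nat_gt (5 * ‖ψ‖ ^ 2 / δ ^ 2)
  rw [div_lt_iff₀ (by positivity)] at hn
  obtain ⟨z, hz, hψz⟩ := many n
  have h5 := (Complex.re_le_norm (ψ z)).trans (ψ.le_opNorm z)
  have h6 : (n * δ) ^ 2 ≤ ‖ψ‖ ^ 2 * ‖z‖ ^ 2 := by
    rw [← mul_pow]
    exact pow_le_pow_left₀ (by positivity) (hψz.trans h5) 2
  have hn0 : (0 : ℝ) < n := by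
    rcases Nat.eq_zero_or_pos n with h | h
    · subst h
      have : 0 ≤ 5 * ‖ψ‖ ^ 2 := by positivity
      simp only [CharP.cast_eq_zero, zero_mul] at hn
      linarith
    · exact_mod_cast h
  have h7 : ‖ψ‖ ^ 2 * ‖z‖ ^ 2 ≤ ‖ψ‖ ^ 2 * (5 * n) := by gcongr
  have h8 : (n : ℝ) * (n * δ ^ 2) ≤ n * (5 * ‖ψ‖ ^ 2) := by nlinarith
  have := le_of_mul_le_mul_left h8 hn0
  linarith

/-- By Hahn–Banach, the restriction of φ to I extends without increase of norm, and an element of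
I'' does not see the difference between φ and this extension. -/
theorem Bidual.norm_apply_le_of_mem_ofSubspace {X : Type*} [NormedAddCommGroup X]
    [NormedSpace ℂ X] {I : Submodule ℂ X} {m : Bidual X} (hm : m ∈ Bidual.ofSubspace I)
    {φ : StrongDual ℂ X} {δ : ℝ} (hδ : 0 ≤ δ) (h : ∀ x ∈ I, ‖φ x‖ ≤ δ * ‖x‖) :
    ‖m φ‖ ≤ ‖m‖ * δ := by
  obtain ⟨θ, hθ, hn⟩ := exists_extension_norm_eq I (φ.comp I.subtypeL)
  have h1 : m φ = m θ := by
    rw [← sub_eq_zero, ← map_sub]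
    refine hm _ fun x hx => ?_
    rw [sub_apply, hθ ⟨x, hx⟩, sub_eq_zero]
    rfl
  have h2 : ‖θ‖ ≤ δ := by
    rw [hn]
    exact ContinuousLinearMap.opNorm_le_bound _ hδ fun x => h x.1 x.2
  rw [h1]
  exact (m.le_opNorm θ).trans (by gcongr)

theorem Bidual.exists_norm_apply_le {X : Type*} [NormedAddCommGroup X] [NormedSpace ℂ X]
    {I : Submodule ℂ X} {m : Bidual X} (hm : m ∈ Bidual.ofSubspace I) :
    ∃ M : ℝ, 0 ≤ M ∧ ∀ (φ : StrongDual ℂ X) (δ : ℝ), 0 ≤ δ → (∀ x ∈ I, ‖φ x‖ ≤ δ * ‖x‖) →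
      ‖m φ‖ ≤ M * δ :=
  ⟨‖m‖, norm_nonneg m, fun _ _ hδ h => Bidual.norm_apply_le_of_mem_ofSubspace hm hδ h⟩

theorem Bidual.IsUnitOf.apply_comp_left {X : Type*} [NormedAddCommGroup X] [NormedSpace ℂ X]
    {μ : X →L[ℂ] X →L[ℂ] X} {I : Submodule ℂ X} {e : Bidual X} (h : Bidual.IsUnitOf μ I e) {d : X}
    (hd : d ∈ I) (φ : StrongDual ℂ X) : e (φ.comp (μ d)) = φ d :=
  DFunLike.congr_fun (h.2 (NormedSpace.inclusionInDoubleDual ℂ X d) fun _ hθ => hθ d hd).2 φ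

theorem Bidual.IsUnitOf.apply_comp_right {X : Type*} [NormedAddCommGroup X] [NormedSpace ℂ X]
    {μ : X →L[ℂ] X →L[ℂ] X} {I : Submodule ℂ X} {e : Bidual X} (h : Bidual.IsUnitOf μ I e) {d : X}
    (hd : d ∈ I) (φ : StrongDual ℂ X) : e (φ.comp (μ.flip d)) = φ d :=
  DFunLike.congr_fun (h.2 (NormedSpace.inclusionInDoubleDual ℂ X d) fun _ hθ => hθ d hd).1 φ

/-- The bidual of a C⋆-algebra, embedded into a larger Banach algebra, is unital. -/
theorem Bidual.exists_isUnitOf {N X : Type*} [NonUnitalCStarAlgebra N] [NormedAddCommGroup X]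
    [NormedSpace ℂ X] (μ : X →L[ℂ] X →L[ℂ] X) (Φ : N →ₗᵢ[ℂ] X)
    (hΦ : ∀ a b, Φ (a * b) = μ (Φ a) (Φ b)) {I : Submodule ℂ X}
    (hI : LinearMap.range Φ.toLinearMap = I) : ∃ e, Bidual.IsUnitOf μ I e := by
  let _ := CStarAlgebra.spectralOrder N
  let _ := CStarAlgebra.spectralOrderedRing N
  have hl := CStarAlgebra.increasingApproximateUnit N
  set l := CStarAlgebra.approximateUnit N
  have hmem : ∀ n, Φ n ∈ I := fun n => hI ▸ ⟨n, rfl⟩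
  -- The unit is a weak⋆ cluster point of an approximate unit, which exists by Banach–Alaoglu.
  let ul : Ultrafilter N := Ultrafilter.of l
  have hul : (ul : Filter N) ≤ l := Ultrafilter.of_le l
  let F : N → WeakDual ℂ (StrongDual ℂ X) := fun n =>
    StrongDual.toWeakDual (NormedSpace.inclusionInDoubleDual ℂ X (Φ n))
  have hF : ∀ᶠ n in (ul : Filter N), F n ∈ WeakDual.toStrongDual ⁻¹'
      Metric.closedBall (0 : Bidual X) 1 := by
    filter_upwards [hul hl.eventually_norm] with n hn
    change NormedSpace.inclusionInDoubleDual ℂ X (Φ n) ∈ Metric.closedBall (0 : Bidual X) 1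
    refine (mem_closedBall_zero_iff (E := Bidual X)).2 ?_
    exact (NormedSpace.double_dual_bound ℂ X (Φ n)).trans (by rwa [Φ.norm_map])
  obtain ⟨E, -, hE⟩ := (WeakDual.isCompact_closedBall (𝕜 := ℂ) (0 : Bidual X) 1).ultrafilter_le_nhds
    (ul.map F) (by rw [le_principal_iff]; exact hF)
  have hlim : ∀ ψ : StrongDual ℂ X, Tendsto (fun n => ψ (Φ n)) ul
      (𝓝 (WeakDual.toStrongDual E ψ)) := fun ψ =>
    ((WeakDual.eval_continuous ψ).tendsto E).comp hE
  refine ⟨WeakDual.toStrongDual E, ?_, fun m hm => ⟨?_, ?_⟩⟩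
  · intro φ hφ
    refine tendsto_nhds_unique (hlim φ) ?_
    simp only [hφ _ (hmem _)]
    exact tendsto_const_nhds
  -- Here m is applied to functionals that vary with the approximate unit. Weak⋆ convergence does
  -- not suffice: the functionals y ↦ ψ(ey) must converge to ψ in norm on I, which is
  -- `eventually_norm_sub_mul_le`.
  · refine ContinuousLinearMap.ext fun ψ => ?_
    rw [Bidual.arens_apply]
    refine tendsto_nhds_unique (hlim _) ?_
    rw [Metric.tendsto_nhds]
    intro ε hε
    have h1 := eventually_norm_sub_mul_le hl.tendsto_mul_right hl.eventually_norm
      hl.eventually_star_eq (ψ.comp Φ.toContinuousLinearMap) (δ := ε / (2 * (‖m‖ + 1)))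
      (by positivity)
    filter_upwards [hul h1] with e he
    have e1 : dist ((m.comp ((ContinuousLinearMap.compL ℂ X X ℂ ψ).comp μ)) (Φ e)) (m ψ) =
        ‖m (ψ - ψ.comp (μ (Φ e)))‖ := by
      rw [dist_comm, dist_eq_norm, map_sub]
      rfl
    rw [e1]
    refine (Bidual.norm_apply_le_of_mem_ofSubspace hm (δ := ε / (2 * (‖m‖ + 1)))
      (by positivity) ?_).trans_lt ?_
    · intro x hx
      rw [← hI] at hx
      obtain ⟨y, rfl⟩ := hx
      have := he y
      rw [← Φ.norm_map y] at this
      refine le_trans (le_of_eq ?_) this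
      congr 1
      change ψ (Φ y) - ψ (μ (Φ e) (Φ y)) = ψ (Φ (y - e * y))
      rw [← hΦ, ← map_sub, ← map_sub]
    · rw [mul_div_assoc', div_lt_iff₀ (by positivity)]
      nlinarith [norm_nonneg m]
  -- In the other order m is applied to one fixed functional, so it suffices to compare with ψ
  -- pointwise on I.
  · refine ContinuousLinearMap.ext fun ψ => ?_
    rw [Bidual.arens_apply, ← sub_eq_zero, ← map_sub]
    refine hm _ fun x hx => ?_
    rw [← hI] at hx
    obtain ⟨k, rfl⟩ := hx
    rw [sub_apply, sub_eq_zero]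
    refine tendsto_nhds_unique (hlim _) ?_
    have h2 : Tendsto (fun n => ψ (Φ (k * n))) l (𝓝 (ψ (Φ k))) :=
      ((ψ.continuous.comp Φ.continuous).tendsto k).comp (hl.tendsto_mul_left k)
    refine (h2.mono_left hul).congr fun n => ?_
    rw [hΦ]
    rfl

end BidualUnit

/-- The intersection of two open bisections. -/
def Bis.inter {G : Type u} [TopologicalSpace G] [TopGroupoid G] [EtaleGroupoid G] (u w : Bis G) :
    Bis G :=
  ⟨u.carrier ∩ w.carrier, EtaleGroupoid.isOpenBisection_of_injOn (u.2.isOpen.inter w.2.isOpen)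
    (fun _ hg _ hh e => u.rng_inj hg.1 hh.1 e) (fun _ hg _ hh e => u.src_inj hg.1 hh.1 e)⟩

/-- The units in a bisection, as a subset of the unit space. -/
def Bis.unitSet {G : Type u} [TopologicalSpace G] [TopGroupoid G] (u : Bis G) : Set (units G) :=
  Subtype.val ⁻¹' u.carrier

theorem Bis.isOpen_unitSet {G : Type u} [TopologicalSpace G] [TopGroupoid G] (u : Bis G) :
    IsOpen u.unitSet :=
  u.2.isOpen.preimage continuous_subtype_val

namespace GroupoidFellBundle

/-! ### The ideals I_{s,1} as spaces of sections over units -/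

section Ideal

variable {G : Type u} [TopologicalSpace G] [TopGroupoid G] {A : GroupoidFellBundle.{u, v} G}

theorem rngUnit_of_unit (x : units G) : rngUnit x.1 = x := Subtype.ext (rng_of_unit x.2)

theorem C0.sub_apply {u : Bis G} (f f' : A.C0 u) (g : G) : (f - f').1 g = f.1 g - f'.1 g := rfl

theorem C0.sum_apply {u : Bis G} {ι : Type*} (F : Finset ι) (f : ι → A.C0 u) (g : G) :
    (∑ i ∈ F, f i).1 g = ∑ i ∈ F, (f i).1 g := by
  classical
  induction F using Finset.induction_on with
  | empty => simp
  | insert j F hj ih => rw [Finset.sum_insert hj, Finset.sum_insert hj, C0.add_apply, ih]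

theorem C0.sum_cut_eq {u : Bis G} {n : ℕ} {ρ : Fin n → C(units G, unitInterval)} {a : A.C0 u}
    {L : Set (units G)} (ha : C0.VanishesOn a Lᶜ)
    (h : ∀ x ∈ L, ∑ i, ((ρ i x : ℝ) : ℂ) = 1) : ∑ i, C0.cut (ρ i) a = a := C0.ext fun g => by
  rw [C0.sum_apply]
  simp only [C0.cut_apply]
  rw [← Finset.sum_smul]
  by_cases hg : rngUnit g ∈ L
  · rw [h _ hg, one_smul]
  · rw [ha g hg, smul_zero]

theorem C0.isClosed_vanishesOn {u : Bis G} (K : Set (units G)) :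
    IsClosed {a : A.C0 u | C0.VanishesOn a K} := by
  rw [← isSeqClosed_iff_isClosed]
  intro F f hF hf g hg
  have h1 := squeeze_zero (fun _ => norm_nonneg _) (fun i => C0.norm_apply_le (F i - f) g)
    (tendsto_iff_norm_sub_tendsto_zero.1 hf)
  have h2 : ∀ i, (F i - f).1 g = - f.1 g := fun i => by
    rw [C0.sub_apply, hF i g hg, zero_sub]
  simp only [h2, norm_neg] at h1
  exact norm_eq_zero.1 (tendsto_nhds_unique tendsto_const_nhds h1)

section Partition

variable [T2Space (units G)] [LocallyCompactSpace (units G)]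

theorem exists_partition {ι : Type*} {L : Set (units G)} (hL : IsCompact L)
    {O : ι → Set (units G)} (hO : ∀ i, IsOpen (O i)) (hLO : L ⊆ ⋃ i, O i) :
    ∃ (n : ℕ) (j : Fin n → ι) (ρ : Fin n → C(units G, unitInterval)),
      (∀ i, ∀ x ∉ O (j i), ρ i x = 0) ∧ ∀ x ∈ L, ∑ i, ((ρ i x : ℝ) : ℂ) = 1 := by
  obtain ⟨t, ht⟩ := hL.elim_finite_subcover O hO hLO
  let j : Fin t.card → ι := fun i => (t.equivFin.symm i).1
  obtain ⟨f, h1, h2, h3, -⟩ := exists_continuous_sum_one_of_isOpen_isCompact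
    (s := fun i => O (j i)) (fun i => hO _) hL (fun x hx => by
      obtain ⟨i, hi⟩ := Set.mem_iUnion.1 (ht hx)
      obtain ⟨hit, hxi⟩ := Set.mem_iUnion.1 hi
      refine Set.mem_iUnion.2 ⟨t.equivFin ⟨i, hit⟩, ?_⟩
      simpa [j] using hxi)
  refine ⟨t.card, j, fun i => ⟨fun x => ⟨f i x, h3 i x⟩, (f i).continuous.subtype_mk _⟩,
    fun i x hx => Subtype.ext ?_, fun x hx => ?_⟩
  · exact image_eq_zero_of_notMem_tsupport (f := f i) fun h => hx (h1 i h)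
  · have := h2 hx
    simp only [Finset.sum_apply, Pi.one_apply] at this
    simp only [ContinuousMap.coe_mk]
    exact_mod_cast this

end Partition

variable [EtaleGroupoid G]

/-- For a set w of units, w itself is the idempotent that witnesses the natural order: w w = w and s
w = w. -/
theorem natLE_of_subset {S : InverseSubmonoid (Bis G)} {w s : S.toSubmonoid}
    (h : w.1.carrier ⊆ s.1.carrier) (hw : w.1.carrier ⊆ units G) : NatLE w s := by
  have key : ∀ k ∈ w.1, IsMul k k k := fun k hk => isMul_unit (hw hk)
  refine ⟨w, Subtype.ext (Bis.ext fun k => ⟨?_, fun hk => ⟨k, k, hk, hk, key k hk⟩⟩),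
    Subtype.ext (Bis.ext fun k => ⟨?_, fun hk => ⟨k, k, h hk, hk, key k hk⟩⟩)⟩
  all_goals
    rintro ⟨a, b, ha, hb, H⟩
    have e1 : b = src a := by rw [H.comp, rng_of_unit (hw hb)]
  · rw [e1] at H
    rwa [H.unique (isMul_src a)]
  · have e2 : a = b := s.1.src_inj ha (h hb) (by rw [show src b = b from hw hb, e1])
    subst e2
    rwa [H.unique (key a hb)]

theorem C0.VanishesOn.apply_rng {b : A.C0 (1 : Bis G)} {K : Set (units G)}
    (h : C0.VanishesOn b K) {g : G} (hg : rngUnit g ∈ K) : b.1 (rng g) = 0 :=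
  h (rng g) (by rwa [show rngUnit (rng g) = rngUnit g from Subtype.ext (rng_rng g)])

theorem inv_mul_self_of_subset_units {w : Bis G} (hw : w.carrier ⊆ units G) : w⁻¹ * w = w := by
  refine Bis.ext fun k => ⟨?_, fun hk => ⟨k, k, ?_, hk, isMul_unit (hw hk)⟩⟩
  · rintro ⟨b, c, hb, hc, H⟩
    have hb' : ginv b ∈ w := hb
    have h3 := ginv_of_unit (hw hb')
    rw [ginv_ginv] at h3
    rw [← h3] at hb'
    have h4 : src b = b := hw hb'
    have e1 : b = c := by rw [← h4, H.comp, rng_of_unit (hw hc)]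
    subst e1
    rwa [H.unique (isMul_unit (hw hc))]
  · change ginv k ∈ w
    rwa [ginv_of_unit (hw hk)]

variable [T2Space (units G)]

/-- The compact sets where ‖a‖ ≥ ε lie in u ∩ w, so a is a C₀-section over u ∩ w, and its extension
by zero to w is again continuous. This lets a section change its bisection. -/
theorem C0.mem_of_eq_zero {u w : Bis G} (a : A.C0 u) (h : ∀ g, g ∉ w → a.1 g = 0) :
    a.1 ∈ A.C0 w := by
  have h1 : a.1 ∈ A.C0 (u.inter w) := by
    refine ⟨fun g hg => ?_, a.2.2.1.mono Set.inter_subset_left, fun ε hε => ?_⟩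
    · by_cases hgu : g ∈ u
      · exact h g fun hgw => hg ⟨hgu, hgw⟩
      · exact C0.apply_eq_zero a hgu
    · obtain ⟨M, hM, hMc, h1, h2⟩ := C0.exists_isCompact_norm_lt a hε
      refine ⟨M, fun g hg => ⟨hM hg, ?_⟩, hMc, h2⟩
      by_contra hgw
      have := h1 g hg
      rw [h g hgw, norm_zero] at this
      linarith
  exact C0.mono Set.inter_subset_right h1

/-- The sections over the unit space supported in the bisection `u`. -/
def C0.idealOf (A : GroupoidFellBundle.{u, v} G) (u : Bis G) : Submodule ℂ (A.C0 (1 : Bis G)) where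
  carrier := {f | C0.VanishesOn f u.unitSetᶜ}
  add_mem' {a b} ha hb g hg := by rw [C0.add_apply, ha g hg, hb g hg, add_zero]
  zero_mem' _ _ := rfl
  smul_mem' c a ha g hg := by rw [C0.smul_apply, ha g hg, smul_zero]

variable (S : InverseSubmonoid (Bis G))

/-- The left multiplication `B_1 × B_s → B_s`. -/
noncomputable def lmulC0 (A : GroupoidFellBundle.{u, v} G) (s : S.toSubmonoid) :
    A.C0 (1 : Bis G) →L[ℂ] A.C0 s.1 →L[ℂ] A.C0 s.1 :=
  (A.toFellBundle S).lmul s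

/-- The multiplication of `B_1`. -/
noncomputable def lmulOne (A : GroupoidFellBundle.{u, v} G) :
    A.C0 (1 : Bis G) →L[ℂ] A.C0 (1 : Bis G) →L[ℂ] A.C0 (1 : Bis G) :=
  (A.toFellBundle S).lmul 1

/-- The right multiplication `B_s × B_1 → B_s`. -/
noncomputable def rmulC0 (A : GroupoidFellBundle.{u, v} G) (s : S.toSubmonoid) :
    A.C0 s.1 →L[ℂ] A.C0 (1 : Bis G) →L[ℂ] A.C0 s.1 :=
  (A.toFellBundle S).rmul s

/-- The involution of `B_1`. -/
noncomputable def starC0 (A : GroupoidFellBundle.{u, v} G) (b : A.C0 (1 : Bis G)) :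
    A.C0 (1 : Bis G) :=
  (A.toFellBundle S).starOne b

/-- The projection `1_s`. -/
noncomputable def projC0 (A : GroupoidFellBundle.{u, v} G) (s : S.toSubmonoid) :
    Bidual (A.C0 (1 : Bis G)) :=
  (A.toFellBundle S).unitProj s

variable {S}

theorem lmulC0_apply {s : S.toSubmonoid} (b : A.C0 (1 : Bis G)) (a : A.C0 s.1) (g : G) :
    (lmulC0 S A s b a).1 g = A.mul (isMul_rng g) (b.1 (rng g)) (a.1 g) := by
  change (C0.mul (1 : Bis G) s.1 b a).1 g = _
  by_cases hg : g ∈ s.1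
  · exact C0.mul_apply b a (rng_mem_units g) hg (isMul_rng g)
  · rw [C0.apply_eq_zero a hg, map_zero]
    exact C0.apply_eq_zero _ (by rwa [one_mul])

theorem rmulC0_apply {s : S.toSubmonoid} (a : A.C0 s.1) (b : A.C0 (1 : Bis G)) (g : G) :
    (rmulC0 S A s a b).1 g = A.mul (isMul_src g) (a.1 g) (b.1 (src g)) := by
  change (C0.mul s.1 (1 : Bis G) a b).1 g = _
  by_cases hg : g ∈ s.1
  · exact C0.mul_apply a b hg (src_mem_units g) (isMul_src g)
  · rw [C0.apply_eq_zero a hg, map_zero, LinearMap.zero_apply]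
    exact C0.apply_eq_zero _ (by rwa [mul_one])

theorem lmulOne_apply (b a : A.C0 (1 : Bis G)) (g : G) :
    (lmulOne S A b a).1 g = A.mul (isMul_rng g) (b.1 (rng g)) (a.1 g) :=
  lmulC0_apply (s := (1 : S.toSubmonoid)) b a g

theorem lmulOne_apply_unit (b a : A.C0 (1 : Bis G)) (x : units G) :
    (lmulOne S A b a).1 x.1 = A.mul (isMul_unit x.2) (b.1 x.1) (a.1 x.1) :=
  C0.mul_apply b a x.2 x.2 (isMul_unit x.2)

theorem norm_lmulOne_le (b a : A.C0 (1 : Bis G)) : ‖lmulOne S A b a‖ ≤ ‖b‖ * ‖a‖ :=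
  C0.norm_mul_le b a

theorem C0.VanishesOn.lmulOne_right {a : A.C0 (1 : Bis G)} {K : Set (units G)}
    (h : C0.VanishesOn a K) (b : A.C0 (1 : Bis G)) : C0.VanishesOn (lmulOne S A b a) K :=
  fun g hg => by rw [lmulOne_apply, h g hg, map_zero]

theorem C0.VanishesOn.lmulOne_left {b : A.C0 (1 : Bis G)} {K : Set (units G)}
    (h : C0.VanishesOn b K) (a : A.C0 (1 : Bis G)) : C0.VanishesOn (lmulOne S A b a) K :=
  fun g hg => by rw [lmulOne_apply, h.apply_rng hg, map_zero, LinearMap.zero_apply]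

theorem C0.VanishesOn.lmulC0_right {s : S.toSubmonoid} {a : A.C0 s.1} {K : Set (units G)}
    (h : C0.VanishesOn a K) (b : A.C0 (1 : Bis G)) : C0.VanishesOn (lmulC0 S A s b a) K :=
  fun g hg => by rw [lmulC0_apply, h g hg, map_zero]

theorem C0.VanishesOn.lmulC0_left {s : S.toSubmonoid} {b : A.C0 (1 : Bis G)} {K : Set (units G)}
    (h : C0.VanishesOn b K) (a : A.C0 s.1) : C0.VanishesOn (lmulC0 S A s b a) K :=
  fun g hg => by rw [lmulC0_apply, h.apply_rng hg, map_zero, LinearMap.zero_apply]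

theorem starC0_apply (b : A.C0 (1 : Bis G)) (x : units G) :
    (starC0 S A b).1 x.1 = A.star (ginv_of_unit x.2) (b.1 x.1) :=
  C0.star_apply b (ginv_of_unit x.2)

theorem norm_lmulC0_le {s : S.toSubmonoid} (b : A.C0 (1 : Bis G)) (a : A.C0 s.1) :
    ‖lmulC0 S A s b a‖ ≤ ‖b‖ * ‖a‖ :=
  C0.norm_mul_le b a

variable [LocallyCompactSpace (units G)]

theorem idealOf_le_of_forall_mem (hS : S.IsWide) (s : S.toSubmonoid)
    {J : Submodule ℂ (A.C0 (1 : Bis G))} (hJc : IsClosed (J : Set (A.C0 (1 : Bis G))))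
    (hJ : ∀ w : S.toSubmonoid, w.1.carrier ⊆ s.1.carrier → w.1.carrier ⊆ units G →
      ∀ a : A.C0 (1 : Bis G), a.1 ∈ A.C0 w.1 → a ∈ J) : C0.idealOf A s.1 ≤ J := by
  intro f hf
  have hcut : ∀ χ : C(units G, unitInterval), (∃ L ⊆ s.1.unitSet, IsCompact L ∧
      ∀ x ∉ L, χ x = 0) → C0.cut χ f ∈ J := by
    rintro χ ⟨L, hL, hLc, hχ⟩
    -- Wideness, applied to s and the unit of S, covers the units in s by members of S that are
    -- contained in s ∩ G⁰.
    have hcov : ∀ x : L, ∃ w : S.toSubmonoid, x.1.1 ∈ w.1 ∧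
        w.1.carrier ⊆ s.1.carrier ∩ units G := fun x => by
      obtain ⟨w, hw, hxw, hsub⟩ := hS.2 s.1 s.2 1 (one_mem _) x.1.1 (hL x.2) x.1.2
      exact ⟨⟨w, hw⟩, hxw, hsub⟩
    choose w hxw hw using hcov
    obtain ⟨n, j, ρ, hρ, hsum⟩ := exists_partition hLc (O := fun x : L => (w x).1.unitSet)
      (fun x => Bis.isOpen_unitSet _) fun x hx => Set.mem_iUnion.2 ⟨⟨x, hx⟩, hxw ⟨x, hx⟩⟩
    rw [← C0.sum_cut_eq (a := C0.cut χ f) (ρ := ρ) (L := L)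
      (C0.vanishesOn_cut_of_zero f hχ) hsum]
    refine sum_mem fun i _ => ?_
    refine hJ (w (j i)) (fun k hk => (hw (j i) hk).1) (fun k hk => (hw (j i) hk).2) _
      (C0.mem_of_eq_zero _ fun g hg => ?_)
    by_cases hgu : g ∈ units G
    · refine C0.cut_apply_of_eq_zero _ (hρ i _ fun h => hg ?_)
      have : rng g ∈ (w (j i)).1 := h
      rwa [rng_of_unit hgu] at this
    · exact C0.apply_eq_zero _ hgu
  have hcl : f ∈ closure (J : Set (A.C0 (1 : Bis G))) := by
    rw [Metric.mem_closure_iff]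
    intro ε hε
    obtain ⟨χ, hχ, hle⟩ := C0.exists_cut_norm_sub_le f (Bis.isOpen_unitSet s.1) hf (half_pos hε)
    refine ⟨C0.cut χ f, hcut χ hχ, ?_⟩
    rw [dist_eq_norm]
    exact hle.trans_lt (half_lt_self hε)
  rwa [hJc.closure_eq] at hcl

/-- The generators come from members v of S with v ⊆ s ∩ G⁰, for which v^* v = v. They lie in the
closed ideal of sections supported there, and by wideness and a partition of unity they already span
a dense subspace of it. -/
theorem ideal_toFellBundle (hS : S.IsWide) (s : S.toSubmonoid) :
    (A.toFellBundle S).ideal s 1 = C0.idealOf A s.1 := by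
  refine le_antisymm (sInf_le ⟨C0.isClosed_vanishesOn _, fun a b hb => ⟨?_, ?_⟩,
    fun v hv hv1 a => ?_⟩) (le_sInf ?_)
  · exact C0.VanishesOn.lmulOne_right (S := S) hb a
  · exact C0.VanishesOn.lmulOne_left (S := S) hb a
  · intro g hg
    refine C0.apply_eq_zero (u := (v⁻¹ * v).1) a fun hgv => hg ?_
    have h1 := Bis.subset_of_natLE (InverseSubmonoid.natLE_val hv)
    have h2 : v.1.carrier ⊆ units G := Bis.subset_of_natLE (InverseSubmonoid.natLE_val hv1)
    have h3 : g ∈ v.1⁻¹ * v.1 := hgv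
    rw [inv_mul_self_of_subset_units h2] at h3
    change rng g ∈ s.1
    rw [rng_of_unit (h2 h3)]
    exact h1 h3
  · rintro J ⟨hJc, -, hJ⟩
    refine idealOf_le_of_forall_mem hS s hJc fun w hws hw a ha => ?_
    have ha' : a.1 ∈ A.C0 (w.1⁻¹ * w.1) := by rwa [inv_mul_self_of_subset_units hw]
    exact hJ w (natLE_of_subset hws hw) (natLE_of_subset hw hw) ⟨a.1, ha'⟩

end Ideal

end GroupoidFellBundle

namespace GroupoidFellBundle

/-! ### The projections 1_s as restriction of functionals -/

section Projection

variable {G : Type u} [TopologicalSpace G] [TopGroupoid G] {A : GroupoidFellBundle.{u, v} G}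

theorem norm_mul_star_self {g : G} (a : A.Fib g) :
    ‖A.mul (isMul_ginv g) a (A.star rfl a)‖ = ‖a‖ ^ 2 := by
  have := A.norm_star_mul_self (ginv_ginv g) (isMul_ginv g) (A.star rfl a)
  rwa [A.star_star, norm_star] at this

/-- How well `b` acts as a unit on `c` is controlled by its action on `c c^*`. -/
theorem norm_mul_sub_self_sq_le {g : G} (b : A.Fib (rng g)) (c : A.Fib g) :
    ‖A.mul (isMul_rng g) b c - c‖ ^ 2 ≤ (‖b‖ + 1) *
      ‖A.mul (isMul_unit (rng_mem_units g)) b (A.mul (isMul_ginv g) c (A.star rfl c)) -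
        A.mul (isMul_ginv g) c (A.star rfl c)‖ := by
  have hu := isMul_unit (rng_mem_units g)
  have hi := ginv_of_unit (rng_mem_units g)
  have hm : IsMul (ginv g) (rng g) (ginv g) := by
    have := isMul_src (ginv g)
    rwa [src_ginv] at this
  set k := A.mul (isMul_ginv g) c (A.star rfl c) with hk
  -- With k = c c^* one has (bc - c)(bc - c)^* = (bk - k)b^* - (bk - k), and the C⋆-identity turns
  -- the left side into the squared norm.
  have e1 : A.mul (isMul_ginv g) (A.mul (isMul_rng g) b c - c)
      (A.star rfl (A.mul (isMul_rng g) b c - c)) =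
      A.mul hu (A.mul hu b k - k) (A.star hi b) - (A.mul hu b k - k) := by
    have h1 : A.star rfl (A.mul (isMul_rng g) b c) = A.mul hm (A.star rfl c) (A.star hi b) :=
      A.star_mul _ _ _ _ _ _ _
    have h2 : ∀ d : A.Fib g, A.mul (isMul_ginv g) d (A.mul hm (A.star rfl c) (A.star hi b)) =
        A.mul hu (A.mul (isMul_ginv g) d (A.star rfl c)) (A.star hi b) := fun d =>
      (A.mul_assoc _ _ _ _ _ _ _).symm
    have h3 : A.mul (isMul_ginv g) (A.mul (isMul_rng g) b c) (A.star rfl c) = A.mul hu b k :=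
      A.mul_assoc _ _ _ _ _ _ _
    rw [map_sub (A.star _), h1, map_sub (A.mul _ _), h2, map_sub (A.mul (isMul_ginv g)),
      LinearMap.sub_apply, h3, ← hk]
  rw [← norm_mul_star_self, e1]
  refine (norm_sub_le _ _).trans ?_
  have h4 := A.norm_mul_le hu (A.mul hu b k - k) (A.star hi b)
  rw [norm_star] at h4
  linarith

variable [EtaleGroupoid G]

theorem C0.ext_units {f f' : A.C0 (1 : Bis G)} (h : ∀ x : units G, f.1 x.1 = f'.1 x.1) :
    f = f' := C0.ext fun g => by
  by_cases hg : g ∈ units G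
  · exact h ⟨g, hg⟩
  · rw [C0.apply_eq_zero f hg, C0.apply_eq_zero f' hg]

variable [T2Space (units G)]

/-- The C⋆-algebra of sections over the units of a bisection. -/
abbrev unitPartAlg (A : GroupoidFellBundle.{u, v} G) (u : Bis G) :
    NonUnitalStarSubalgebra ℂ (lp A.UnitFib ∞) :=
  C0.unitAlg (A := A) (u.inter 1) Set.inter_subset_right

instance (u : Bis G) : IsClosed (unitPartAlg A u : Set (lp A.UnitFib ∞)) :=
  C0.isClosed_unitAlg _ _

/-- An element of `unitPartAlg A u` as a section over the unit space. -/
noncomputable def ofUnitPart {u : Bis G} (n : unitPartAlg A u) : A.C0 (1 : Bis G) :=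
  ⟨n.2.choose.1, C0.mono Set.inter_subset_right n.2.choose.2⟩

theorem ofUnitPart_apply {u : Bis G} (n : unitPartAlg A u) (x : units G) :
    (ofUnitPart n).1 x.1 = n.1 x := (n.2.choose_spec x).symm

variable (A) in
/-- The inclusion of `unitPartAlg A u` into the sections over the unit space. -/
noncomputable def unitPartIncl (u : Bis G) : unitPartAlg A u →ₗᵢ[ℂ] A.C0 (1 : Bis G) where
  toFun := ofUnitPart
  map_add' m n := C0.ext_units fun x => by
    rw [C0.add_apply, ofUnitPart_apply, ofUnitPart_apply, ofUnitPart_apply]; rfl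
  map_smul' c n := C0.ext_units fun x => by
    rw [C0.smul_apply, ofUnitPart_apply, ofUnitPart_apply]; rfl
  norm_map' n := by
    refine le_antisymm (C0.norm_le _ (norm_nonneg _) fun g => ?_)
      (lp.norm_le_of_forall_le (norm_nonneg _) fun x => ?_)
    · by_cases hg : g ∈ units G
      · have := lp.norm_apply_le_norm ENNReal.top_ne_zero n.1 ⟨g, hg⟩
        rw [← ofUnitPart_apply n ⟨g, hg⟩] at this
        exact this
      · change ‖(ofUnitPart n).1 g‖ ≤ _
        rw [C0.apply_eq_zero _ hg, norm_zero]
        exact norm_nonneg _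
    · have := C0.norm_apply_le (ofUnitPart n) x.1
      rw [ofUnitPart_apply n x] at this
      exact this

theorem unitPartIncl_apply {u : Bis G} (n : unitPartAlg A u) (x : units G) :
    (unitPartIncl A u n).1 x.1 = n.1 x := ofUnitPart_apply n x

theorem range_unitPartIncl (u : Bis G) :
    LinearMap.range (unitPartIncl A u).toLinearMap = C0.idealOf A u := by
  ext f
  constructor
  · rintro ⟨n, rfl⟩ g hg
    refine C0.apply_eq_zero n.2.choose fun h => hg ?_
    change rng g ∈ u
    rw [rng_of_unit h.2]
    exact h.1
  · intro hf
    have hm : f.1 ∈ A.C0 (u.inter 1) := C0.mem_of_eq_zero f fun g hg => by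
      by_cases hgu : g ∈ units G
      · refine hf g fun h => hg ⟨?_, hgu⟩
        have : rng g ∈ u := h
        rwa [rng_of_unit hgu] at this
      · exact C0.apply_eq_zero f hgu
    let y : lp A.UnitFib ∞ := ⟨fun x => f.1 x.1, memℓp_infty ⟨‖f‖, by
      rintro _ ⟨x, rfl⟩
      exact C0.norm_apply_le f x.1⟩⟩
    refine ⟨⟨y, ⟨f.1, hm⟩, fun x => rfl⟩, C0.ext_units fun x => ?_⟩
    exact unitPartIncl_apply (u := u) _ x

variable {S : InverseSubmonoid (Bis G)}

theorem unitPartIncl_mul {u : Bis G} (m n : unitPartAlg A u) :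
    unitPartIncl A u (m * n) = lmulOne S A (unitPartIncl A u m) (unitPartIncl A u n) :=
  C0.ext_units fun x => by
    rw [lmulOne_apply_unit, unitPartIncl_apply, unitPartIncl_apply, unitPartIncl_apply]
    rfl

/-- The ideal of sections over `u` has an approximate unit for the sections supported over `u`. -/
theorem exists_mem_idealOf_norm_sub_le {s : S.toSubmonoid} {u : Bis G} {c : A.C0 s.1}
    (hc : C0.VanishesOn c u.unitSetᶜ) {ε : ℝ} (hε : 0 < ε) :
    ∃ d ∈ C0.idealOf A u, ‖lmulC0 S A s d c - c‖ ≤ ε := by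
  let _ := CStarAlgebra.spectralOrder (unitPartAlg A u)
  let _ := CStarAlgebra.spectralOrderedRing (unitPartAlg A u)
  have hl := CStarAlgebra.increasingApproximateUnit (unitPartAlg A u)
  have hss : (s.1 * s.1⁻¹).carrier ⊆ (1 : Bis G).carrier :=
    Bis.subset_of_natLE (mul_inv_natLE_one s.1)
  -- This is c c^*, an element of the ideal; an approximate unit for it is one for c.
  let f : A.C0 (1 : Bis G) := ⟨(C0.mul s.1 s.1⁻¹ c (C0.star s.1 c)).1,
    C0.mono hss (C0.mul s.1 s.1⁻¹ c (C0.star s.1 c)).2⟩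
  have hfg : ∀ g ∈ s.1, f.1 (rng g) = A.mul (isMul_ginv g) (c.1 g) (A.star rfl (c.1 g)) := by
    intro g hg
    have h1 : ginv g ∈ s.1⁻¹ := by rw [Bis.mem_inv, ginv_ginv]; exact hg
    rw [← C0.star_apply c rfl]
    exact C0.mul_apply c (C0.star s.1 c) hg h1 (isMul_ginv g)
  have hf : f ∈ C0.idealOf A u := by
    intro x hx
    by_cases hxs : x ∈ s.1 * s.1⁻¹
    · obtain ⟨g, h, hg, hh, H⟩ := hxs
      have hxu : x ∈ units G := hss ⟨g, h, hg, hh, H⟩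
      have e : x = rng g := by rw [← H.rng_eq, rng_of_unit hxu]
      subst e
      have hc0 : c.1 g = 0 := hc g (by
        rwa [show rngUnit (rng g) = rngUnit g from Subtype.ext (rng_rng g)] at hx)
      rw [hfg g hg, hc0, map_zero, LinearMap.zero_apply]
    · exact C0.apply_eq_zero (C0.mul s.1 s.1⁻¹ c (C0.star s.1 c)) hxs
  rw [← range_unitPartIncl] at hf
  obtain ⟨n, hn⟩ := hf
  -- The tolerance is dictated by ‖ec - c‖² ≤ (‖e‖ + 1)‖ef - f‖ ≤ 2 · ε²/2.
  have hev := (hl.tendsto_mul_right n).eventually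
    (Metric.ball_mem_nhds n (show 0 < ε ^ 2 / 2 by positivity))
  have := hl.neBot
  obtain ⟨e, he1, he2⟩ := (hl.eventually_norm.and hev).exists
  rw [dist_eq_norm] at he2
  refine ⟨unitPartIncl A u e, by rw [← range_unitPartIncl]; exact ⟨e, rfl⟩,
    C0.norm_le _ hε.le fun g => ?_⟩
  rw [C0.sub_apply, lmulC0_apply]
  by_cases hg : g ∈ s.1
  · refine abs_le_of_sq_le_sq' ?_ hε.le |>.2
    refine (norm_mul_sub_self_sq_le _ _).trans ?_
    rw [← hfg g hg]
    have h1 : ‖(unitPartIncl A u e).1 (rng g)‖ ≤ 1 :=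
      (C0.norm_apply_le (unitPartIncl A u e) (rng g)).trans
        (((unitPartIncl A u).norm_map e).le.trans he1)
    have h2 : ‖A.mul (isMul_unit (rng_mem_units g)) ((unitPartIncl A u e).1 (rng g))
        (f.1 (rng g)) - f.1 (rng g)‖ ≤ ε ^ 2 / 2 := by
      have h3 : (unitPartIncl A u (e * n - n)).1 (rng g) =
          A.mul (isMul_unit (rng_mem_units g)) ((unitPartIncl A u e).1 (rng g))
          (f.1 (rng g)) - f.1 (rng g) := by
        rw [map_sub, C0.sub_apply, unitPartIncl_mul (S := S), ← hn]
        rw [lmulOne_apply_unit _ _ ⟨rng g, rng_mem_units g⟩]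
        rfl
      rw [← h3]
      refine (C0.norm_apply_le (unitPartIncl A u (e * n - n)) (rng g)).trans ?_
      rw [(unitPartIncl A u).norm_map]
      exact he2.le
    calc _ ≤ (1 + 1) * (ε ^ 2 / 2) := by gcongr
      _ = ε ^ 2 := by ring
  · rw [C0.apply_eq_zero c hg, map_zero, sub_zero, norm_zero]
    exact hε.le

theorem lmulC0_lmulC0 {t : S.toSubmonoid} (y d : A.C0 (1 : Bis G)) (c : A.C0 t.1) :
    lmulC0 S A t y (lmulC0 S A t d c) = lmulC0 S A t (lmulOne S A y d) c := C0.ext fun g => by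
  rw [lmulC0_apply, lmulC0_apply, lmulC0_apply, lmulOne_apply_unit _ _ ⟨rng g, rng_mem_units g⟩]
  exact (A.mul_assoc _ _ _ _ _ _ _).symm

variable [LocallyCompactSpace (units G)]

/-- Existence of a unit makes the choice in `FellBundle.unitProj` a genuine unit: the ideal is the
isometric image of the C⋆-algebra `unitPartAlg A s.1`. -/
theorem isUnitOf_projC0 (hS : S.IsWide) (s : S.toSubmonoid) :
    Bidual.IsUnitOf (lmulOne S A) (C0.idealOf A s.1) (projC0 S A s) := by
  have h := Classical.epsilon_spec (Bidual.exists_isUnitOf (lmulOne S A) (unitPartIncl A s.1)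
    unitPartIncl_mul (range_unitPartIncl s.1))
  have e : projC0 S A s =
      Classical.epsilon (Bidual.IsUnitOf (lmulOne S A) ((A.toFellBundle S).ideal s 1)) := rfl
  rw [e, ideal_toFellBundle hS]
  exact h

/-- The operator on functionals induced by an element of the bidual of the coefficient algebra. -/
noncomputable def partMap {X Y : Type*} [NormedAddCommGroup X] [NormedSpace ℂ X]
    [NormedAddCommGroup Y] [NormedSpace ℂ Y] (μ : X →L[ℂ] Y →L[ℂ] X) (e : Bidual Y) :
    StrongDual ℂ X →ₗ[ℂ] StrongDual ℂ X where
  toFun ψ := e.comp ((ContinuousLinearMap.compL ℂ Y X ℂ ψ).comp μ)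
  map_add' ψ φ := ContinuousLinearMap.ext fun x => by
    change e ((ψ + φ).comp (μ x)) = e (ψ.comp (μ x)) + e (φ.comp (μ x))
    rw [ContinuousLinearMap.add_comp, map_add]
  map_smul' c ψ := ContinuousLinearMap.ext fun x => by
    change e ((c • ψ).comp (μ x)) = c • e (ψ.comp (μ x))
    rw [ContinuousLinearMap.smul_comp, map_smul]

theorem partMap_apply {X Y : Type*} [NormedAddCommGroup X] [NormedSpace ℂ X]
    [NormedAddCommGroup Y] [NormedSpace ℂ Y] (μ : X →L[ℂ] Y →L[ℂ] X) (e : Bidual Y)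
    (ψ : StrongDual ℂ X) (x : X) : partMap μ e ψ x = e (ψ.comp (μ x)) := rfl

/-- The common core of the left and right actions. Tightness holds because e, being in I'', only
sees products with elements of I; these are supported in u ∩ G⁰ and vanish wherever a does. Nullity
of ψ minus its image says that e acts as a unit on sections supported there. -/
theorem isPart_partMap {s : Bis G} {u : Bis G} {e : Bidual (A.C0 (1 : Bis G))}
    (he : e ∈ Bidual.ofSubspace (C0.idealOf A u))
    {μ : A.C0 s →L[ℂ] A.C0 (1 : Bis G) →L[ℂ] A.C0 s}
    (h1 : ∀ a K y, C0.VanishesOn a K → C0.VanishesOn (μ a y) K)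
    (h2 : ∀ a K y, C0.VanishesOn y K → C0.VanishesOn (μ a y) K)
    (h3 : ∀ a y, ‖μ a y‖ ≤ ‖a‖ * ‖y‖)
    (h4 : ∀ (ψ : StrongDual ℂ (A.C0 s)) (c : A.C0 s), C0.VanishesOn c u.unitSetᶜ →
      e (ψ.comp (μ c)) = ψ c) (ψ : StrongDual ℂ (A.C0 s)) :
    IsPart u.unitSet ψ (partMap μ e ψ) := by
  obtain ⟨M, hM, he'⟩ := Bidual.exists_norm_apply_le he
  refine ⟨fun ε hε => ?_, fun a ha => ?_⟩
  · obtain ⟨K, hK, hKc, H⟩ := exists_isCompact_norm_le ψ u.isOpen_unitSet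
      (ε := ε / (M + 1)) (by positivity)
    refine ⟨K, hK, hKc, fun a ha => ?_⟩
    rw [partMap_apply]
    refine (he' _ (ε / (M + 1) * ‖a‖) (by positivity) fun y hy => ?_).trans ?_
    · refine (H (μ a y) (h2 a _ y hy) (h1 a _ y ha)).trans ?_
      rw [_root_.mul_assoc]
      gcongr
      exact h3 a y
    · rw [← _root_.mul_assoc]
      gcongr
      rw [mul_div_assoc', div_le_iff₀ (by positivity)]
      nlinarith
  · rw [_root_.sub_apply, partMap_apply, h4 ψ a ha, sub_self]

theorem isPart_right (hS : S.IsWide) (s : S.toSubmonoid) (ψ : StrongDual ℂ (A.C0 (1 : Bis G))) :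
    IsPart s.1.unitSet ψ (partMap (lmulOne S A) (projC0 S A s) ψ) := by
  have hu := isUnitOf_projC0 (A := A) hS s
  refine isPart_partMap hu.1 (fun a K y h => h.lmulOne_left y) (fun a K y h => h.lmulOne_right a)
    norm_lmulOne_le (fun ψ c hc => hu.apply_comp_left hc ψ) ψ

/-- On products dc with d in the ideal, associativity reduces the action of 1_s on B_t to its unit
property inside the bidual of B_1. -/
theorem projC0_comp_flip_lmulC0 (hS : S.IsWide) {s t : S.toSubmonoid}
    (ψ : StrongDual ℂ (A.C0 t.1)) {d : A.C0 (1 : Bis G)} (hd : d ∈ C0.idealOf A s.1)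
    (c : A.C0 t.1) : partMap (lmulC0 S A t).flip (projC0 S A s) ψ (lmulC0 S A t d c) =
      ψ (lmulC0 S A t d c) := by
  have h := (isUnitOf_projC0 hS s).apply_comp_right hd (ψ.comp ((lmulC0 S A t).flip c))
  rw [partMap_apply]
  refine Eq.trans (congrArg (projC0 S A s) (ContinuousLinearMap.ext fun y => ?_)) h
  exact congrArg ψ (lmulC0_lmulC0 y d c)

/-- A section c over t supported over s is a norm limit of products dc with d in the ideal, and both
sides are continuous in c. -/
theorem partMap_flip_lmulC0_of_vanishesOn (hS : S.IsWide) {s t : S.toSubmonoid}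
    (ψ : StrongDual ℂ (A.C0 t.1)) {c : A.C0 t.1} (hc : C0.VanishesOn c s.1.unitSetᶜ) :
    partMap (lmulC0 S A t).flip (projC0 S A s) ψ c = ψ c := by
  have hcl : c ∈ closure {x : A.C0 t.1 |
      partMap (lmulC0 S A t).flip (projC0 S A s) ψ x = ψ x} := by
    rw [Metric.mem_closure_iff]
    intro ε hε
    obtain ⟨d, hd, hle⟩ := exists_mem_idealOf_norm_sub_le hc (half_pos hε)
    refine ⟨_, projC0_comp_flip_lmulC0 hS ψ hd c, ?_⟩
    rw [dist_comm, dist_eq_norm]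
    exact hle.trans_lt (half_lt_self hε)
  have hclosed : IsClosed {x : A.C0 t.1 |
      partMap (lmulC0 S A t).flip (projC0 S A s) ψ x = ψ x} :=
    isClosed_eq (partMap (lmulC0 S A t).flip (projC0 S A s) ψ).continuous ψ.continuous
  rwa [hclosed.closure_eq] at hcl

theorem isPart_left (hS : S.IsWide) (s t : S.toSubmonoid) (ψ : StrongDual ℂ (A.C0 t.1)) :
    IsPart s.1.unitSet ψ (partMap (lmulC0 S A t).flip (projC0 S A s) ψ) := by
  have hu := (isUnitOf_projC0 (A := A) hS s).1
  refine isPart_partMap hu ?_ ?_ ?_ ?_ ψ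
  · intro a K y h
    rw [ContinuousLinearMap.flip_apply]
    exact h.lmulC0_right y
  · intro a K y h
    rw [ContinuousLinearMap.flip_apply]
    exact h.lmulC0_left a
  · intro a y
    rw [ContinuousLinearMap.flip_apply, mul_comm]
    exact norm_lmulC0_le y a
  · intro ψ c hc
    exact partMap_flip_lmulC0_of_vanishesOn hS ψ hc

end Projection

end GroupoidFellBundle

/-! ### The Cauchy–Schwarz estimate for averages -/

section CauchySchwarz

/-- The Cauchy–Schwarz inequality for finite families in a C⋆-algebra. -/
theorem norm_sum_star_mul_le {N ι : Type*} [NonUnitalCStarAlgebra N] (H : Finset ι)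
    (a e : ι → N) :
    ‖∑ h ∈ H, star (a h) * e h‖ ≤
      √‖∑ h ∈ H, star (a h) * a h‖ * √‖∑ h ∈ H, star (e h) * e h‖ := by
  let _ := CStarAlgebra.spectralOrder N
  let _ := CStarAlgebra.spectralOrderedRing N
  have := CStarModule.norm_inner_le (A := N) (WithCStarModule N (H → N))
    (x := (WithCStarModule.equiv N _).symm fun h => star (e h.1))
    (y := (WithCStarModule.equiv N _).symm fun h => star (a h.1))
  rw [WithCStarModule.pi_norm, WithCStarModule.pi_norm, WithCStarModule.pi_inner] at this
  simp only [WithCStarModule.equiv_symm_pi_apply, WithCStarModule.inner_def, star_star] at this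
  rw [mul_comm, ← Finset.sum_coe_sort H, ← Finset.sum_coe_sort H, ← Finset.sum_coe_sort H]
  exact this

theorem norm_sum_conjugate_le {N ι : Type*} [NonUnitalCStarAlgebra N] (H : Finset ι)
    (c : ι → N) (y : N) :
    ‖∑ h ∈ H, star (c h) * (star y * y) * c h‖ ≤ ‖star y * y‖ * ‖∑ h ∈ H, star (c h) * c h‖ := by
  let _ := CStarAlgebra.spectralOrder N
  let _ := CStarAlgebra.spectralOrderedRing N
  have h1 : ∑ h ∈ H, star (c h) * (star y * y) * c h ≤
      ‖star y * y‖ • ∑ h ∈ H, star (c h) * c h := by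
    rw [Finset.smul_sum]
    exact Finset.sum_le_sum fun h _ =>
      CStarAlgebra.star_left_conjugate_le_norm_smul (.star_mul_self y)
  have h2 : 0 ≤ ∑ h ∈ H, star (c h) * (star y * y) * c h :=
    Finset.sum_nonneg fun h _ => star_left_conjugate_nonneg (star_mul_self_nonneg y) _
  refine (CStarAlgebra.norm_le_norm_of_nonneg_of_le h2 h1).trans ?_
  rw [norm_smul, norm_norm]

namespace GroupoidFellBundle

variable {G : Type u} [TopologicalSpace G] [TopGroupoid G] {A : GroupoidFellBundle.{u, v} G}

/-- The left inner product `w v^*` of a fibre. -/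
noncomputable def linner {g : G} (w v : A.Fib g) : A.UnitFib (rngUnit g) :=
  A.mul (isMul_ginv g) w (A.star rfl v)

/-- The right inner product `w^* v` of a fibre. -/
noncomputable def rinner {g : G} (w v : A.Fib g) : A.UnitFib (srcUnit g) :=
  A.mul (isMul_ginv_left g) (A.star rfl w) v

/-- The left multiplication on a fibre. -/
noncomputable def lact {g : G} (a : A.UnitFib (rngUnit g)) (w : A.Fib g) : A.Fib g :=
  A.mul (isMul_rng g) a w

/-- The right multiplication on a fibre. -/
noncomputable def ract {g : G} (w : A.Fib g) (c : A.UnitFib (srcUnit g)) : A.Fib g :=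
  A.mul (isMul_src g) w c

theorem linner_lact {g : G} (a : A.UnitFib (rngUnit g)) (w v : A.Fib g) :
    linner (lact a w) v = a * linner w v :=
  A.mul_assoc (isMul_rng g) (isMul_ginv g) (isMul_ginv g) (isMul_unit (rng_mem_units g)) a w _

theorem star_linner {g : G} (w v : A.Fib g) : Star.star (linner w v) = linner v w := by
  have h : A.star (ginv_of_unit (rng_mem_units g)) (A.mul (isMul_ginv g) w (A.star rfl v)) =
      A.mul (isMul_ginv g) (A.star (ginv_ginv g) (A.star rfl v)) (A.star rfl w) :=
    A.star_mul _ _ _ _ _ _ _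
  rw [A.star_star] at h
  exact h

theorem linner_mul_linner {g : G} (z d : A.Fib g) :
    linner z d * linner d z = linner (ract z (rinner d d)) z := by
  have h1 : IsMul (rng g) g g := isMul_rng g
  have e1 : A.mul (isMul_rng g) (A.mul (isMul_ginv g) z (A.star rfl d)) d =
      A.mul (isMul_src g) z (A.mul (isMul_ginv_left g) (A.star rfl d) d) :=
    A.mul_assoc _ _ _ _ _ _ _
  have e2 : A.mul (isMul_ginv g)
      (A.mul (isMul_rng g) (A.mul (isMul_ginv g) z (A.star rfl d)) d) (A.star rfl z) =
      A.mul (isMul_unit (rng_mem_units g)) (A.mul (isMul_ginv g) z (A.star rfl d))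
        (A.mul (isMul_ginv g) d (A.star rfl z)) :=
    A.mul_assoc _ _ _ _ _ _ _
  rw [e1] at e2
  exact e2.symm

theorem rinner_ract {g : G} (b : A.Fib g) (c : A.UnitFib (srcUnit g)) :
    rinner (ract b c) (ract b c) = Star.star c * rinner b b * c := by
  have hm : IsMul (src g) (ginv g) (ginv g) := by
    have := isMul_rng (ginv g)
    rwa [rng_ginv] at this
  have hu := isMul_unit (src_mem_units g)
  have e1 : A.star rfl (A.mul (isMul_src g) b c) =
      A.mul hm (A.star (ginv_of_unit (src_mem_units g)) c) (A.star rfl b) :=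
    A.star_mul _ _ _ _ _ _ _
  have e2 : A.mul (isMul_ginv_left g) (A.star rfl b) (A.mul (isMul_src g) b c) =
      A.mul hu (A.mul (isMul_ginv_left g) (A.star rfl b) b) c :=
    (A.mul_assoc _ _ _ _ _ _ _).symm
  have e3 : A.mul (isMul_ginv_left g) (A.mul hm (A.star (ginv_of_unit (src_mem_units g)) c)
      (A.star rfl b)) (A.mul (isMul_src g) b c) =
      A.mul hu (A.star (ginv_of_unit (src_mem_units g)) c)
        (A.mul (isMul_ginv_left g) (A.star rfl b) (A.mul (isMul_src g) b c)) :=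
    A.mul_assoc _ _ _ _ _ _ _
  rw [e2, ← e1] at e3
  rw [_root_.mul_assoc]
  exact e3

theorem norm_linner_self {g : G} (z : A.Fib g) : ‖linner z z‖ = ‖z‖ ^ 2 := norm_mul_star_self z

theorem norm_rinner_self {g : G} (z : A.Fib g) : ‖rinner z z‖ = ‖z‖ ^ 2 :=
  A.norm_star_mul_self rfl (isMul_ginv_left g) z

theorem norm_linner_le {g : G} (w v : A.Fib g) : ‖linner w v‖ ≤ ‖w‖ * ‖v‖ :=
  (A.norm_mul_le (isMul_ginv g) w (A.star rfl v)).trans_eq (by rw [norm_star])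

theorem norm_ract_le {g : G} (w : A.Fib g) (c : A.UnitFib (srcUnit g)) :
    ‖ract w c‖ ≤ ‖w‖ * ‖c‖ := A.norm_mul_le (isMul_src g) w c

theorem linner_sum_left {g : G} {ι : Type*} (H : Finset ι) (w : ι → A.Fib g) (v : A.Fib g) :
    linner (∑ h ∈ H, w h) v = ∑ h ∈ H, linner (w h) v := by
  change A.mul (isMul_ginv g) (∑ h ∈ H, w h) (A.star rfl v) = _
  rw [map_sum, LinearMap.sum_apply]
  rfl

theorem ract_sum {g : G} {ι : Type*} (H : Finset ι) (w : A.Fib g)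
    (c : ι → A.UnitFib (srcUnit g)) : ract w (∑ h ∈ H, c h) = ∑ h ∈ H, ract w (c h) :=
  map_sum (A.mul (isMul_src g) w) c H

/-- Put z = ∑ a_h^* b c_h. Then z z^* = ∑ a_h^* (b c_h z^*) is a sum in the C⋆-algebra over r(g),
where Cauchy–Schwarz applies. The second factor involves z (∑ c_h^* b^* b c_h) z^*, whose norm is at
most ‖z‖²‖b‖²C, so ‖z‖² ≤ C‖z‖‖b‖. -/
theorem norm_sum_lact_ract_le {g : G} {ι : Type*} (H : Finset ι)
    (a : ι → A.UnitFib (rngUnit g)) (c : ι → A.UnitFib (srcUnit g)) (b : A.Fib g) {C : ℝ}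
    (ha : ‖∑ h ∈ H, Star.star (a h) * a h‖ ≤ C) (hc : ‖∑ h ∈ H, Star.star (c h) * c h‖ ≤ C) :
    ‖∑ h ∈ H, lact (Star.star (a h)) (ract b (c h))‖ ≤ C * ‖b‖ := by
  have hC : 0 ≤ C := (norm_nonneg _).trans ha
  set z := ∑ h ∈ H, lact (Star.star (a h)) (ract b (c h)) with hz
  obtain ⟨y, hy⟩ : ∃ y : A.UnitFib (srcUnit g), rinner b b = Star.star y * y :=
    A.star_mul_self_nonneg rfl (isMul_ginv_left g) (ginv_of_unit (src_mem_units g))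
      (isMul_unit (src_mem_units g)) b
  have h1 : linner z z = ∑ h ∈ H, Star.star (a h) * linner (ract b (c h)) z := by
    conv_lhs => rw [hz, linner_sum_left]
    exact Finset.sum_congr rfl fun h _ => linner_lact _ _ _
  have h2 : ∑ h ∈ H, Star.star (linner (ract b (c h)) z) * linner (ract b (c h)) z =
      linner (ract z (∑ h ∈ H, Star.star (c h) * (Star.star y * y) * c h)) z := by
    rw [ract_sum, linner_sum_left]
    refine Finset.sum_congr rfl fun h _ => ?_
    rw [star_linner, linner_mul_linner, rinner_ract, hy]
  have h3 : ‖∑ h ∈ H, Star.star (linner (ract b (c h)) z) * linner (ract b (c h)) z‖ ≤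
      (‖z‖ * ‖b‖) ^ 2 * C := by
    rw [h2]
    refine (norm_linner_le _ _).trans ?_
    have h4 := norm_sum_conjugate_le H c y
    rw [← hy, norm_rinner_self] at h4
    have h5 := norm_ract_le z (∑ h ∈ H, Star.star (c h) * rinner b b * c h)
    rw [← hy]
    have h6 : ‖b‖ ^ 2 * ‖∑ h ∈ H, Star.star (c h) * c h‖ ≤ ‖b‖ ^ 2 * C := by gcongr
    calc _ ≤ ‖z‖ * (‖b‖ ^ 2 * C) * ‖z‖ := by
          gcongr
          exact h5.trans (mul_le_mul_of_nonneg_left (h4.trans h6) (norm_nonneg z))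
      _ = _ := by ring
  have h7 := norm_sum_star_mul_le H a fun h => linner (ract b (c h)) z
  rw [← h1, norm_linner_self] at h7
  have h8 : ‖z‖ ^ 2 ≤ √C * √((‖z‖ * ‖b‖) ^ 2 * C) := h7.trans (by gcongr)
  rw [Real.sqrt_mul (by positivity), Real.sqrt_sq (by positivity)] at h8
  have h9 : ‖z‖ ^ 2 ≤ ‖z‖ * (C * ‖b‖) := by
    have := Real.mul_self_sqrt hC
    calc _ ≤ _ := h8
      _ = ‖z‖ * ((√C * √C) * ‖b‖) := by ring
      _ = _ := by rw [this]
  rcases (norm_nonneg z).eq_or_lt with h0 | h0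
  · rw [← h0]; positivity
  · rw [sq] at h9
    exact le_of_mul_le_mul_left h9 h0

/-- The value of `ξ` at `k`, in the fibre over the unit `x = r(k)`. -/
def fibVal (ξ : ∀ g : G, A.Fib (rng g)) (x : units G) (k : {k : G // rng k = x.1}) :
    A.UnitFib x :=
  cast (congrArg A.Fib k.2) (ξ k.1)

theorem sqSum_eq (ξ : ∀ g : G, A.Fib (rng g)) (x : units G) :
    sqSum ξ x = ∑ᶠ k : {k : G // rng k = x.1}, Star.star (fibVal ξ x k) * fibVal ξ x k := by
  refine finsum_congr fun k => ?_
  obtain ⟨x, hx⟩ := x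
  obtain ⟨k, hk⟩ := k
  obtain rfl : rng k = x := hk
  rfl

theorem mul_star_mul_mul_eq {g x y : G} (hx : x = rng g) (hy : y = src g) (H1 : IsMul g y g)
    (H2 : ginv x = rng g) (a : A.Fib x) (b : A.Fib g) (c : A.Fib y) :
    A.mul H1 (A.mul (isMul_rng g) (A.star H2 a) b) c =
      lact (Star.star (cast (congrArg A.Fib hx) a : A.UnitFib (rngUnit g)))
        (ract b (cast (congrArg A.Fib hy) c)) := by
  have e1 : A.star H2 a = A.star (ginv_of_unit (rng_mem_units g))
      (cast (congrArg A.Fib hx) a) := by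
    subst hx; rfl
  have e2 : ∀ w : A.Fib g, A.mul H1 w c = A.mul (isMul_src g) w (cast (congrArg A.Fib hy) c) := by
    subst hy; intro w; rfl
  rw [e1, e2]
  exact A.mul_assoc _ _ _ _ _ _ _

theorem average_eq (ξ : ∀ g : G, A.Fib (rng g)) (f : ∀ g : G, A.Fib g) (g : G) :
    average ξ f g = ∑ᶠ h : {h : G // rng h = src g},
      lact (Star.star (fibVal ξ (rngUnit g) ⟨gmul g h.1 h.2.symm, rng_gmul _ _ _⟩))
        (ract (f g) (fibVal ξ (srcUnit g) h)) :=
  finsum_congr fun h => mul_star_mul_mul_eq (rng_gmul _ _ _) h.2 _ _ _ _ _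

/-- Left translation by `g` as a bijection `G^{s(g)} → G^{r(g)}`. -/
def translate (g : G) : {h : G // rng h = src g} ≃ {k : G // rng k = (rngUnit g).1} where
  toFun h := ⟨gmul g h.1 h.2.symm, rng_gmul _ _ _⟩
  invFun k := ⟨gmul (ginv g) k.1 (by rw [src_ginv, k.2]; rfl), by rw [rng_gmul, rng_ginv]⟩
  left_inv h := Subtype.ext ((isMul_gmul _).unique (isMul_gmul h.2.symm).inv_left)
  right_inv k := Subtype.ext (by
    have := (isMul_gmul (g := ginv g) (h := k.1) (by rw [src_ginv, k.2]; rfl)).inv_left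
    rw [ginv_ginv] at this
    exact (isMul_gmul _).unique this)

/-- Translation by g carries the fibre over s(g) to the fibre over r(g), so the left and right
coefficients of the average have square sums `sqSum ξ` at r(g) and at s(g), both bounded by C. -/
theorem norm_average_le (ξ : ∀ g : G, A.Fib (rng g))
    (hfin : ∀ x : units G, {k : {k : G // rng k = x.1} | ξ k.1 ≠ 0}.Finite) {C : ℝ}
    (hC : ∀ x : units G, ‖sqSum ξ x‖ ≤ C) (f : ∀ g : G, A.Fib g) (g : G) :
    ‖average ξ f g‖ ≤ C * ‖f g‖ := by
  classical
  have hval : ∀ (x : units G) (k : {k : G // rng k = x.1}), fibVal ξ x k ≠ 0 → ξ k.1 ≠ 0 := by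
    rintro ⟨x, hx⟩ ⟨k, hk⟩ h h'
    obtain rfl : rng k = x := hk
    exact h h'
  let a : {h : G // rng h = src g} → A.UnitFib (rngUnit g) := fun h =>
    fibVal ξ (rngUnit g) (translate g h)
  let c : {h : G // rng h = src g} → A.UnitFib (srcUnit g) := fun h => fibVal ξ (srcUnit g) h
  have hc : {h | c h ≠ 0}.Finite := (hfin (srcUnit g)).subset fun h hh => hval _ _ hh
  have ha : {h | a h ≠ 0}.Finite :=
    ((hfin (rngUnit g)).preimage (translate g).injective.injOn).subset fun h hh => hval _ _ hh
  let H : Finset {h : G // rng h = src g} := (ha.union hc).toFinset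
  have hHa : ∀ h ∉ H, a h = 0 := fun h hh => by
    by_contra h'
    exact hh ((ha.union hc).mem_toFinset.2 (Or.inl h'))
  have hHc : ∀ h ∉ H, c h = 0 := fun h hh => by
    by_contra h'
    exact hh ((ha.union hc).mem_toFinset.2 (Or.inr h'))
  have e1 : average ξ f g = ∑ h ∈ H, lact (Star.star (a h)) (ract (f g) (c h)) := by
    rw [average_eq]
    refine finsum_eq_sum_of_support_subset _ fun h hh => ?_
    by_contra hhH
    refine hh ?_
    change lact (Star.star (a h)) (ract (f g) (c h)) = 0
    rw [hHa h hhH, star_zero]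
    change A.mul (isMul_rng g) 0 (ract (f g) (c h)) = 0
    rw [map_zero, LinearMap.zero_apply]
  have e2 : sqSum ξ (srcUnit g) = ∑ h ∈ H, Star.star (c h) * c h := by
    rw [sqSum_eq]
    refine finsum_eq_sum_of_support_subset _ fun h hh => ?_
    by_contra hhH
    refine hh ?_
    change Star.star (c h) * c h = 0
    rw [hHc h hhH, mul_zero]
  have e3 : sqSum ξ (rngUnit g) = ∑ h ∈ H, Star.star (a h) * a h := by
    refine (sqSum_eq ξ _).trans ((finsum_comp_equiv (translate g)).symm.trans
      (finsum_eq_sum_of_support_subset _ fun h hh => ?_))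
    by_contra hhH
    refine hh ?_
    change Star.star (a h) * a h = 0
    rw [hHa h hhH, mul_zero]
  rw [e1]
  exact norm_sum_lact_ract_le H a c (f g) (e3 ▸ hC _) (e2 ▸ hC _)

end GroupoidFellBundle

end CauchySchwarz

/-! ### Interchanging sums, and the bidual sums tested on functionals -/

/-- Converts sums over arrows into sums over pairs of bisections: a bisection meets each range fibre
at most once, so each pair contributes its term once or not at all. -/
theorem finsum_sum_ite {Y ι M : Type*} [AddCommMonoid M] (F : Finset ι) (P : ι → Y → Prop)
    (hP : ∀ q k k', P q k → P q k' → k = k') (m : ι → M) :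
    ∑ᶠ k, ∑ q ∈ F, (open Classical in if P q k then m q else 0) =
      ∑ q ∈ F, open Classical in if ∃ k, P q k then m q else 0 := by
  classical
  rw [finsum_sum_comm]
  · refine Finset.sum_congr rfl fun q _ => ?_
    by_cases h : ∃ k, P q k
    · rw [if_pos h]
      obtain ⟨k, hk⟩ := h
      rw [finsum_eq_single _ k fun k' hk' => if_neg fun h => hk' (hP q k' k h hk), if_pos hk]
    · rw [if_neg h]
      exact (finsum_congr fun k => if_neg fun hk => h ⟨k, hk⟩).trans finsum_zero
  · intro q _
    refine Set.Subsingleton.finite fun k hk k' hk' => ?_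
    simp only [Function.mem_support, ne_eq, ite_eq_right_iff, Classical.not_imp] at hk hk'
    exact hP q k k' hk.1 hk'.1

theorem NormedSpace.norm_bidual_le {X : Type*} [NormedAddCommGroup X] [NormedSpace ℂ X]
    {m : Bidual X} {C : ℝ} (hC : 0 ≤ C) (h : ∀ ψ, ‖m ψ‖ ≤ C * ‖ψ‖) : ‖m‖ ≤ C :=
  m.opNorm_le_bound hC h

theorem NormedSpace.norm_bidual_apply_le {X : Type*} [NormedAddCommGroup X] [NormedSpace ℂ X]
    (m : Bidual X) {ψ : StrongDual ℂ X} (h : ‖ψ‖ ≤ 1) : ‖m ψ‖ ≤ ‖m‖ :=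
  (m.le_opNorm ψ).trans (mul_le_of_le_one_right (norm_nonneg m) h)

namespace FellBundle

variable {S : Type u} [InverseMonoid S] {A : FellBundle.{u, v} S}

theorem FinSection.sqSum_apply (ξ : A.FinSection) (ψ : StrongDual ℂ (A.Fib 1)) :
    ξ.sqSum ψ = ∑ q ∈ ξ.finite_support.toFinset ×ˢ ξ.finite_support.toFinset,
      A.unitProj (q.1 * q.2⁻¹)
        (ψ.comp (A.lmul 1 (A.lmul 1 (A.starOne (ξ.val q.1)) (ξ.val q.2)))) := by
  rw [Finset.sum_product]
  simp only [FinSection.sqSum, _root_.sum_apply]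
  rfl

theorem FinSection.average_sub_apply (ξ : A.FinSection) (s : S) (a : A.Fib s)
    (ψ : StrongDual ℂ (A.Fib s)) :
    (ξ.average s a - NormedSpace.inclusionInDoubleDual ℂ (A.Fib s) a) ψ = ψ (-a) +
      ∑ q ∈ ξ.finite_support.toFinset ×ˢ ξ.finite_support.toFinset,
      A.unitProj (q.1 * (s * q.2)⁻¹)
        (ψ.comp ((A.lmul s).flip
          (A.rmul s (A.lmul s (A.starOne (ξ.val q.1)) a) (ξ.val q.2)))) := by
  rw [Finset.sum_product, sub_apply, map_neg, neg_add_eq_sub]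
  simp only [FinSection.average, _root_.sum_apply]
  rfl

end FellBundle

namespace GroupoidFellBundle

/-! ### Functionals concentrated at one arrow -/

section Eval

variable {G : Type u} [TopologicalSpace G] [TopGroupoid G] {A : GroupoidFellBundle.{u, v} G}

theorem star_congr_apply {u : Bis G} (f : A.C0 u) {x y : G} (e : x = y) (H : ginv x = y)
    (H' : ginv y = y) : A.star H (f.1 x) = A.star H' (f.1 y) := by
  subst e; rfl

theorem mul_congr_apply {u : Bis G} (f : A.C0 u) {g x y : G} (e : x = y) (H : IsMul g x g)
    (H' : IsMul g y g) (b : A.Fib g) : A.mul H b (f.1 x) = A.mul H' b (f.1 y) := by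
  subst e; rfl

/-- Evaluation at an arrow. -/
noncomputable def C0.eval {u : Bis G} (g : G) : A.C0 u →L[ℂ] A.Fib g :=
  LinearMap.mkContinuous
    { toFun := fun a => a.1 g
      map_add' := fun _ _ => rfl
      map_smul' := fun _ _ => rfl } 1 fun a => by
    rw [one_mul]
    exact C0.norm_apply_le a g

theorem C0.norm_comp_eval_le {u : Bis G} {g : G} {φ : StrongDual ℂ (A.Fib g)} (hφ : ‖φ‖ ≤ 1) :
    ‖φ.comp (C0.eval g : A.C0 u →L[ℂ] A.Fib g)‖ ≤ 1 := by
  refine ContinuousLinearMap.opNorm_le_bound _ zero_le_one fun a => ?_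
  rw [one_mul]
  refine ((φ.le_opNorm _).trans (mul_le_of_le_one_left (norm_nonneg _) hφ)).trans ?_
  exact C0.norm_apply_le a g

variable [T2Space (units G)] [LocallyCompactSpace (units G)]

/-- A functional that factors through evaluation at g is a point mass at r(g): it is tight on U if
r(g) ∈ U and null on U otherwise, so its part on U is all of it or zero. -/
theorem IsPart.apply_of_eval {u : Bis G} {U : Set (units G)} (hU : IsOpen U) {g : G}
    {φ : StrongDual ℂ (A.Fib g)} {θ : StrongDual ℂ (A.C0 u)}
    (h : IsPart U (φ.comp (C0.eval g)) θ) (a : A.C0 u) :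
    θ a = φ (open Classical in if rngUnit g ∈ U then a.1 g else 0) := by
  by_cases hg : rngUnit g ∈ U
  · rw [if_pos hg, h.eq_self hU fun ε hε => ⟨{rngUnit g}, Set.singleton_subset_iff.2 hg,
      isCompact_singleton, fun b hb => ?_⟩]
    · rfl
    · have e : b.1 g = 0 := hb g rfl
      change ‖φ (b.1 g)‖ ≤ _
      rw [e, map_zero, norm_zero]
      positivity
  · rw [if_neg hg, map_zero, h.eq_zero hU fun b hb => ?_]
    · rfl
    · have e : b.1 g = 0 := hb g hg
      change φ (b.1 g) = 0
      rw [e, map_zero]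

end Eval

/-! ### Sums over range fibres in terms of pairs of bisections -/

section Formulas

variable {G : Type u} [TopologicalSpace G] [TopGroupoid G] {A : GroupoidFellBundle.{u, v} G}
  [EtaleGroupoid G] {S : InverseSubmonoid (Bis G)}

/-- The function `g ↦ ∑_{p ∋ g} c_p(r(g))`. -/
noncomputable def rangeSec (F : Finset S.toSubmonoid) (c : S.toSubmonoid → A.C0 (1 : Bis G))
    (g : G) : A.Fib (rng g) :=
  ∑ p ∈ F, open Classical in if g ∈ p.1 then (c p).1 (rng g) else 0

theorem finite_rangeSec_ne_zero (F : Finset S.toSubmonoid)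
    (c : S.toSubmonoid → A.C0 (1 : Bis G)) (x : units G) :
    {k : {k : G // rng k = x.1} | rangeSec F c k.1 ≠ 0}.Finite := by
  refine (F.finite_toSet.biUnion (t := fun p => {k : {k : G // rng k = x.1} | k.1 ∈ p.1})
    fun p _ => Set.Subsingleton.finite fun k hk k' hk' => ?_).subset fun k hk => ?_
  · exact Subtype.ext (p.1.rng_inj hk hk' (k.2.trans k'.2.symm))
  · by_contra h
    refine hk (Finset.sum_eq_zero fun p hp => if_neg fun hkp => h ?_)
    exact Set.mem_biUnion (Finset.mem_coe.2 hp) hkp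

/-- A product k l of arrows is the unit x only if l = k⁻¹. This is why the projection 1_{pt^*}
counts the common arrows of p and t. -/
theorem mem_mul_inv_iff {p t : Bis G} {x : G} (hx : x ∈ units G) :
    x ∈ p * t⁻¹ ↔ ∃ k, k ∈ p ∧ k ∈ t ∧ rng k = x := by
  constructor
  · rintro ⟨k, l, hk, hl, H⟩
    have e1 : rng k = x := by rw [← H.rng_eq, rng_of_unit hx]
    have e2 : l = ginv k := by
      subst e1
      exact H.left_cancel (isMul_ginv k)
    subst e2
    have hl' : ginv (ginv k) ∈ t := hl
    rw [ginv_ginv] at hl'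
    exact ⟨k, hk, hl', e1⟩
  · rintro ⟨k, hkp, hkt, rfl⟩
    exact ⟨k, ginv k, hkp, Bis.mem_inv.2 (by rwa [ginv_ginv]), isMul_ginv k⟩

theorem rng_mem_mul_inv_iff {p s t : Bis G} {g : G} (hg : g ∈ s) :
    rng g ∈ p * (s * t)⁻¹ ↔ ∃ h k, h ∈ t ∧ k ∈ p ∧ IsMul g h k := by
  rw [mem_mul_inv_iff (rng_mem_units g)]
  constructor
  · rintro ⟨k, hkp, ⟨g', h, hg', hh, H⟩, e⟩
    obtain rfl : g' = g := s.rng_inj hg' hg (by rw [← H.rng_eq, e])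
    exact ⟨h, k, hh, hkp, H⟩
  · rintro ⟨h, k, hh, hk, H⟩
    exact ⟨k, hk, ⟨g, h, hg, hh, H⟩, H.rng_eq⟩

theorem mul_star_rangeSec_self (F : Finset S.toSubmonoid) (c : S.toSubmonoid → A.C0 (1 : Bis G))
    {x k : G} (hx : x ∈ units G) (hk : rng k = x) (H1 : IsMul x (rng k) x)
    (H2 : ginv (rng k) = x) :
    A.mul H1 (A.star H2 (rangeSec F c k)) (rangeSec F c k) =
      ∑ q ∈ F ×ˢ F, open Classical in if k ∈ q.1.1 ∧ k ∈ q.2.1 then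
        A.mul (isMul_unit hx) (A.star (ginv_of_unit hx) ((c q.1).1 x)) ((c q.2).1 x) else 0 := by
  classical
  subst hk
  rw [Finset.sum_product]
  simp only [rangeSec, map_sum, LinearMap.sum_apply]
  rw [Finset.sum_comm]
  refine Finset.sum_congr rfl fun p _ => Finset.sum_congr rfl fun t _ => ?_
  by_cases h1 : k ∈ p.1 <;> by_cases h2 : k ∈ t.1 <;> simp [h1, h2]

/-- The summand `c_p^* b c_t` of an average. -/
noncomputable def avgTerm (c : S.toSubmonoid → A.C0 (1 : Bis G))
    (q : S.toSubmonoid × S.toSubmonoid) (g : G) (b : A.Fib g) : A.Fib g :=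
  A.mul (isMul_src g) (A.mul (isMul_rng g)
    (A.star (ginv_of_unit (rng_mem_units g)) ((c q.1).1 (rng g))) b) ((c q.2).1 (src g))

theorem mul_star_rangeSec_mul (F : Finset S.toSubmonoid) (c : S.toSubmonoid → A.C0 (1 : Bis G))
    {g h k : G} (hk : rng k = rng g) (hh : rng h = src g) (H1 : IsMul g (rng h) g)
    (H2 : ginv (rng k) = rng g) (b : A.Fib g) :
    A.mul H1 (A.mul (isMul_rng g) (A.star H2 (rangeSec F c k)) b) (rangeSec F c h) =
      ∑ q ∈ F ×ˢ F, open Classical in if k ∈ q.1.1 ∧ h ∈ q.2.1 then avgTerm c q g b else 0 := by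
  classical
  rw [Finset.sum_product]
  simp only [rangeSec, map_sum, LinearMap.sum_apply]
  rw [Finset.sum_comm]
  refine Finset.sum_congr rfl fun p _ => Finset.sum_congr rfl fun t _ => ?_
  by_cases h1 : k ∈ p.1
  · by_cases h2 : h ∈ t.1
    · rw [if_pos h1, if_pos h2, if_pos ⟨h1, h2⟩, avgTerm,
        star_congr_apply (c p) hk H2 (ginv_of_unit (rng_mem_units g)),
        mul_congr_apply (c t) hh H1 (isMul_src g)]
    · simp [h2]
  · simp [h1]

/-- The coefficients depend only on the ranges r(gh) = r(g) and r(h) = s(g), so the summand for a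
pair (p, t) is the same for every h; the sum over h only asks whether some h ∈ t has gh ∈ p. -/
theorem average_rangeSec (F : Finset S.toSubmonoid) (c : S.toSubmonoid → A.C0 (1 : Bis G))
    (f : ∀ g, A.Fib g) (g : G) : average (rangeSec F c) f g = ∑ q ∈ F ×ˢ F,
      open Classical in if ∃ h k, h ∈ q.2.1 ∧ k ∈ q.1.1 ∧ IsMul g h k then
        avgTerm c q g (f g) else 0 := by
  classical
  have h1 : average (rangeSec F c) f g = ∑ᶠ h : {h : G // rng h = src g}, ∑ q ∈ F ×ˢ F,
      if gmul g h.1 h.2.symm ∈ q.1.1 ∧ h.1 ∈ q.2.1 then avgTerm c q g (f g) else 0 := by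
    refine finsum_congr fun h => ?_
    rw [mul_star_rangeSec_mul F c (rng_gmul _ _ _) h.2]
  have h2 := finsum_sum_ite (F ×ˢ F) (fun q (h : {h : G // rng h = src g}) =>
    gmul g h.1 h.2.symm ∈ q.1.1 ∧ h.1 ∈ q.2.1) (fun q h h' H H' => Subtype.ext
      (q.2.1.rng_inj H.2 H'.2 (h.2.trans h'.2.symm))) (fun q => avgTerm c q g (f g))
  refine h1.trans (Eq.trans (finsum_congr fun h => Finset.sum_congr rfl fun q _ => by congr)
    (h2.trans (Finset.sum_congr rfl fun q _ => if_congr ?_ rfl rfl)))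
  constructor
  · rintro ⟨h, H1, H2⟩
    exact ⟨h.1, _, H2, H1, isMul_gmul h.2.symm⟩
  · rintro ⟨h, k, H1, H2, hc, rfl⟩
    exact ⟨⟨h, hc.symm⟩, H2, H1⟩

variable [T2Space (units G)]

theorem sqSum_rangeSec (F : Finset S.toSubmonoid) (c : S.toSubmonoid → A.C0 (1 : Bis G))
    (x : units G) : sqSum (rangeSec F c) x = ∑ q ∈ F ×ˢ F,
      open Classical in if x ∈ (q.1 * q.2⁻¹).1.unitSet then
        (lmulOne S A (starC0 S A (c q.1)) (c q.2)).1 x.1 else 0 := by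
  classical
  have h1 : sqSum (rangeSec F c) x = ∑ᶠ k : {k : G // rng k = x.1}, ∑ q ∈ F ×ˢ F,
      if k.1 ∈ q.1.1 ∧ k.1 ∈ q.2.1 then
        (lmulOne S A (starC0 S A (c q.1)) (c q.2)).1 x.1 else 0 := by
    refine finsum_congr fun k => ?_
    rw [mul_star_rangeSec_self F c x.2 k.2]
    refine Finset.sum_congr rfl fun q _ => ?_
    rw [lmulOne_apply_unit, starC0_apply]
  have h2 := finsum_sum_ite (F ×ˢ F) (fun q (k : {k : G // rng k = x.1}) =>
    k.1 ∈ q.1.1 ∧ k.1 ∈ q.2.1) (fun q h h' H H' => Subtype.ext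
      (q.2.1.rng_inj H.2 H'.2 (h.2.trans h'.2.symm)))
      (fun q => (lmulOne S A (starC0 S A (c q.1)) (c q.2)).1 x.1)
  refine h1.trans (Eq.trans (finsum_congr fun h => Finset.sum_congr rfl fun q _ => by congr)
    (h2.trans (Finset.sum_congr rfl fun q _ => if_congr ?_ rfl rfl)))
  refine Iff.trans ?_ (mem_mul_inv_iff (p := q.1.1) (t := q.2.1) x.2).symm
  constructor
  · rintro ⟨k, H1, H2⟩
    exact ⟨k.1, H1, H2, k.2⟩
  · rintro ⟨k, H1, H2, e⟩
    exact ⟨⟨k, e⟩, H1, H2⟩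

theorem average_rangeSec_C0 (F : Finset S.toSubmonoid)
    (c : S.toSubmonoid → A.C0 (1 : Bis G)) (s : S.toSubmonoid) (a : A.C0 s.1) (g : G) :
    average (rangeSec F c) a.1 g = ∑ q ∈ F ×ˢ F,
      open Classical in if rngUnit g ∈ (q.1 * (s * q.2)⁻¹).1.unitSet then
        (rmulC0 S A s (lmulC0 S A s (starC0 S A (c q.1)) a) (c q.2)).1 g else 0 := by
  classical
  rw [average_rangeSec]
  refine Finset.sum_congr rfl fun q _ => ?_
  have e : (rmulC0 S A s (lmulC0 S A s (starC0 S A (c q.1)) a) (c q.2)).1 g =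
      avgTerm c q g (a.1 g) := by
    rw [rmulC0_apply, lmulC0_apply, starC0_apply _ ⟨rng g, rng_mem_units g⟩]
    rfl
  rw [e]
  -- The combinatorial description of p(st)^* is valid only for g ∈ s; for other g the section
  -- vanishes and both conditions are irrelevant.
  by_cases hg : g ∈ s.1
  · exact if_congr (rng_mem_mul_inv_iff (p := q.1.1) (t := q.2.1) hg).symm rfl rfl
  · have : avgTerm c q g (a.1 g) = 0 := by
      rw [avgTerm, C0.apply_eq_zero a hg, map_zero, map_zero, LinearMap.zero_apply]
    rw [this, ite_self, ite_self]

end Formulas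

/-! ### Bidual norms equal supremum norms over the groupoid -/

section Comparison

variable {G : Type u} [TopologicalSpace G] [TopGroupoid G] {A : GroupoidFellBundle.{u, v} G}
  [EtaleGroupoid G] {S : InverseSubmonoid (Bis G)} [T2Space (units G)]

/-- The coefficients of a finitely supported section, as sections over the unit space. -/
noncomputable def coeff (ξ : (A.toFellBundle S).FinSection) (p : S.toSubmonoid) :
    A.C0 (1 : Bis G) := ξ.val p

/-- The section of `r^*(A⁰)` associated to a finitely supported section over `S`. -/
noncomputable def toRange (ξ : (A.toFellBundle S).FinSection) : ∀ g : G, A.Fib (rng g) :=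
  rangeSec ξ.finite_support.toFinset (coeff ξ)

theorem sqSum_apply_eq (ξ : (A.toFellBundle S).FinSection)
    (ψ : StrongDual ℂ (A.C0 (1 : Bis G))) :
    ξ.sqSum ψ = ∑ q ∈ ξ.finite_support.toFinset ×ˢ ξ.finite_support.toFinset,
      partMap (lmulOne S A) (projC0 S A (q.1 * q.2⁻¹)) ψ
        (lmulOne S A (starC0 S A (coeff ξ q.1)) (coeff ξ q.2)) :=
  FellBundle.FinSection.sqSum_apply ξ ψ

theorem average_sub_apply_eq (ξ : (A.toFellBundle S).FinSection) (s : S.toSubmonoid)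
    (a : A.C0 s.1) (ψ : StrongDual ℂ (A.C0 s.1)) :
    (ξ.average s a - NormedSpace.inclusionInDoubleDual ℂ ((A.toFellBundle S).Fib s) a) ψ =
      ψ (-a) + ∑ q ∈ ξ.finite_support.toFinset ×ˢ ξ.finite_support.toFinset,
      partMap (lmulC0 S A s).flip (projC0 S A (q.1 * (s * q.2)⁻¹)) ψ
        (rmulC0 S A s (lmulC0 S A s (starC0 S A (coeff ξ q.1)) a) (coeff ξ q.2)) :=
  FellBundle.FinSection.average_sub_apply ξ s a ψ

variable [LocallyCompactSpace (units G)]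

theorem norm_sqSum_apply_le (hS : S.IsWide) (ξ : (A.toFellBundle S).FinSection) {C : ℝ} (hC : 0 ≤ C)
    (h : ∀ x, ‖sqSum (toRange ξ) x‖ ≤ C) (ψ : StrongDual ℂ (A.C0 (1 : Bis G))) :
    ‖ξ.sqSum ψ‖ ≤ C * ‖ψ‖ := by
  rw [sqSum_apply_eq]
  -- The square sum has no undecorated term, so a₀ = 0; for the average, a₀ = -a accounts for the
  -- limit that is subtracted.
  have h1 := norm_add_sum_part_le (A := A) (u := 1)
    (U := fun q : S.toSubmonoid × S.toSubmonoid => (q.1 * q.2⁻¹).1.unitSet)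
    (fun q => Bis.isOpen_unitSet _)
    (fun q => partMap (lmulOne S A) (projC0 S A (q.1 * q.2⁻¹))) (fun q => isPart_right hS _)
    0 (fun q => lmulOne S A (starC0 S A (coeff ξ q.1)) (coeff ξ q.2)) hC
    (ξ.finite_support.toFinset ×ˢ ξ.finite_support.toFinset) (fun g => ?_) ψ
  · rw [map_zero, zero_add] at h1
    exact h1
  · by_cases hg : g ∈ units G
    · have h2 := h ⟨g, hg⟩
      rw [toRange, sqSum_rangeSec] at h2
      have e : rngUnit g = ⟨g, hg⟩ := rngUnit_of_unit ⟨g, hg⟩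
      rw [e]
      refine le_trans (le_of_eq ?_) h2
      congr 1
      exact zero_add _
    · rw [C0.apply_eq_zero _ hg, zero_add, Finset.sum_eq_zero, norm_zero]
      · exact hC
      · intro q _
        rw [C0.apply_eq_zero _ hg, ite_self]

theorem norm_sqSum_le (hS : S.IsWide) (ξ : (A.toFellBundle S).FinSection) {C : ℝ} (hC : 0 ≤ C)
    (h : ∀ x, ‖sqSum (toRange ξ) x‖ ≤ C) : ‖ξ.sqSum‖ ≤ C :=
  NormedSpace.norm_bidual_le hC fun ψ => norm_sqSum_apply_le hS ξ hC h ψ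

theorem norm_average_sub_apply_le (hS : S.IsWide) (ξ : (A.toFellBundle S).FinSection)
    (s : S.toSubmonoid) (a : A.C0 s.1) {C : ℝ} (hC : 0 ≤ C)
    (h : ∀ g, ‖average (toRange ξ) a.1 g - a.1 g‖ ≤ C) (ψ : StrongDual ℂ (A.C0 s.1)) :
    ‖(ξ.average s a - NormedSpace.inclusionInDoubleDual ℂ ((A.toFellBundle S).Fib s) a) ψ‖ ≤
      C * ‖ψ‖ := by
  rw [average_sub_apply_eq]
  have h1 := norm_add_sum_part_le (A := A) (u := s.1)
    (U := fun q : S.toSubmonoid × S.toSubmonoid => (q.1 * (s * q.2)⁻¹).1.unitSet)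
    (fun q => Bis.isOpen_unitSet _)
    (fun q => partMap (lmulC0 S A s).flip (projC0 S A (q.1 * (s * q.2)⁻¹)))
    (fun q => isPart_left hS _ s) (-a)
    (fun q => rmulC0 S A s (lmulC0 S A s (starC0 S A (coeff ξ q.1)) a) (coeff ξ q.2)) hC
    (ξ.finite_support.toFinset ×ˢ ξ.finite_support.toFinset) (fun g => ?_) ψ
  · exact h1
  · have h2 := h g
    rw [toRange, average_rangeSec_C0, sub_eq_neg_add] at h2
    exact h2

theorem norm_average_sub_le (hS : S.IsWide) (ξ : (A.toFellBundle S).FinSection)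
    (s : S.toSubmonoid) (a : A.C0 s.1) {C : ℝ} (hC : 0 ≤ C)
    (h : ∀ g, ‖average (toRange ξ) a.1 g - a.1 g‖ ≤ C) :
    ‖ξ.average s a - NormedSpace.inclusionInDoubleDual ℂ ((A.toFellBundle S).Fib s) a‖ ≤ C :=
  NormedSpace.norm_bidual_le hC fun ψ => norm_average_sub_apply_le hS ξ s a hC h ψ

/-- Evaluate the bidual element at a norming functional of the fibre composed with evaluation at x.
On such a point mass the projections become indicator functions, so the fibrewise sum appears. -/
theorem norm_sqSum_toRange_le (hS : S.IsWide) (ξ : (A.toFellBundle S).FinSection)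
    (x : units G) : ‖sqSum (toRange ξ) x‖ ≤ ‖ξ.sqSum‖ := by
  obtain ⟨φ, hφ, he⟩ := exists_dual_vector'' ℂ (sqSum (toRange ξ) x)
  have h1 := NormedSpace.norm_bidual_apply_le ξ.sqSum
    (ψ := (φ.comp (C0.eval x.1) : StrongDual ℂ (A.C0 (1 : Bis G)))) (C0.norm_comp_eval_le hφ)
  refine le_trans (le_of_eq ?_) h1
  have h2 : ξ.sqSum (φ.comp (C0.eval x.1) : StrongDual ℂ (A.C0 (1 : Bis G))) =
      φ (sqSum (toRange ξ) x) := by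
    rw [sqSum_apply_eq, toRange, sqSum_rangeSec, map_sum]
    refine Finset.sum_congr rfl fun q _ => ?_
    rw [(isPart_right hS _ _).apply_of_eval (Bis.isOpen_unitSet _), rngUnit_of_unit]
  rw [h2, he]
  simp

theorem norm_average_toRange_sub_le (hS : S.IsWide) (ξ : (A.toFellBundle S).FinSection)
    (s : S.toSubmonoid) (a : A.C0 s.1) (g : G) :
    ‖average (toRange ξ) a.1 g - a.1 g‖ ≤
      ‖ξ.average s a - NormedSpace.inclusionInDoubleDual ℂ ((A.toFellBundle S).Fib s) a‖ := by
  obtain ⟨φ, hφ, he⟩ := exists_dual_vector'' ℂ (average (toRange ξ) a.1 g - a.1 g)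
  have h1 := NormedSpace.norm_bidual_apply_le
    (ξ.average s a - NormedSpace.inclusionInDoubleDual ℂ ((A.toFellBundle S).Fib s) a)
    (ψ := (φ.comp (C0.eval g) : StrongDual ℂ (A.C0 s.1))) (C0.norm_comp_eval_le hφ)
  refine le_trans (le_of_eq ?_) h1
  have h2 : (ξ.average s a - NormedSpace.inclusionInDoubleDual ℂ ((A.toFellBundle S).Fib s) a)
      (φ.comp (C0.eval g) : StrongDual ℂ (A.C0 s.1)) =
      φ (average (toRange ξ) a.1 g - a.1 g) := by
    rw [average_sub_apply_eq, toRange, average_rangeSec_C0, sub_eq_neg_add, map_add, map_sum]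
    refine congrArg₂ (· + ·) rfl (Finset.sum_congr rfl fun q _ => ?_)
    rw [(isPart_left hS _ s _).apply_of_eval (Bis.isOpen_unitSet _)]
  rw [h2, he]
  simp

end Comparison

end GroupoidFellBundle

namespace GroupoidFellBundle

/-! ### Compactly supported sections and their transport to the unit space -/

section CompactSupport

variable {G : Type u} [TopologicalSpace G] [TopGroupoid G] {A : GroupoidFellBundle.{u, v} G}

theorem bddAbove_norm_of_isCompact {f : ∀ g : G, A.Fib g} {u K : Set G} (hu : IsOpen u)
    (hf : ContinuousOn (fun g => (⟨g, f g⟩ : A.Total)) u) (hKu : K ⊆ u) (hK : IsCompact K) :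
    BddAbove ((fun g => ‖f g‖) '' K) := by
  refine UpperSemicontinuousOn.bddAbove_of_isCompact hK fun g hg c hc => ?_
  refine Filter.Eventually.filter_mono nhdsWithin_le_nhds ?_
  exact (hf.continuousAt (hu.mem_nhds (hKu hg))).tendsto.eventually
    (A.upperSemicontinuous_norm (⟨g, f g⟩ : A.Total) c hc)

theorem exists_C0_of_isCompact {f : ∀ g : G, A.Fib g} (u : Bis G)
    (hf : ContinuousOn (fun g => (⟨g, f g⟩ : A.Total)) u.carrier) {K : Set G}
    (hKu : K ⊆ u.carrier) (hK : IsCompact K) (h0 : ∀ g ∉ K, f g = 0) :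
    ∃ a : A.C0 u, ∀ g, a.1 g = f g := by
  obtain ⟨C, hC⟩ := bddAbove_norm_of_isCompact u.2.isOpen hf hKu hK
  have hm : Memℓp f ∞ := by
    refine memℓp_infty ⟨max C 0, ?_⟩
    rintro _ ⟨g, rfl⟩
    by_cases hg : g ∈ K
    · exact (hC ⟨g, hg, rfl⟩).trans (le_max_left _ _)
    · change ‖f g‖ ≤ _
      rw [h0 g hg, norm_zero]
      exact le_max_right _ _
  refine ⟨⟨⟨f, hm⟩, fun g hg => h0 g fun h => hg (hKu h), hf, fun ε hε =>
    ⟨K, hKu, hK, fun g hg => ?_⟩⟩, fun g => rfl⟩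
  change ‖f g‖ < ε
  rw [h0 g hg, norm_zero]
  exact hε

/-- The range map embeds p as an open subset of the unit space, so compact subsets of r(p) lift to
compact subsets of p. -/
theorem isCompact_inter_preimage_rngUnit (p : Bis G) {L : Set (units G)} (hL : IsCompact L)
    (h : L ⊆ rngUnit '' p.carrier) : IsCompact (p.carrier ∩ rngUnit ⁻¹' L) := by
  have h1 : IsCompact ((fun g : p.carrier => (⟨rng g.1, rng_mem_units g.1⟩ : units G)) ⁻¹' L) := by
    refine (p.2.rng_emb.isInducing.isCompact_preimage_iff ?_).2 hL
    rw [Set.image_eq_range] at h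
    exact h
  have h2 : p.carrier ∩ rngUnit ⁻¹' L = Subtype.val ''
      ((fun g : p.carrier => (⟨rng g.1, rng_mem_units g.1⟩ : units G)) ⁻¹' L) := by
    ext g
    constructor
    · rintro ⟨hg, hgL⟩
      exact ⟨⟨g, hg⟩, hgL, rfl⟩
    · rintro ⟨⟨g, hg⟩, hgL, rfl⟩
      exact ⟨hg, hgL⟩
  rw [h2]
  exact h1.image continuous_subtype_val

/-- The section over the unit space that corresponds to a section of `r^*(A⁰)` over `u`. -/
noncomputable def pushRange (u : Bis G) (ξ : ∀ g : G, A.Fib (rng g)) (x : G) : A.Fib x :=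
  open Classical in if h : ∃ g, g ∈ u ∧ rng g = x then h.choose_spec.2 ▸ ξ h.choose else 0

theorem pushRange_rng (u : Bis G) (ξ : ∀ g : G, A.Fib (rng g)) {g : G} (hg : g ∈ u) :
    pushRange u ξ (rng g) = ξ g := by
  have h : ∃ k, k ∈ u ∧ rng k = rng g := ⟨g, hg, rfl⟩
  rw [pushRange, dif_pos h]
  have key : ∀ k (e : rng k = rng g), k = g → (e ▸ ξ k : A.Fib (rng g)) = ξ g := by
    rintro k e rfl
    rfl
  exact key _ _ (u.rng_inj h.choose_spec.1 hg h.choose_spec.2)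

theorem pushRange_eq_zero (u : Bis G) {ξ : ∀ g : G, A.Fib (rng g)} {x : G}
    (h : ∀ g, g ∈ u → rng g = x → ξ g = 0) : pushRange u ξ x = 0 := by
  by_cases hx : ∃ g, g ∈ u ∧ rng g = x
  · obtain ⟨g, hg, rfl⟩ := hx
    rw [pushRange_rng u ξ hg, h g hg rfl]
  · rw [pushRange, dif_neg hx]

variable [EtaleGroupoid G]

theorem rng_mem_mul_inv_self {u : Bis G} {g : G} (hg : g ∈ u) : rng g ∈ u * u⁻¹ :=
  (mem_mul_inv_iff (rng_mem_units g)).2 ⟨g, hg, hg, rfl⟩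

theorem mul_inv_self_subset_units (u : Bis G) : (u * u⁻¹).carrier ⊆ units G := by
  rintro x ⟨g, h, hg, hh, H⟩
  have hh' : ginv h ∈ u := hh
  have e : g = ginv h := u.src_inj hg hh' (by rw [src_ginv, H.comp])
  subst e
  have H' := isMul_ginv_left h
  rw [H.unique H']
  exact src_mem_units h

theorem mem_mul_inv_self {u : Bis G} {x : G} (hx : x ∈ u * u⁻¹) : ∃ g, g ∈ u ∧ rng g = x := by
  obtain ⟨g, hg, -, e⟩ := (mem_mul_inv_iff (mul_inv_self_subset_units u hx)).1 hx
  exact ⟨g, hg, e⟩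

/-- Over r(u) the section is ξ composed with `Bis.lift`, the continuous inverse of the range map on
u. -/
theorem continuousOn_pushRange (u : Bis G) {ξ : ∀ g : G, A.Fib (rng g)}
    (hξ : ContinuousOn (fun g => (⟨rng g, ξ g⟩ : A.Total)) u.carrier) :
    ContinuousOn (fun x => (⟨x, pushRange u ξ x⟩ : A.Total)) (u * u⁻¹).carrier := by
  have hl : ∀ x ∈ (u * u⁻¹).carrier, ∃ g, g ∈ u ∧ rng g = x ∧ u.lift x = g := fun x hx => by
    obtain ⟨g, hg, e⟩ := mem_mul_inv_self hx
    exact ⟨g, hg, e, u.lift_eq hg (by rw [← e, rng_rng])⟩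
  have h1 : ContinuousOn u.lift (u * u⁻¹).carrier := u.continuousOn_lift.mono fun x hx => by
    obtain ⟨g, hg, e, -⟩ := hl x hx
    exact ⟨g, hg, by rw [← e, rng_rng]⟩
  refine (hξ.comp h1 fun x hx => ?_).congr fun x hx => ?_
  · obtain ⟨g, hg, -, e⟩ := hl x hx
    rw [e]
    exact hg
  · obtain ⟨g, hg, rfl, e⟩ := hl x hx
    change (⟨rng g, pushRange u ξ (rng g)⟩ : A.Total) = ⟨rng (u.lift (rng g)), ξ (u.lift (rng g))⟩
    rw [e, pushRange_rng u ξ hg]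

variable [T2Space (units G)]

theorem exists_C0_one_of_isCompact {ξ : ∀ g : G, A.Fib (rng g)} (u : Bis G)
    (hξ : ContinuousOn (fun g => (⟨rng g, ξ g⟩ : A.Total)) u.carrier) {K : Set G}
    (hKu : K ⊆ u.carrier) (hK : IsCompact K) (h0 : ∀ g ∉ K, ξ g = 0) :
    ∃ a : A.C0 (1 : Bis G), (∀ g ∈ u, a.1 (rng g) = ξ g) ∧
      C0.VanishesOn a (rngUnit '' u.carrier)ᶜ := by
  obtain ⟨a, ha⟩ := exists_C0_of_isCompact (u * u⁻¹) (continuousOn_pushRange u hξ)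
    (K := rng '' K) (by rintro _ ⟨g, hg, rfl⟩; exact rng_mem_mul_inv_self (hKu hg))
    (hK.image continuous_rng) fun x hx =>
      pushRange_eq_zero u fun g _ e => h0 g fun hgK => hx ⟨g, hgK, e⟩
  refine ⟨⟨a.1, C0.mono (mul_inv_self_subset_units u) a.2⟩, fun g hg => ?_, fun g hg => ?_⟩
  · change a.1 (rng g) = ξ g
    rw [ha, pushRange_rng u ξ hg]
  · refine C0.apply_eq_zero a fun hgu => hg ?_
    obtain ⟨k, hk, e⟩ := mem_mul_inv_self hgu
    exact ⟨k, hk, Subtype.ext (by change rng k = rng g; rw [← e, rng_rng])⟩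

end CompactSupport

/-! ### Compactly supported functions as images of finitely supported sections -/

section Single

variable {G : Type u} [TopologicalSpace G] [TopGroupoid G] {A : GroupoidFellBundle.{u, v} G}

/-- The section of `r^*(A⁰)` over `p` that corresponds to a section over the unit space. -/
noncomputable def single (p : Bis G) {w : Bis G} : A.C0 w →ₗ[ℂ] (∀ g : G, A.Fib (rng g)) where
  toFun c g := open Classical in if g ∈ p then c.1 (rng g) else 0
  map_add' c c' := funext fun g => by
    by_cases h : g ∈ p
    · simp only [h, if_true, Pi.add_apply]; rfl
    · simp [h]
  map_smul' z c := funext fun g => by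
    by_cases h : g ∈ p
    · simp only [h, if_true, Pi.smul_apply]; rfl
    · simp [h]

theorem single_of_mem {p w : Bis G} (c : A.C0 w) {g : G} (hg : g ∈ p) :
    single p c g = c.1 (rng g) := if_pos hg

theorem single_of_notMem {p w : Bis G} (c : A.C0 w) {g : G} (hg : g ∉ p) :
    single p c g = 0 := if_neg hg

variable [EtaleGroupoid G]

variable {S : InverseSubmonoid (Bis G)}

theorem rangeSec_eq_sum_single (F : Finset S.toSubmonoid)
    (c : S.toSubmonoid → A.C0 (1 : Bis G)) : rangeSec F c = ∑ p ∈ F, single p.1 (c p) :=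
  funext fun g => by
    rw [Finset.sum_apply]
    rfl

theorem single_mem_CcRange (p : Bis G) (c : A.C0 (1 : Bis G)) {L : Set (units G)}
    (hL : IsCompact L) (hLp : L ⊆ rngUnit '' p.carrier) (hc : C0.VanishesOn c Lᶜ) :
    single p c ∈ A.CcRange := by
  refine Submodule.subset_span ⟨p.carrier, p.2, ?_, p.carrier ∩ rngUnit ⁻¹' L,
    Set.inter_subset_left, isCompact_inter_preimage_rngUnit p hL hLp, fun g hg => ?_⟩
  · have h1 : ContinuousOn (fun g : G => (⟨rng g, c.1 (rng g)⟩ : A.Total)) p.carrier :=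
      c.2.2.1.comp continuous_rng.continuousOn fun g _ => rng_mem_units g
    refine h1.congr fun g hg => ?_
    change (⟨rng g, single p c g⟩ : A.Total) = _
    rw [single_of_mem c hg]
  · by_cases hgp : g ∈ p
    · rw [single_of_mem c hgp]
      exact hc.apply_rng fun h => hg ⟨hgp, h⟩
    · exact single_of_notMem c hgp

variable [T2Space (units G)]

/-- The section of `r^*(A⁰)` associated to a finitely supported section over `S`, as a linear
map. -/
noncomputable def toRangeLinear (A : GroupoidFellBundle.{u, v} G) (S : InverseSubmonoid (Bis G)) :
    (open Classical in Π₀ s : S.toSubmonoid, A.C0 (s * s⁻¹).1) →ₗ[ℂ] (∀ g : G, A.Fib (rng g)) :=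
  open Classical in DFinsupp.lsum ℕ fun s => single s.1

/-- Shows that the image of `toRange` contains the range of a linear map, so that it is enough to
reach the generators of `CcRange`. -/
theorem exists_toRange_eq (c : Π₀ s : S.toSubmonoid, A.C0 (s * s⁻¹).1) :
    ∃ η : (A.toFellBundle S).FinSection, toRange η = toRangeLinear A S c := by
  classical
  refine ⟨⟨fun s => c s, c.finite_support⟩, ?_⟩
  rw [toRange, rangeSec_eq_sum_single]
  have h1 : toRangeLinear A S c = ∑ s ∈ c.support, single s.1 (c s) := by
    have := DFinsupp.sumAddHom_apply
      (fun s : S.toSubmonoid => (single (A := A) (w := (s * s⁻¹).1) s.1).toAddMonoidHom) c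
    exact this
  rw [h1]
  refine Finset.sum_congr ?_ fun s _ => rfl
  ext s
  rw [Set.Finite.mem_toFinset, DFinsupp.mem_support_iff]
  rfl

variable [LocallyCompactSpace (units G)]

/-- A partition of unity subordinate to the open sets r(t ∩ u), t ∈ S, decomposes ξ. Over r(t ∩ u)
the bisections t and u have the same arrow, so each piece over u may be regarded as a piece over t.
-/
theorem exists_sum_single (hS : S.IsWide) {ξ : ∀ g : G, A.Fib (rng g)} (u : Bis G)
    (hξ : ContinuousOn (fun g => (⟨rng g, ξ g⟩ : A.Total)) u.carrier) {K : Set G}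
    (hKu : K ⊆ u.carrier) (hK : IsCompact K) (h0 : ∀ g ∉ K, ξ g = 0) :
    ∃ (n : ℕ) (t : Fin n → S.toSubmonoid) (c : ∀ i, A.C0 (t i * (t i)⁻¹).1),
      ξ = ∑ i, single (t i).1 (c i) := by
  obtain ⟨a, ha, ha0⟩ := exists_C0_one_of_isCompact u hξ hKu hK h0
  obtain ⟨n, t, ρ, hρ, hsum⟩ := exists_partition (hK.image continuous_rngUnit)
    (O := fun t : S.toSubmonoid => rngUnit '' (t.1.carrier ∩ u.carrier))
    (fun t => EtaleGroupoid.isOpenMap_rng _ (t.1.2.isOpen.inter u.2.isOpen)) (by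
      rintro _ ⟨g, hg, rfl⟩
      obtain ⟨t, ht, hgt⟩ := hS.1 g
      exact Set.mem_iUnion.2 ⟨⟨t, ht⟩, g, ⟨hgt, hKu hg⟩, rfl⟩)
  have hmem : ∀ i, (C0.cut (ρ i) a).1 ∈ A.C0 (t i * (t i)⁻¹).1 := fun i => by
    refine C0.mem_of_eq_zero _ fun x hx => ?_
    by_cases hxu : x ∈ units G
    · refine C0.cut_apply_of_eq_zero _ (hρ i _ ?_)
      rintro ⟨g, hg, e⟩
      refine hx ?_
      have e' : rng g = x := (congrArg Subtype.val e).trans (rng_of_unit hxu)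
      rw [← e']
      exact rng_mem_mul_inv_self hg.1
    · exact C0.apply_eq_zero _ hxu
  refine ⟨n, t, fun i => ⟨_, hmem i⟩, funext fun g => ?_⟩
  rw [Finset.sum_apply]
  have hr : rngUnit (rng g) = rngUnit g := Subtype.ext (rng_rng g)
  by_cases hg : g ∈ u
  · have h1 : ∀ i, single (t i).1 (⟨_, hmem i⟩ : A.C0 (t i * (t i)⁻¹).1) g =
        ((ρ i (rngUnit g) : ℝ) : ℂ) • ξ g := fun i => by
      by_cases hgt : g ∈ (t i).1
      · rw [single_of_mem _ hgt]
        change (C0.cut (ρ i) a).1 (rng g) = _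
        rw [C0.cut_apply, hr, ha g hg]
      · rw [single_of_notMem _ hgt, hρ i, Set.Icc.coe_zero, Complex.ofReal_zero, zero_smul]
        -- If r(g) were in r(t ∩ u), injectivity of the range on u would force g ∈ t.
        rintro ⟨k, hk, e⟩
        exact hgt (u.rng_inj hk.2 hg (congrArg Subtype.val e) ▸ hk.1)
    rw [Finset.sum_congr rfl fun i _ => h1 i, ← Finset.sum_smul]
    by_cases hgK : g ∈ K
    · rw [hsum _ ⟨g, hgK, rfl⟩, one_smul]
    · rw [h0 g hgK, smul_zero]
  · rw [h0 g fun h => hg (hKu h), Finset.sum_eq_zero]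
    intro i _
    by_cases hgt : g ∈ (t i).1
    · rw [single_of_mem _ hgt]
      refine C0.cut_apply_of_eq_zero (u := (1 : Bis G)) a ?_
      rw [hr]
      refine hρ i _ ?_
      -- Symmetrically, injectivity of the range on t excludes arrows of t outside u.
      rintro ⟨k, hk, e⟩
      exact hg ((t i).1.rng_inj hk.1 hgt (congrArg Subtype.val e) ▸ hk.2)
    · exact single_of_notMem _ hgt

theorem exists_toRange_eq_of_mem_CcRange (hS : S.IsWide) {ξ : ∀ g : G, A.Fib (rng g)}
    (hξ : ξ ∈ A.CcRange) : ∃ η : (A.toFellBundle S).FinSection, toRange η = ξ := by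
  classical
  have h : A.CcRange ≤ LinearMap.range (toRangeLinear A S) := by
    refine Submodule.span_le.2 ?_
    rintro ξ ⟨u, hu, hc, K, hKu, hK, h0⟩
    obtain ⟨n, t, c, rfl⟩ := exists_sum_single hS ⟨u, hu⟩ hc hKu hK h0
    refine sum_mem fun i _ => ⟨DFinsupp.single (t i) (c i), ?_⟩
    exact DFinsupp.lsum_single ℕ _ _ _
  obtain ⟨c, rfl⟩ := h hξ
  exact exists_toRange_eq c

end Single

end GroupoidFellBundle

theorem tendsto_nhds_iff_norm_sub_lt {E ι : Type*} [SeminormedAddCommGroup E] {l : Filter ι}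
    {m : ι → E} {m₀ : E} :
    Tendsto m l (𝓝 m₀) ↔ ∀ ε > (0 : ℝ), ∀ᶠ i in l, ‖m i - m₀‖ < ε := by
  simp only [Metric.tendsto_nhds, dist_eq_norm]

theorem NormedSpace.tendsto_bidual_iff {X ι : Type*} [NormedAddCommGroup X] [NormedSpace ℂ X]
    {l : Filter ι} {m : ι → Bidual X} {m₀ : Bidual X} :
    Tendsto m l (𝓝 m₀) ↔ ∀ ε > (0 : ℝ), ∀ᶠ i in l, ‖m i - m₀‖ < ε :=
  tendsto_nhds_iff_norm_sub_lt (E := Bidual X)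

theorem isDirectedOrder_prod {ι κ : Type*} [Preorder ι] [Preorder κ] [IsDirectedOrder ι]
    [IsDirectedOrder κ] : IsDirectedOrder (ι × κ) :=
  ⟨fun a b => by
    obtain ⟨i, hi, hi'⟩ := exists_ge_ge a.1 b.1
    obtain ⟨k, hk, hk'⟩ := exists_ge_ge a.2 b.2
    exact ⟨(i, k), ⟨hi, hk⟩, ⟨hi', hk'⟩⟩⟩

namespace GroupoidFellBundle

/-! ### Approximating by compactly supported functions -/

section Perturbation

variable {G : Type u} [TopologicalSpace G] [TopGroupoid G] {A : GroupoidFellBundle.{u, v} G}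

theorem norm_mul_sub_mul_le {g h k : G} (H : IsMul g h k) (a a' : A.Fib g) (b b' : A.Fib h) :
    ‖A.mul H a b - A.mul H a' b'‖ ≤ ‖a - a'‖ * ‖b‖ + ‖a'‖ * ‖b - b'‖ := by
  have e : A.mul H a b - A.mul H a' b' = A.mul H (a - a') b + A.mul H a' (b - b') := by
    rw [map_sub, map_sub, LinearMap.sub_apply, sub_add_sub_cancel]
  rw [e]
  exact (norm_add_le _ _).trans (add_le_add (A.norm_mul_le H _ _) (A.norm_mul_le H _ _))

theorem norm_sum_ite_sub_sum_ite_le {ι X : Type*} [NormedAddCommGroup X] (F : Finset ι)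
    (P : ι → Prop) [DecidablePred P] (a b : ι → X) {C : ℝ} (hC : 0 ≤ C)
    (h : ∀ i ∈ F, ‖a i - b i‖ ≤ C) :
    ‖∑ i ∈ F, (if P i then a i else 0) - ∑ i ∈ F, (if P i then b i else 0)‖ ≤ F.card * C := by
  rw [← Finset.sum_sub_distrib, ← nsmul_eq_mul, ← Finset.sum_const]
  refine norm_sum_le_of_le F fun i hi => ?_
  by_cases hP : P i
  · rw [if_pos hP, if_pos hP]
    exact h i hi
  · rw [if_neg hP, if_neg hP, sub_zero, norm_zero]
    exact hC

variable [EtaleGroupoid G] {S : InverseSubmonoid (Bis G)}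

theorem norm_avgTerm_sub_le {c c' : S.toSubmonoid → A.C0 (1 : Bis G)}
    {q : S.toSubmonoid × S.toSubmonoid} {M δ : ℝ} (h2 : ‖c q.2‖ ≤ M) (h1' : ‖c' q.1‖ ≤ M)
    (h1 : ‖c q.1 - c' q.1‖ ≤ δ) (h : ‖c q.2 - c' q.2‖ ≤ δ) (g : G) (b : A.Fib g) :
    ‖avgTerm c q g b - avgTerm c' q g b‖ ≤ 2 * M * δ * ‖b‖ := by
  have hM : 0 ≤ M := (norm_nonneg _).trans h2
  have hδ : 0 ≤ δ := (norm_nonneg _).trans h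
  have hH := ginv_of_unit (rng_mem_units g)
  refine (norm_mul_sub_mul_le _ _ _ _ _).trans ?_
  rw [← LinearMap.sub_apply, ← map_sub, ← map_sub]
  have e1 : ‖(c q.1).1 (rng g) - (c' q.1).1 (rng g)‖ ≤ δ :=
    (C0.norm_apply_le (c q.1 - c' q.1) (rng g)).trans h1
  have e2 : ‖(c q.2).1 (src g) - (c' q.2).1 (src g)‖ ≤ δ :=
    (C0.norm_apply_le (c q.2 - c' q.2) (src g)).trans h
  have e3 := A.norm_mul_le (isMul_rng g)
    (A.star hH ((c q.1).1 (rng g) - (c' q.1).1 (rng g))) b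
  have e4 := A.norm_mul_le (isMul_rng g) (A.star hH ((c' q.1).1 (rng g))) b
  rw [norm_star] at e3 e4
  have e5 := (C0.norm_apply_le (c q.2) (src g)).trans h2
  have e6 := (C0.norm_apply_le (c' q.1) (rng g)).trans h1'
  calc _ ≤ (δ * ‖b‖) * M + (M * ‖b‖) * δ := by
        refine add_le_add (mul_le_mul (e3.trans ?_) e5 (norm_nonneg _) (by positivity))
          (mul_le_mul (e4.trans ?_) e2 (norm_nonneg _) (by positivity))
        · gcongr
        · gcongr
    _ = _ := by ring

variable [T2Space (units G)]

theorem norm_star_mul_sub_le {c₁ c₂ c₁' c₂' : A.C0 (1 : Bis G)} {M δ : ℝ} (h2 : ‖c₂‖ ≤ M)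
    (h1' : ‖c₁'‖ ≤ M) (h1 : ‖c₁ - c₁'‖ ≤ δ) (h : ‖c₂ - c₂'‖ ≤ δ) (x : units G) :
    ‖(lmulOne S A (starC0 S A c₁) c₂).1 x.1 - (lmulOne S A (starC0 S A c₁') c₂').1 x.1‖ ≤
      2 * M * δ := by
  have hM : 0 ≤ M := (norm_nonneg _).trans h2
  have hδ : 0 ≤ δ := (norm_nonneg _).trans h
  rw [lmulOne_apply_unit, lmulOne_apply_unit, starC0_apply, starC0_apply]
  refine (norm_mul_sub_mul_le _ _ _ _ _).trans ?_
  rw [← map_sub, norm_star, norm_star]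
  have e1 : ‖c₁.1 x.1 - c₁'.1 x.1‖ ≤ δ := (C0.norm_apply_le (c₁ - c₁') x.1).trans h1
  have e2 : ‖c₂.1 x.1 - c₂'.1 x.1‖ ≤ δ := (C0.norm_apply_le (c₂ - c₂') x.1).trans h
  have e3 := (C0.norm_apply_le c₂ x.1).trans h2
  have e4 := (C0.norm_apply_le c₁' x.1).trans h1'
  calc _ ≤ δ * M + M * δ := by gcongr
    _ = _ := by ring

theorem vanishesOn_coeff (ξ : (A.toFellBundle S).FinSection) (p : S.toSubmonoid) :
    C0.VanishesOn (coeff ξ p) (rngUnit '' p.1.carrier)ᶜ := fun g hg => by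
  refine C0.apply_eq_zero (u := p.1 * p.1⁻¹) (ξ.toFun p) fun h => hg ?_
  obtain ⟨k, hk, e⟩ := mem_mul_inv_self h
  exact ⟨k, hk, Subtype.ext (by change rng k = rng g; rw [← e, rng_rng])⟩

variable [LocallyCompactSpace (units G)]

/-- The coefficient at p vanishes at infinity on r(p) but need not be compactly supported there.
Cutting it off keeps its norm bound, which is needed for uniform estimates of the products. -/
theorem exists_coeff_approx (ξ : (A.toFellBundle S).FinSection) {δ : ℝ} (hδ : 0 < δ) :
    ∃ c : S.toSubmonoid → A.C0 (1 : Bis G), (∀ p, ‖coeff ξ p - c p‖ ≤ δ) ∧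
      (∀ p, ‖c p‖ ≤ ‖coeff ξ p‖) ∧ ∀ F : Finset S.toSubmonoid, rangeSec F c ∈ A.CcRange := by
  have h : ∀ p : S.toSubmonoid, ∃ χ : C(units G, unitInterval),
      (∃ L ⊆ rngUnit '' p.1.carrier, IsCompact L ∧ ∀ x ∉ L, χ x = 0) ∧
      ‖coeff ξ p - C0.cut χ (coeff ξ p)‖ ≤ δ := fun p =>
    C0.exists_cut_norm_sub_le (coeff ξ p) (EtaleGroupoid.isOpenMap_rng _ p.1.2.isOpen)
      (vanishesOn_coeff ξ p) hδ
  choose χ hχ hle using h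
  refine ⟨fun p => C0.cut (χ p) (coeff ξ p), hle, fun p => C0.norm_cut_le _ _, fun F => ?_⟩
  rw [rangeSec_eq_sum_single]
  refine sum_mem fun p _ => ?_
  obtain ⟨L, hL, hLc, h0⟩ := hχ p
  exact single_mem_CcRange p.1 _ hLc hL (C0.vanishesOn_cut_of_zero _ h0)

theorem exists_mem_CcRange_approx (ξ : (A.toFellBundle S).FinSection) {ε : ℝ} (hε : 0 < ε) :
    ∃ η ∈ A.CcRange, (∀ x, ‖sqSum (toRange ξ) x - sqSum η x‖ ≤ ε) ∧
      ∀ (f : ∀ g, A.Fib g) g, ‖average (toRange ξ) f g - average η f g‖ ≤ ε * ‖f g‖ := by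
  classical
  set F := ξ.finite_support.toFinset with hF
  set M : ℝ := ∑ p ∈ F, ‖coeff ξ p‖ with hM
  have hM0 : 0 ≤ M := Finset.sum_nonneg fun _ _ => norm_nonneg _
  have hcM : ∀ p ∈ F, ‖coeff ξ p‖ ≤ M := fun p hp =>
    Finset.single_le_sum (f := fun p => ‖coeff ξ p‖) (fun _ _ => norm_nonneg _) hp
  set N : ℝ := ((F ×ˢ F).card : ℝ) with hN
  have hN0 : 0 ≤ N := Nat.cast_nonneg _
  -- Each of the N pairs of bisections contributes an error of at most 2Mδ, with M a common bound
  -- for the coefficients; the summand 1 keeps the denominator positive.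
  set δ : ℝ := ε / (N * (2 * M) + 1) with hδ
  have hδ0 : 0 < δ := by positivity
  have hbd : N * (2 * M * δ) ≤ ε := by
    have h1 : δ * (N * (2 * M) + 1) = ε := div_mul_cancel₀ _ (by positivity)
    nlinarith
  obtain ⟨c, hc, hcle, hmem⟩ := exists_coeff_approx ξ hδ0
  refine ⟨rangeSec F c, hmem F, fun x => ?_, fun f g => ?_⟩
  · rw [toRange, sqSum_rangeSec, sqSum_rangeSec]
    refine (norm_sum_ite_sub_sum_ite_le _ _ _ _ (by positivity) fun q hq => ?_).trans hbd
    obtain ⟨hq1, hq2⟩ := Finset.mem_product.1 hq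
    exact norm_star_mul_sub_le (hcM _ hq2) ((hcle _).trans (hcM _ hq1)) (hc _) (hc _) x
  · rw [toRange, average_rangeSec, average_rangeSec]
    refine (norm_sum_ite_sub_sum_ite_le _ _ _ _ (C := 2 * M * δ * ‖f g‖) (by positivity)
      fun q hq => ?_).trans ?_
    · obtain ⟨hq1, hq2⟩ := Finset.mem_product.1 hq
      exact norm_avgTerm_sub_le (hcM _ hq2) ((hcle _).trans (hcM _ hq1)) (hc _) (hc _) g _
    · refine le_trans (le_of_eq ?_) (mul_le_mul_of_nonneg_right hbd (norm_nonneg _))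
      ring

end Perturbation

/-! ### The two approximation properties imply each other -/

section Equivalence

variable {G : Type u} [TopologicalSpace G] [TopGroupoid G] {A : GroupoidFellBundle.{u, v} G}
  [EtaleGroupoid G] {S : InverseSubmonoid (Bis G)}

theorem avgTerm_add (c : S.toSubmonoid → A.C0 (1 : Bis G)) (q : S.toSubmonoid × S.toSubmonoid)
    (g : G) (b b' : A.Fib g) : avgTerm c q g (b + b') = avgTerm c q g b + avgTerm c q g b' := by
  simp only [avgTerm, map_add, LinearMap.add_apply]

theorem avgTerm_smul (c : S.toSubmonoid → A.C0 (1 : Bis G)) (q : S.toSubmonoid × S.toSubmonoid)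
    (g : G) (z : ℂ) (b : A.Fib g) : avgTerm c q g (z • b) = z • avgTerm c q g b := by
  simp only [avgTerm, map_smul, LinearMap.smul_apply]

variable [T2Space (units G)]

theorem average_toRange_add (ξ : (A.toFellBundle S).FinSection) (f f' : ∀ g, A.Fib g) (g : G) :
    average (toRange ξ) (f + f') g = average (toRange ξ) f g + average (toRange ξ) f' g := by
  classical
  simp only [toRange, average_rangeSec]
  rw [← Finset.sum_add_distrib]
  refine Finset.sum_congr rfl fun q _ => ?_
  split_ifs
  · rw [Pi.add_apply, avgTerm_add]
  · rw [add_zero]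

theorem average_toRange_smul (ξ : (A.toFellBundle S).FinSection) (z : ℂ) (f : ∀ g, A.Fib g)
    (g : G) : average (toRange ξ) (z • f) g = z • average (toRange ξ) f g := by
  classical
  simp only [toRange, average_rangeSec]
  rw [Finset.smul_sum]
  refine Finset.sum_congr rfl fun q _ => ?_
  split_ifs
  · rw [Pi.smul_apply, avgTerm_smul]
  · rw [smul_zero]

variable [LocallyCompactSpace (units G)]

/-- Compactly supported sections decompose along a wide inverse semigroup of bisections. -/
theorem Cc_le_span (hS : S.IsWide) : A.Cc ≤ Submodule.span ℂ
    {f : ∀ g, A.Fib g | ∃ (s : S.toSubmonoid) (a : A.C0 s.1), f = fun g => a.1 g} := by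
  refine Submodule.span_le.2 ?_
  rintro f ⟨u, hu, hc, K, hKu, hK, h0⟩
  obtain ⟨a, ha⟩ := exists_C0_of_isCompact ⟨u, hu⟩ hc hKu hK h0
  obtain ⟨n, t, ρ, hρ, hsum⟩ := exists_partition (hK.image continuous_rngUnit)
    (O := fun t : S.toSubmonoid => rngUnit '' (t.1.carrier ∩ u))
    (fun t => EtaleGroupoid.isOpenMap_rng _ (t.1.2.isOpen.inter hu.isOpen)) (by
      rintro _ ⟨g, hg, rfl⟩
      obtain ⟨t, ht, hgt⟩ := hS.1 g
      exact Set.mem_iUnion.2 ⟨⟨t, ht⟩, g, ⟨hgt, hKu hg⟩, rfl⟩)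
  have hf : f = ∑ i, fun g => (C0.cut (ρ i) a).1 g := funext fun g => by
    rw [Finset.sum_apply, ← C0.sum_apply, C0.sum_cut_eq (L := rngUnit '' K) _ hsum, ha]
    intro k hk
    rw [ha]
    exact h0 k fun h => hk ⟨k, h, rfl⟩
  rw [hf]
  refine sum_mem fun i _ => Submodule.subset_span ⟨t i, ⟨(C0.cut (ρ i) a).1, ?_⟩, rfl⟩
  refine C0.mem_of_eq_zero _ fun g hg => ?_
  by_cases hgu : g ∈ u
  · refine C0.cut_apply_of_eq_zero _ (hρ i _ ?_)
    rintro ⟨k, hk, e⟩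
    exact hg (hu.rng_inj hk.2 hgu (congrArg Subtype.val e) ▸ hk.1)
  · exact C0.apply_eq_zero _ hgu

theorem exists_norm_le_of_mem_Cc (hS : S.IsWide) {f : ∀ g, A.Fib g} (hf : f ∈ A.Cc) :
    ∃ C, ∀ g, ‖f g‖ ≤ C := by
  refine Submodule.span_induction (p := fun f _ => ∃ C, ∀ g, ‖f g‖ ≤ C) ?_ ?_ ?_ ?_
    (Cc_le_span hS hf)
  · rintro _ ⟨s, a, rfl⟩
    exact ⟨‖a‖, C0.norm_apply_le a⟩
  · exact ⟨0, fun g => by rw [Pi.zero_apply, norm_zero]⟩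
  · rintro f f' - - ⟨C, hC⟩ ⟨C', hC'⟩
    exact ⟨C + C', fun g => (norm_add_le _ _).trans (add_le_add (hC g) (hC' g))⟩
  · rintro z f - ⟨C, hC⟩
    refine ⟨‖z‖ * C, fun g => ?_⟩
    rw [Pi.smul_apply, norm_smul]
    exact mul_le_mul_of_nonneg_left (hC g) (norm_nonneg _)

/-- For C₀-sections over members of S the bidual norm dominates the supremum norm, and averaging is
linear in f. So convergence, uniform on all of G, passes to the span, which contains `Cc`. -/
theorem eventually_norm_average_toRange_sub_le (hS : S.IsWide) {ι : Type*} {l : Filter ι}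
    {ξ : ι → (A.toFellBundle S).FinSection}
    (h : ∀ (s : S.toSubmonoid) (a : (A.toFellBundle S).Fib s),
      Tendsto (fun i => (ξ i).average s a) l
        (𝓝 (NormedSpace.inclusionInDoubleDual ℂ ((A.toFellBundle S).Fib s) a)))
    {f : ∀ g, A.Fib g} (hf : f ∈ A.Cc) :
    ∀ ε > (0 : ℝ), ∀ᶠ i in l, ∀ g, ‖average (toRange (ξ i)) f g - f g‖ ≤ ε := by
  refine Submodule.span_induction (p := fun f _ => ∀ ε > (0 : ℝ), ∀ᶠ i in l, ∀ g,
    ‖average (toRange (ξ i)) f g - f g‖ ≤ ε) ?_ ?_ ?_ ?_ (Cc_le_span hS hf)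
  · rintro _ ⟨s, a, rfl⟩ ε hε
    filter_upwards [NormedSpace.tendsto_bidual_iff.1 (h s a) ε hε] with i hi g
    exact (norm_average_toRange_sub_le hS (ξ i) s a g).trans hi.le
  · intro ε hε
    refine Eventually.of_forall fun i g => ?_
    have := average_toRange_smul (ξ i) 0 0 g
    rw [zero_smul, zero_smul] at this
    rw [this, Pi.zero_apply, sub_zero, norm_zero]
    exact hε.le
  · intro f f' _ _ H H' ε hε
    filter_upwards [H _ (half_pos hε), H' _ (half_pos hε)] with i hi hi' g
    rw [average_toRange_add, Pi.add_apply, add_sub_add_comm]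
    exact (norm_add_le _ _).trans ((add_le_add (hi g) (hi' g)).trans_eq (add_halves ε))
  · intro z f _ H ε hε
    filter_upwards [H (ε / (‖z‖ + 1)) (by positivity)] with i hi g
    rw [average_toRange_smul, Pi.smul_apply, ← smul_sub, norm_smul]
    have h1 := hi g
    rw [le_div_iff₀ (by positivity)] at h1
    nlinarith [norm_nonneg (average (toRange (ξ i)) f g - f g)]

theorem hasApproximationProperty_of_toFellBundle (hS : S.IsWide)
    (h : (A.toFellBundle S).HasApproximationProperty) : A.HasApproximationProperty := by
  obtain ⟨ι, _, _, _, ξ, ⟨C, hC⟩, hξ⟩ := h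
  have hpos : ∀ n : ℕ, (0 : ℝ) < 1 / ((n : ℝ) + 1) := fun n => by positivity
  -- The second index measures the perturbation error 1/(n + 1), which is at most 1 for the bound
  -- and tends to 0 for the convergence.
  choose η hη hsq hav using fun q : ι × ℕ => exists_mem_CcRange_approx (ξ q.1) (hpos q.2)
  refine ⟨ι × ℕ, inferInstance, isDirectedOrder_prod, inferInstance, η, hη, ⟨C + 1, fun q x => ?_⟩,
    fun f hf K _ ε hε => ?_⟩
  · have h1 := hsq q x
    have h2 := (norm_sqSum_toRange_le hS (ξ q.1) x).trans (hC q.1)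
    have h3 := norm_sub_norm_le (sqSum (η q) x) (sqSum (toRange (ξ q.1)) x)
    rw [norm_sub_rev] at h3
    have h4 : 1 / ((q.2 : ℝ) + 1) ≤ 1 := by
      rw [div_le_one (by positivity)]
      linarith [Nat.cast_nonneg (α := ℝ) q.2]
    linarith
  · obtain ⟨B, hB⟩ := exists_norm_le_of_mem_Cc hS hf
    have h1 := eventually_norm_average_toRange_sub_le hS hξ hf (ε / 4) (by positivity)
    have h2 : ∀ᶠ n : ℕ in atTop, 1 / ((n : ℝ) + 1) < ε / (4 * (max B 0 + 1)) :=
      tendsto_one_div_add_atTop_nhds_zero_nat.eventually_lt_const (by positivity)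
    rw [← prod_atTop_atTop_eq]
    filter_upwards [h1.prod_mk h2] with q hq g _
    have e1 := hq.1 g
    have e2 := hav q f g
    have e3 : 1 / ((q.2 : ℝ) + 1) * ‖f g‖ ≤ ε / 4 := by
      have hf' : ‖f g‖ ≤ max B 0 + 1 := (hB g).trans (by linarith [le_max_left B 0])
      calc _ ≤ ε / (4 * (max B 0 + 1)) * (max B 0 + 1) :=
            mul_le_mul hq.2.le hf' (norm_nonneg _) (by positivity)
        _ = ε / 4 := by field_simp
    rw [norm_sub_rev] at e2
    have e4 := norm_add_le (average (η q) f g - average (toRange (ξ q.1)) f g)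
      (average (toRange (ξ q.1)) f g - f g)
    rw [sub_add_sub_cancel] at e4
    linarith

theorem exists_mem_Cc_norm_sub_le {s : Bis G} (a : A.C0 s) {δ : ℝ} (hδ : 0 < δ) :
    ∃ (b : ∀ g, A.Fib g) (K : Set G), b ∈ A.Cc ∧ IsCompact K ∧ (∀ g ∉ K, b g = 0) ∧
      ∀ g, ‖a.1 g - b g‖ ≤ δ := by
  obtain ⟨χ, ⟨L, hL, hLc, h0⟩, hle⟩ := C0.exists_cut_norm_sub_le a
    (U := rngUnit '' s.carrier) (EtaleGroupoid.isOpenMap_rng _ s.2.isOpen)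
    (fun g hg => C0.apply_eq_zero a fun h => hg ⟨g, h, rfl⟩) hδ
  have hK := isCompact_inter_preimage_rngUnit s hLc hL
  have hz : ∀ g ∉ s.carrier ∩ rngUnit ⁻¹' L, (C0.cut χ a).1 g = 0 := fun g hg => by
    by_cases hgs : g ∈ s
    · exact C0.cut_apply_of_eq_zero a (h0 _ fun h => hg ⟨hgs, h⟩)
    · exact C0.apply_eq_zero _ hgs
  exact ⟨fun g => (C0.cut χ a).1 g, _, Submodule.subset_span
    ⟨s.carrier, s.2, (C0.cut χ a).2.2.1, _, Set.inter_subset_left, hK, hz⟩, hK, hz,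
    fun g => (C0.norm_apply_le (a - C0.cut χ a) g).trans hle⟩

theorem toFellBundle_hasApproximationProperty (hS : S.IsWide)
    (h : A.HasApproximationProperty) : (A.toFellBundle S).HasApproximationProperty := by
  obtain ⟨ι, _, _, _, ξ, hmem, ⟨C₀, hC₀⟩, hξ⟩ := h
  choose η hη using fun i => exists_toRange_eq_of_mem_CcRange hS (hmem i)
  -- For an empty groupoid the given bound could be negative.
  obtain ⟨C, hC0, hC⟩ : ∃ C : ℝ, 0 ≤ C ∧ ∀ i x, ‖sqSum (ξ i) x‖ ≤ C :=
    ⟨max C₀ 0, le_max_right _ _, fun i x => (hC₀ i x).trans (le_max_left _ _)⟩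
  refine ⟨ι, inferInstance, inferInstance, inferInstance, η, ⟨C, fun i => ?_⟩, fun s a => ?_⟩
  · exact norm_sqSum_le hS (η i) hC0 (by rw [hη]; exact hC i)
  · refine NormedSpace.tendsto_bidual_iff.2 fun ε hε => ?_
    -- Three errors add up to (C + 2)δ = ε/2: Cδ from averaging a - b, δ from the convergence for b,
    -- and δ from a - b itself.
    set δ : ℝ := ε / (2 * (C + 2)) with hδ
    have hδ0 : 0 < δ := by positivity
    obtain ⟨b, K, hb, hK, hb0, hab⟩ := exists_mem_Cc_norm_sub_le (s := s.1) a hδ0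
    have hle : ∀ (f : ∀ g, A.Fib g) i g, ‖average (toRange (η i)) f g‖ ≤ C * ‖f g‖ :=
      fun f i g => norm_average_le (toRange (η i)) (finite_rangeSec_ne_zero _ _)
        (by rw [hη]; exact hC i) f g
    filter_upwards [hξ b hb K hK δ hδ0] with i hi
    refine lt_of_le_of_lt (norm_average_sub_le hS (η i) s a (C := ε / 2) (by positivity)
      fun g => ?_) (half_lt_self hε)
    -- The hypothesis controls only the compact set K; off K the section b vanishes, and by
    -- Cauchy–Schwarz so does its average.
    have h1 : ‖average (toRange (η i)) b g - b g‖ ≤ δ := by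
      by_cases hg : g ∈ K
      · rw [hη]
        exact (hi g hg).le
      · have := hle b i g
        rw [hb0 g hg, norm_zero, mul_zero] at this
        rw [hb0 g hg, sub_zero]
        exact this.trans hδ0.le
    have h2 := hle ((fun g => a.1 g) - b) i g
    have h3 : average (toRange (η i)) (fun g => a.1 g) g =
        average (toRange (η i)) ((fun g => a.1 g) - b) g + average (toRange (η i)) b g := by
      rw [← average_toRange_add, sub_add_cancel]
    have h4 : average (toRange (η i)) (fun g => a.1 g) g - a.1 g =
        average (toRange (η i)) ((fun g => a.1 g) - b) g +
          (average (toRange (η i)) b g - b g) - (a.1 g - b g) := by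
      rw [h3]
      abel
    have h5 : ‖average (toRange (η i)) ((fun g => a.1 g) - b) g‖ ≤ C * δ :=
      h2.trans (mul_le_mul_of_nonneg_left (hab g) hC0)
    have h6 : (C + 2) * δ = ε / 2 := by
      rw [hδ]
      field_simp
    refine (le_of_eq (congrArg norm h4)).trans ?_
    refine ((norm_sub_le _ _).trans (add_le_add (norm_add_le _ _) (hab g))).trans ?_
    linarith

end Equivalence

end GroupoidFellBundle

theorem theorem4p12 {G : Type u} [TopologicalSpace G] [TopGroupoid G] [EtaleGroupoid G]
    [LocallyCompactSpace G] [T2Space (TopGroupoid.units G)]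
    (S : InverseSubmonoid (Bis G)) (hS : S.IsWide) (A : GroupoidFellBundle.{u, v} G) :
    A.HasApproximationProperty ↔ (A.toFellBundle S).HasApproximationProperty := by
  have : LocallyCompactSpace (units G) := EtaleGroupoid.isOpen_units.locallyCompactSpace
  exact ⟨GroupoidFellBundle.toFellBundle_hasApproximationProperty hS,
    GroupoidFellBundle.hasApproximationProperty_of_toFellBundle hS⟩
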